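/- **Setting.** Fix $\gamma>0$, $m\in\mathbb R$ and one of four kinds of periodicity cell with fixed angles, with $J$ independent length scales. For $\kappa\in\mathbb R^J_+$ the reciprocal lattice matrix is $L_\kappa=\widetilde L\,\operatorname{diag}(\sqrt{\kappa})$, and $|L_\kappa k|^2=\Delta_k\kappa=\sum_{j=1}^J\Delta_k^j\kappa_j$ for $k\in\mathbb Z^3$: * orthorhombic: $J=3$, $\operatorname{diag}(l)=\operatorname{diag}(l_1,l_2,l_3)$, $\widetilde L=I$; * tetragonal: $J=2$, $\operatorname{diag}(l)=\operatorname{diag}(l_1,l_1,l_2)$, $\widetilde L=I$; * trigonal/hexagonal: $J=2$, $\operatorname{diag}(l)=\operatorname{diag}(l_1,l_1,l_2)$, $\widetilde L=\begin{pmatrix}1&1/2&0\\0&\sqrt3/2&0\\0&0&1\end{pmatrix}$; * cubic: $J=1$, $\operatorname{diag}(l)=l_1I$, $\widetilde L=I$. The cell is $\Omega_\kappa=\{2\pi (L_\kappa^{-1})^T s: s\in[0,1]^3\}$. Let $\mathcal G$ be a finite group (a space group modulo its lattice) represented by the motions $x\mapsto C_gx+2\pi(L_\kappa^{-1})^TD_g$,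 where $C_g$ is orthogonal, depends multiplicatively on $g$, commutes with all $\operatorname{diag}(l)$ and maps $\widetilde L\mathbb Z^3$ to itself, $D_g\in[0,1]^3$, and the motions compose as $\mathcal G$ does modulo lattice translations. Put $g.k=\widetilde L^{-1}C_g\widetilde Lk$ and $\alpha_g(k)=e^{2\pi i (g.k)\cdot D_g}$ for $k\in\mathbb Z^3$; let $\mathcal G.k$ be the orbit and $\mathcal G_k$ the stabilizer of $k$. Let $\mathcal Z$ be the set of those $k$ in a fixed fundamental domain (one element of each orbit) with $\sum_{g\in\mathcal G_k}\alpha_g(k)=|\mathcal G_k|$, and $\mathcal Z_0=\mathcal Z\setminus\{0\}$. For $b=(b_k)_{k\in\mathcal Z}$ let $\sigma(b)=\sum_{k\in\mathcal Z}b_k\sum_{k'\in\mathcal G.k}\widetilde\alpha(k,k')\,\mathrm e_{k'}$, where $\widetilde\alpha(k,k')=\alpha_g(k)^{-1}$ for any $g$ with $g.k=k'$. Let $\nu>1$, $\bar\kappa\in\mathbb R^J_+$, $\|k\|=\sqrt{\Delta_k\bar\kappa}$ and $\omega_k=|\mathcal G.k|\,\nu^{\|k\|}$. Norm $\mathbb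 C^J$ by $\max_j|\kappa_j|/\bar\kappa_j$, and let $\mathbf X_0$ be the Banach space of $b=(b_k)_{k\in\mathcal Z_0}$ with norm $\sum_{k}|b_k|\omega_k<\infty$. Let $(\mathbb I_*b)_k=\overline{\sigma(b)_{-k}}$ and $\mathbb I_*(\kappa,b)=(\kappa^*,\mathbb I_*b)$, where $\kappa^*$ is the componentwise complex conjugate of $\kappa$, and let $\mathcal S$ be the set of fixed points of $\mathbb I_*$ in $\mathbb C^J\times\mathbf X_0$. With $P(y)=\gamma^{-2}y-1+y^{-1}$, with $c=\sigma(m\mathrm e_0+b)$ and with $\langle c^3\rangle$ the convolution power, define for $\operatorname{Re}\kappa_j>0$ and $b\in\mathbf X_0$ $$\mathcal F(\kappa,b)=\Bigl[\Bigl(\tfrac12\sum_{k\ne0}P'(\Delta_k\kappa)\Delta_k^jc_kc_{-k}\Bigr)_{1\le j\le J},\ \Bigl(|\mathcal G.k|\bigl(P(\Delta_k\kappa)c_k+\langle c^3\rangle_k\bigr)\Bigr)_{k\in\mathcal Z_0}\Bigr].$$ Let $K>\sqrt{y_P}$, where $y_P=\gamma$ if $\gamma\le2$ and $y_P=\frac12(\gamma^2+\sqrt{\gamma^4-4\gamma^2})$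 otherwise. Let $A$ be a complex-linear endomorphism (a matrix) of $\mathbb C^J\times\{b\in\mathbf X_0: b_k=0\text{ for }\|k\|>K\}$. Let $\mathcal A$ act as $A$ on the components in $\mathbb C^J$ and with $\|k\|\le K$, and as $b_k\mapsto b_k/(P(\Delta_k\bar\kappa)|\mathcal G.k|)$ on those with $\|k\|>K$. Put $T(x)=x-\mathcal A\mathcal F(x)$. For $r=(r_1,r_2)$ let $\mathcal B^{\mathcal S}_r(\bar x)$ be the set of $(\kappa,b)\in\mathcal S$ with $|\kappa-\bar\kappa|_{\mathbb C^J}\le r_1$ and $\|b-\bar b\|_{\mathbf X_0}\le r_2$. Write $\pi_1,\pi_2$ for the projections to $\mathbb C^J,\mathbf X_0$ and $D_1=D_\kappa$, $D_2=D_b$. **Theorem.** Assume $\bar x=(\bar\kappa,\bar b)\in\mathcal S$, $A$ is invertible and commutes with $\mathbb I_*$. Let $r^*\in\mathbb R^2_+$ with $r_1^*<1$, and let the nonnegative numbers $Y^{[i]},Z^{[i]}_{i'},W^{[i]}_{i'i''}$ ($i,i',i''\in\{1,2\}$) satisfy, in the norms above and the corresponding operator norms, $$\|\pi_i[T(\bar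 x)-\bar x]\|\le Y^{[i]},\qquad \|\pi_iD_{i'}T(\bar x)\|\le Z^{[i]}_{i'},$$ $$\|\pi_i[D_{i'}T(x)-D_{i'}T(\bar x)]\|\le W^{[i]}_{i'1}r_1+W^{[i]}_{i'2}r_2\quad\text{for all }x\in\mathcal B^{\mathcal S}_r(\bar x),\ 0\le r\le r^*.$$ Put $W^{[i]}_{i'}(r)=W^{[i]}_{i'1}r_1+W^{[i]}_{i'2}r_2$ and $\mathcal M(r)=\bigl(Z^{[i]}_{i'}+W^{[i]}_{i'}(r)\bigr)_{i,i'}$, and $$p_i(r)=Y^{[i]}-r_i+\sum_{i'=1}^2r_{i'}\bigl[Z^{[i]}_{i'}+\tfrac12W^{[i]}_{i'}(r)\bigr]\quad(i=1,2),$$ $$\widetilde p_3(r)=\operatorname{tr}\mathcal M(r)-2,\qquad \widetilde p_4(r)=\operatorname{tr}\mathcal M(r)-\det\mathcal M(r)-1 .$$ If $0<\hat r\le r^*$ (componentwise) and $p_1(\hat r),p_2(\hat r),\widetilde p_3(\hat r),\widetilde p_4(\hat r)<0$, then: (a) $\mathcal F$ has a unique zero $\hat x=(\hat\kappa,\hat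 b)$ in $\mathcal B^{\mathcal S}_{\hat r}(\bar x)$, and $\hat\kappa\in\mathbb R^J_+$; (b) with $\hat c=\sigma(m\mathrm e_0+\hat b)$, the function $\hat u(x)=\sum_{k\in\mathbb Z^3}\hat c_k\exp(iL_{\hat\kappa}k\cdot x)$ is a real-valued, $\mathcal G$-invariant classical solution of $-\Delta\bigl(\gamma^{-2}\Delta u+u-u^3\bigr)-(u-m)=0$ on $\mathbb R^3$, periodic with cell $\Omega_{\hat\kappa}$ and with average $m$; (c) the cell $\Omega_{\hat\kappa}$ is such that the energy is stationary under symmetry-respecting changes of its proportions: with $u_\kappa(x)=\sum_{k}\hat c_k\exp(iL_\kappa k\cdot x)$, real-valued for $\kappa\in\mathbb R^J_+$, and $v_\kappa$ the $\Omega_\kappa$-periodic solution of $-\Delta v_\kappa=u_\kappa-m$ with $\int_{\Omega_\kappa}v_\kappa=0$, the function $$\kappa\mapsto\frac1{|\Omega_\kappa|}\int_{\Omega_\kappa}\frac1{2\gamma^2}|\nabla u_\kappa|^2+\frac14(1-u_\kappa^2)^2+\frac12|\nabla v_\kappa|^2\,dx$$ on $\mathbb R^J_+$ is differentiable at $\hat\kappa$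 with derivative $0$. -/

import Mathlib

open scoped Matrix

noncomputable section

namespace OhtaKawasaki

/-- Points of `ℝ³`. -/
abbrev E3 : Type := EuclideanSpace ℝ (Fin 3)

/-- Fourier indices `k ∈ ℤ³`. -/
abbrev Idx : Type := Fin 3 → ℤ

/-- A Fourier index as a real vector. -/
def Idx.toReal (k : Idx) : Fin 3 → ℝ := fun i => (k i : ℝ)

/-! ### Periodicity cells with fixed angles -/

/-- The four kinds of periodicity cell with a priori fixed angles; `hexagonal` is the kind shared
by the trigonal and the hexagonal groups. -/
inductive Cell : Type
  | orthorhombic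
  | tetragonal
  | hexagonal
  | cubic

namespace Cell

/-- The number `J` of independent length scales. -/
def J : Cell → ℕ
  | orthorhombic => 3
  | tetragonal => 2
  | hexagonal => 2
  | cubic => 1

/-- The length scale to which each of the three coordinates is linked. -/
def scaleOf : (t : Cell) → Fin 3 → Fin t.J
  | orthorhombic => ![(0 : Fin 3), (1 : Fin 3), (2 : Fin 3)]
  | tetragonal => ![(0 : Fin 2), (0 : Fin 2), (1 : Fin 2)]
  | hexagonal => ![(0 : Fin 2), (0 : Fin 2), (1 : Fin 2)]
  | cubic => ![(0 : Fin 1), (0 : Fin 1), (0 : Fin 1)]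

/-- The dilation matrix of the length scales `l`. -/
def dilation (t : Cell) (l : Fin t.J → ℝ) : Matrix (Fin 3) (Fin 3) ℝ :=
  Matrix.diagonal fun i => l (t.scaleOf i)

/-- The fixed factor `L̃` of the reciprocal lattice matrix. -/
def Ltilde : Cell → Matrix (Fin 3) (Fin 3) ℝ
  | hexagonal => !![1, 1 / 2, 0; 0, Real.sqrt 3 / 2, 0; 0, 0, 1]
  | _ => 1

/-- `L_κ = L̃ · dilation(√κ)`. -/
def L (t : Cell) (κ : Fin t.J → ℝ) : Matrix (Fin 3) (Fin 3) ℝ :=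
  t.Ltilde * t.dilation fun j => Real.sqrt (κ j)

/-- The coefficients `Δ_k^j` in `|L_κ k|² = Δ_k κ = ∑_j Δ_k^j κ_j`. -/
def Del : (t : Cell) → Idx → Fin t.J → ℝ
  | orthorhombic, k => (![(k 0 : ℝ) ^ 2, (k 1 : ℝ) ^ 2, (k 2 : ℝ) ^ 2] : Fin 3 → ℝ)
  | tetragonal, k => (![(k 0 : ℝ) ^ 2 + (k 1 : ℝ) ^ 2, (k 2 : ℝ) ^ 2] : Fin 2 → ℝ)
  | hexagonal, k =>
      (![(k 0 : ℝ) ^ 2 + (k 0 : ℝ) * (k 1 : ℝ) + (k 1 : ℝ) ^ 2, (k 2 : ℝ) ^ 2] : Fin 2 → ℝ)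
  | cubic, k => (![(k 0 : ℝ) ^ 2 + (k 1 : ℝ) ^ 2 + (k 2 : ℝ) ^ 2] : Fin 1 → ℝ)

/-- `Δ_k κ` for complex length scales. -/
def DelC (t : Cell) (k : Idx) (κ : Fin t.J → ℂ) : ℂ := ∑ j, (t.Del k j : ℂ) * κ j

/-- The point `2π (L_κ⁻¹)ᵀ s` of `ℝ³`, whose coordinates relative to the periodicity cell
are `s`. -/
def latticePoint (t : Cell) (κ : Fin t.J → ℝ) (s : Fin 3 → ℝ) : E3 :=
  WithLp.toLp 2 ((2 * Real.pi) • (((t.L κ)⁻¹)ᵀ *ᵥ s))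

/-- The periodicity cell `Ω_κ`. -/
def Omega (t : Cell) (κ : Fin t.J → ℝ) : Set E3 :=
  {x | ∃ s : Fin 3 → ℝ, (∀ i, s i ∈ Set.Icc (0 : ℝ) 1) ∧ x = t.latticePoint κ s}

/-- `u` is periodic with periodicity cell `Ω_κ`. -/
def Periodic (t : Cell) (κ : Fin t.J → ℝ) (u : E3 → ℝ) : Prop :=
  ∀ (n : Idx) (x : E3), u (x + t.latticePoint κ n.toReal) = u x

/-- The wave `x ↦ exp(i L_κ k · x)`. -/
def wave (t : Cell) (κ : Fin t.J → ℝ) (k : Idx) (x : E3) : ℂ :=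
  Complex.exp (Complex.I * ((t.L κ *ᵥ k.toReal) ⬝ᵥ (x : Fin 3 → ℝ) : ℝ))

end Cell

/-! ### The equation and the energy -/

/-- The Laplacian of a function on `ℝ³`. -/
def lap (u : E3 → ℝ) : E3 → ℝ := Laplacian.laplacian u

/-- `u` is a (classical) solution, periodic with cell `Ω_κ` and with average `m`, of
`-Δ(γ⁻² Δu + u - u³) - (u - m) = 0`. -/
structure IsPeriodicSolution (t : Cell) (γ m : ℝ) (κ : Fin t.J → ℝ) (u : E3 → ℝ) : Prop where
  contDiff : ContDiff ℝ 4 u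
  periodic : t.Periodic κ u
  average : (⨍ x in t.Omega κ, u x) = m
  pde : ∀ x, -lap (fun y => 1 / γ ^ 2 * lap u y + u y - u y ^ 3) x - (u x - m) = 0

/-- `v` is the solution of `-Δv = u - m` which is periodic with cell `Ω_κ` and satisfies
`∫ v = 0`. -/
structure IsPotential (t : Cell) (m : ℝ) (κ : Fin t.J → ℝ) (u v : E3 → ℝ) : Prop where
  contDiff : ContDiff ℝ 2 v
  periodic : t.Periodic κ v
  mean_zero : (∫ x in t.Omega κ, v x) = 0
  poisson : ∀ x, -lap v x = u x - m

/-- The Ohta–Kawasaki energy of `u` per unit volume of the cell `Ω_κ`, where `v` is the potential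
of `u`. -/
def energy (t : Cell) (γ : ℝ) (κ : Fin t.J → ℝ) (u v : E3 → ℝ) : ℝ :=
  ⨍ x in t.Omega κ, (1 / (2 * γ ^ 2) * ‖gradient u x‖ ^ 2 + 1 / 4 * (1 - u x ^ 2) ^ 2
    + 1 / 2 * ‖gradient v x‖ ^ 2)

/-! ### Space groups -/

/-- A space group with the given kind of cell, modulo the lattice translations: `g` stands for the
motion `x ↦ C_g x + 2π (L_κ⁻¹)ᵀ D_g`, for every `κ`. -/
structure SpaceGroup (t : Cell) (G : Type*) [Group G] where
  C : G →* Matrix.orthogonalGroup (Fin 3) ℝ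
  D : G → Fin 3 → ℝ
  D_mem : ∀ g i, D g i ∈ Set.Icc (0 : ℝ) 1
  /-- `C_g` has the block structure that is compatible with the independent length scales. -/
  comm : ∀ g (l : Fin t.J → ℝ), (∀ j, 0 < l j) →
    (C g : Matrix (Fin 3) (Fin 3) ℝ) * t.dilation l = t.dilation l * C g
  /-- The integer matrix of the lattice map `k ↦ L̃⁻¹ C_g L̃ k`. -/
  β : G → Matrix (Fin 3) (Fin 3) ℤ
  β_spec : ∀ g, t.Ltilde * (β g).map (fun n : ℤ => (n : ℝ)) = C g * t.Ltilde
  /-- The motion of `g * h` is the composition of those of `g` and `h`, modulo the lattice. -/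
  D_mul : ∀ g h, ∃ n : Idx, (t.Ltilde⁻¹)ᵀ *ᵥ (D (g * h) + n.toReal) =
    (C g : Matrix (Fin 3) (Fin 3) ℝ) *ᵥ ((t.Ltilde⁻¹)ᵀ *ᵥ D h) + (t.Ltilde⁻¹)ᵀ *ᵥ D g

namespace SpaceGroup

variable {t : Cell} {G : Type*} [Group G] (S : SpaceGroup t G)

/-- `u(C_g x + 2π (L_κ⁻¹)ᵀ D_g) = u(x)` for all `g`. -/
def Invariant (κ : Fin t.J → ℝ) (u : E3 → ℝ) : Prop :=
  ∀ (g : G) (x : E3), u (WithLp.toLp 2 ((S.C g : Matrix (Fin 3) (Fin 3) ℝ) *ᵥ (x : Fin 3 → ℝ))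
    + t.latticePoint κ (S.D g)) = u x

/-- The action `g . k = L̃⁻¹ C_g L̃ k` on the Fourier indices. -/
def act (g : G) (k : Idx) : Idx := S.β g *ᵥ k

/-- `α_g(k) = exp(2πi (g . k) · D_g)`. -/
def α (g : G) (k : Idx) : ℂ :=
  Complex.exp (2 * Real.pi * Complex.I * ((S.act g k).toReal ⬝ᵥ S.D g : ℝ))

/-- The orbit of `k`. -/
def orbit (k : Idx) : Set Idx := Set.range fun g => S.act g k

/-- The number of elements of the orbit of `k`. -/
def orbCard (k : Idx) : ℕ := (S.orbit k).ncard

/-- The indices of the coefficients that may be nonzero in a symmetric sequence: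
`∑ α_g(k) = |G_k|`, the sum over the stabilizer `G_k` of `k`. -/
def Zsym [Fintype G] : Set Idx :=
  {k | ∑ g with S.act g k = k, S.α g k = ((Finset.univ.filter fun g => S.act g k = k).card : ℂ)}

open Classical in
/-- `α̃(k,k') = α_g(k)⁻¹` for a `g` with `g . k = k'`; by convention `0` if `k'` is not in the
orbit of `k`. -/
def αt (k k' : Idx) : ℂ := if h : ∃ g, S.act g k = k' then (S.α h.choose k)⁻¹ else 0

theorem orbCard_pos [Finite G] (k : Idx) : 0 < S.orbCard k :=
  (Set.ncard_pos (Set.finite_range _)).2 ⟨S.act 1 k, 1, rfl⟩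

end SpaceGroup

/-! ### Weighted coordinates -/

/-- The complex line with the norm `z ↦ w |z|`. -/
def WC (_w : Set.Ioi (0 : ℝ)) : Type := ℂ

namespace WC

variable {w : Set.Ioi (0 : ℝ)}

/-- The underlying complex number. -/
def val (z : WC w) : ℂ := z

/-- A complex number as an element of the weighted line. -/
def mk (z : ℂ) : WC w := z

instance : AddCommGroup (WC w) := inferInstanceAs (AddCommGroup ℂ)

instance : Module ℂ (WC w) := inferInstanceAs (Module ℂ ℂ)

instance : Norm (WC w) := ⟨fun z => (w : ℝ) * ‖z.val‖⟩

theorem norm_def (z : WC w) : ‖z‖ = (w : ℝ) * ‖z.val‖ := rfl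

theorem core : NormedSpace.Core ℂ (WC w) where
  norm_nonneg z := mul_nonneg (le_of_lt w.2) (norm_nonneg z.val)
  norm_smul c z := by
    change (w : ℝ) * ‖c * z.val‖ = ‖c‖ * ((w : ℝ) * ‖z.val‖)
    rw [norm_mul]; ring
  norm_triangle x y := by
    change (w : ℝ) * ‖x.val + y.val‖ ≤ (w : ℝ) * ‖x.val‖ + (w : ℝ) * ‖y.val‖
    rw [← mul_add]
    exact mul_le_mul_of_nonneg_left (norm_add_le _ _) (le_of_lt w.2)
  norm_eq_zero_iff z := by
    change (w : ℝ) * ‖z.val‖ = 0 ↔ z.val = (0 : ℂ)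
    rw [mul_eq_zero, norm_eq_zero]
    exact or_iff_right (ne_of_gt w.2)

instance : NormedAddCommGroup (WC w) := NormedAddCommGroup.ofCore core

instance : NormedSpace ℂ (WC w) := NormedSpace.ofCore core

end WC

/-! ### The zero finding problem -/

/-- `P(y) = γ⁻² y - 1 + y⁻¹`. -/
def P (γ : ℝ) (y : ℂ) : ℂ := 1 / (γ : ℂ) ^ 2 * y - 1 + 1 / y

/-- The derivative of `P`, that is `γ⁻² - y⁻²`. -/
def P' (γ : ℝ) (y : ℂ) : ℂ := 1 / (γ : ℂ) ^ 2 - 1 / y ^ 2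

/-- A bound beyond which `P` is positive and increasing. -/
def yP (γ : ℝ) : ℝ :=
  if γ ≤ 2 then γ else (γ ^ 2 + Real.sqrt (γ ^ 4 - 4 * γ ^ 2)) / 2

/-- The discrete convolution product. -/
def conv (c c' : Idx → ℂ) (k : Idx) : ℂ := ∑' k₁, c k₁ * c' (k - k₁)

/-- `f_k(κ,c) = P(Δ_k κ) c_k + ⟨c³⟩_k`. -/
def f (t : Cell) (γ : ℝ) (κ : Fin t.J → ℂ) (c : Idx → ℂ) (k : Idx) : ℂ :=
  P γ (t.DelC k κ) * c k + conv c (conv c c) k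

/-- `h_j(κ,c) = ½ ∑_{k ≠ 0} P'(Δ_k κ) Δ_k^j c_k c_{-k}`. -/
def h (t : Cell) (γ : ℝ) (κ : Fin t.J → ℂ) (c : Idx → ℂ) (j : Fin t.J) : ℂ :=
  1 / 2 * ∑' k : {k : Idx // k ≠ 0},
    P' γ (t.DelC k κ) * (t.Del k j : ℂ) * c k * c (-k)

/-- The data of the fixed point problem: a space group and a fundamental domain for its action on
the Fourier indices, the parameters `γ > 0` and `m` of the equation, the decay rate `ν > 1`, the
length scale part `κ̄` of the approximate zero, and the cut-off `K > √y_P`. -/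
structure Setup (t : Cell) (G : Type*) [Group G] extends SpaceGroup t G where
  dom : Set Idx
  dom_spec : ∀ k, ∃! k', k' ∈ dom ∧ k' ∈ toSpaceGroup.orbit k
  γ : ℝ
  γ_pos : 0 < γ
  m : ℝ
  ν : ℝ
  one_lt_ν : 1 < ν
  κbar : Fin t.J → ℝ
  κbar_pos : ∀ j, 0 < κbar j
  K : ℝ
  K_gt : Real.sqrt (yP γ) < K

namespace Setup

variable {t : Cell} {G : Type*} [Group G] [Fintype G] (S : Setup t G)

/-- The symmetry reduced indices. -/
def Z : Set Idx := S.Zsym ∩ S.dom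

/-- The symmetry reduced indices other than `0`. -/
def Z0 : Set Idx := {k | k ∈ S.Z ∧ k ≠ 0}

/-- The norm `‖k‖ = (Δ_k κ̄)^{1/2}` of an index. -/
def knorm (k : Idx) : ℝ := Real.sqrt (∑ j, t.Del k j * S.κbar j)

/-- The weight `ω_k = |G.k| ν^{‖k‖}`, which is positive. -/
def ω (k : Idx) : Set.Ioi (0 : ℝ) :=
  ⟨(S.orbCard k : ℝ) * S.ν ^ S.knorm k,
    mul_pos (Nat.cast_pos.2 (S.orbCard_pos k))
      (Real.rpow_pos_of_pos (zero_lt_one.trans S.one_lt_ν) _)⟩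

/-- `ℂ^J` with the norm `max_j |κ_j| / κ̄_j`. -/
abbrev CJ : Type := (j : Fin t.J) → WC ⟨(S.κbar j)⁻¹, inv_pos.2 (S.κbar_pos j)⟩

/-- The Banach space `X₀` of sequences `(b_k)`, `k ∈ Z₀`, with the norm `∑ |b_k| ω_k`. -/
abbrev X0 : Type := lp (fun k : S.Z0 => WC (S.ω k)) 1

variable {S} in
/-- The complex numbers `κ_j`. -/
def coords (κ : S.CJ) : Fin t.J → ℂ := fun j => (κ j).val

variable {S} in
/-- The sequence of complex numbers underlying an element of `X₀`. -/
def seq (b : S.X0) : S.Z0 → ℂ := fun k => (b k).val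

/-- A vector of complex numbers as an element of `ℂ^J` with its norm. -/
def toCJ (κ : Fin t.J → ℂ) : S.CJ := fun j => WC.mk (κ j)

open Classical in
/-- A sequence with `∑ |b_k| ω_k < ∞` as an element of `X₀` (and, by convention, `0` for the
sequences with an infinite sum). -/
def toX0 (b : S.Z0 → ℂ) : S.X0 :=
  if hb : Memℓp (fun k : S.Z0 => (WC.mk (b k) : WC (S.ω k))) 1 then ⟨_, hb⟩ else 0

open Classical in
/-- The sequence `c₀ e₀ + b` indexed by `Z`. -/
def extend (c₀ : ℂ) (b : S.Z0 → ℂ) (k : S.Z) : ℂ :=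
  if hk : (k : Idx) = 0 then c₀ else b ⟨k, k.2, hk⟩

/-- `σ(b) = ∑_{k ∈ Z} b_k ∑_{k' ∈ G.k} α̃(k,k') e_{k'}` (in each coordinate at most one term of the
outer sum is nonzero). -/
def σ (b : S.Z → ℂ) (k' : Idx) : ℂ := ∑' k : S.Z, b k * S.αt k k'

/-- The Fourier coefficients `σ(m e₀ + b)`. -/
def coeff (b : S.Z0 → ℂ) : Idx → ℂ := S.σ (S.extend S.m b)

/-- The conjugation `(I_* b)_k = conj (σ(b)_{-k})`. -/
def conjSeq (b : S.Z0 → ℂ) (k : S.Z0) : ℂ := starRingEnd ℂ (S.σ (S.extend 0 b) (-(k : Idx)))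

/-- The set of conjugate symmetric elements of `ℂ^J × X₀`. -/
def symm : Set (S.CJ × S.X0) :=
  {x | (∀ j, starRingEnd ℂ (coords x.1 j) = coords x.1 j) ∧ S.conjSeq (seq x.2) = seq x.2}

/-- The map `𝓕(κ,b) = [(h_j)_j, (|G.k| f_k)_{k ∈ Z₀}]`, evaluated at `(κ, σ(m e₀ + b))`. -/
def F (x : S.CJ × S.X0) : (Fin t.J → ℂ) × (S.Z0 → ℂ) :=
  (fun j => h t S.γ (coords x.1) (S.coeff (seq x.2)) j,
   fun k => (S.orbCard k : ℂ) * f t S.γ (coords x.1) (S.coeff (seq x.2)) k)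

/-! ### The fixed point operator -/

/-- The finite set of the indices in `Z₀` with `‖k‖ ≤ K`. -/
def ZK : Set S.Z0 := {k | S.knorm k ≤ S.K}

/-- The finite dimensional space `ℂ^J × X₀^K`, in coordinates. -/
abbrev Fin0 : Type := (Fin t.J → ℂ) × (S.ZK → ℂ)

/-- The projection onto `ℂ^J × X₀^K`. -/
def proj (y : (Fin t.J → ℂ) × (S.Z0 → ℂ)) : S.Fin0 := (y.1, fun k => y.2 k)

open Classical in
/-- The inclusion of `ℂ^J × X₀^K`. -/
def incl (y : S.Fin0) : (Fin t.J → ℂ) × (S.Z0 → ℂ) :=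
  (y.1, fun k => if hk : k ∈ S.ZK then y.2 ⟨k, hk⟩ else 0)

/-- The conjugation `I_*` on `ℂ^J × X₀^K`. -/
def conjFin (y : S.Fin0) : S.Fin0 :=
  S.proj (fun j => starRingEnd ℂ ((S.incl y).1 j), S.conjSeq (S.incl y).2)

open Classical in
/-- The diagonal operator `Λ⁻¹`, which vanishes on the indices with `‖k‖ ≤ K`. -/
def Λinv (b : S.Z0 → ℂ) (k : S.Z0) : ℂ :=
  if k ∈ S.ZK then 0
  else 1 / (P S.γ (t.DelC k fun j => (S.κbar j : ℂ)) * (S.orbCard k : ℂ)) * b k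

/-- The operator `𝒜`, which acts as `A` on `ℂ^J × X₀^K` and as `Λ⁻¹` on the tail. -/
def AA (A : Module.End ℂ S.Fin0) (y : (Fin t.J → ℂ) × (S.Z0 → ℂ)) :
    (Fin t.J → ℂ) × (S.Z0 → ℂ) :=
  S.incl (A (S.proj y)) + (0, S.Λinv y.2)

/-- The operator `T(x) = x - 𝒜 𝓕(x)`. -/
def T (A : Module.End ℂ S.Fin0) (x : S.CJ × S.X0) : S.CJ × S.X0 :=
  (x.1 - S.toCJ (S.AA A (S.F x)).1, S.toX0 (seq x.2 - (S.AA A (S.F x)).2))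

/-- `π_κ D_κ T(x)`. -/
def Dκκ (A : Module.End ℂ S.Fin0) (x : S.CJ × S.X0) : S.CJ →L[ℂ] S.CJ :=
  fderiv ℂ (fun κ => (S.T A (κ, x.2)).1) x.1

/-- `π_κ D_b T(x)`. -/
def Dκb (A : Module.End ℂ S.Fin0) (x : S.CJ × S.X0) : S.X0 →L[ℂ] S.CJ :=
  fderiv ℂ (fun b => (S.T A (x.1, b)).1) x.2

/-- `π_b D_κ T(x)`. -/
def Dbκ (A : Module.End ℂ S.Fin0) (x : S.CJ × S.X0) : S.CJ →L[ℂ] S.X0 :=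
  fderiv ℂ (fun κ => (S.T A (κ, x.2)).2) x.1

/-- `π_b D_b T(x)`. -/
def Dbb (A : Module.End ℂ S.Fin0) (x : S.CJ × S.X0) : S.X0 →L[ℂ] S.X0 :=
  fderiv ℂ (fun b => (S.T A (x.1, b)).2) x.2

/-- The approximate zero `x̄ = (κ̄, b̄)`. -/
def xbar (b : S.X0) : S.CJ × S.X0 := (S.toCJ fun j => (S.κbar j : ℂ), b)

/-- The conjugate symmetric ball with radii `r 0` and `r 1` (for the two components). -/
def ball (r : Fin 2 → ℝ) (x : S.CJ × S.X0) : Set (S.CJ × S.X0) :=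
  {y | ‖y.1 - x.1‖ ≤ r 0 ∧ ‖y.2 - x.2‖ ≤ r 1} ∩ S.symm

/-- The bounds `Y`, `Z`, `W` on the residual and on the derivatives of `T`, for all radii up to
`rs`; the indices `0` and `1` stand for the components in `ℂ^J` and in `X₀`. -/
structure Bounds (A : Module.End ℂ S.Fin0) (b : S.X0) (rs : Fin 2 → ℝ)
    (Y : Fin 2 → ℝ) (Z : Fin 2 → Fin 2 → ℝ) (W : Fin 2 → Fin 2 → Fin 2 → ℝ) : Prop where
  Y0 : ‖(S.T A (S.xbar b) - S.xbar b).1‖ ≤ Y 0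
  Y1 : ‖(S.T A (S.xbar b) - S.xbar b).2‖ ≤ Y 1
  Z00 : ‖S.Dκκ A (S.xbar b)‖ ≤ Z 0 0
  Z01 : ‖S.Dκb A (S.xbar b)‖ ≤ Z 0 1
  Z10 : ‖S.Dbκ A (S.xbar b)‖ ≤ Z 1 0
  Z11 : ‖S.Dbb A (S.xbar b)‖ ≤ Z 1 1
  W00 : ∀ r : Fin 2 → ℝ, 0 ≤ r → r ≤ rs → ∀ x ∈ S.ball r (S.xbar b),
    ‖S.Dκκ A x - S.Dκκ A (S.xbar b)‖ ≤ W 0 0 0 * r 0 + W 0 0 1 * r 1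
  W01 : ∀ r : Fin 2 → ℝ, 0 ≤ r → r ≤ rs → ∀ x ∈ S.ball r (S.xbar b),
    ‖S.Dκb A x - S.Dκb A (S.xbar b)‖ ≤ W 0 1 0 * r 0 + W 0 1 1 * r 1
  W10 : ∀ r : Fin 2 → ℝ, 0 ≤ r → r ≤ rs → ∀ x ∈ S.ball r (S.xbar b),
    ‖S.Dbκ A x - S.Dbκ A (S.xbar b)‖ ≤ W 1 0 0 * r 0 + W 1 0 1 * r 1
  W11 : ∀ r : Fin 2 → ℝ, 0 ≤ r → r ≤ rs → ∀ x ∈ S.ball r (S.xbar b),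
    ‖S.Dbb A x - S.Dbb A (S.xbar b)‖ ≤ W 1 1 0 * r 0 + W 1 1 1 * r 1

end Setup

/-! ### Radii polynomials -/

section Radii

variable (Y : Fin 2 → ℝ) (Z : Fin 2 → Fin 2 → ℝ) (W : Fin 2 → Fin 2 → Fin 2 → ℝ) (r : Fin 2 → ℝ)

/-- The linear forms `W^{[i]}_{i'}(r)`. -/
def Wlin (i i' : Fin 2) : ℝ := W i i' 0 * r 0 + W i i' 1 * r 1

/-- The radii polynomial `p₁`. -/
def p₁ : ℝ :=
  Y 0 + r 0 * (Z 0 0 + 1 / 2 * Wlin W r 0 0 - 1) + r 1 * (Z 0 1 + 1 / 2 * Wlin W r 0 1)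

/-- The radii polynomial `p₂`. -/
def p₂ : ℝ :=
  Y 1 + r 0 * (Z 1 0 + 1 / 2 * Wlin W r 1 0) + r 1 * (Z 1 1 + 1 / 2 * Wlin W r 1 1 - 1)

/-- The matrix that controls contractivity. -/
def contrM : Matrix (Fin 2) (Fin 2) ℝ := Matrix.of fun i i' => Z i i' + Wlin W r i i'

/-- The radii polynomial `p̃₃`. -/
def p₃ : ℝ := (contrM Z W r).trace - 2

/-- The radii polynomial `p̃₄`. -/
def p₄ : ℝ := (contrM Z W r).trace - (contrM Z W r).det - 1

end Radii

end OhtaKawasaki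

end

noncomputable section

namespace OhtaKawasaki

/-! ### Geometry of the periodicity cells -/

namespace Cell

/-! Zeros of 𝓕 are found as fixed points of the Newton-like map T = id - 𝒜𝓕. The operator 𝒜 is
injective: A is invertible on the finite block, and on the tail P(Δ_k κ̄) > 0 because K² > y_P
(`exists_le_P`). Hence zeros and fixed points agree where Re κ_j > 0 (`F_eq_zero_of_T_eq_self`,
`T_eq_self_of_F_eq_zero`).

On that domain T is differentiable (`differentiableAt_T`). Since P grows at least linearly beyond
y_P, the factor 1/P(Δ_k κ̄) compensates the unbounded multiplier P(Δ_k κ): the product is an affine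
combination of the bounded sequence Δ_k κ / Δ_k κ̄ and of its inverse in the Banach algebra ℓ^∞,
where inversion is differentiable. The cubic term is a convolution power in ℓ¹ with the
submultiplicative weight ν^‖k‖, and this exponential weight also absorbs the factor Δ_k^j in h_j.

The derivative bounds hold at conjugate symmetric points only. These form a closed real subspace, so
segments stay inside, and T preserves it (`T_mem_symm`). Integrating the bounds along segments from
x̄ produces the factor ½, and p₁, p₂ < 0 says that the ball is mapped into itself. The conditions on
p̃₃ and p̃₄ say that the nonnegative matrix M of derivative bounds has spectral radius below one, so
that M v ≤ θ v for some positive vector v and some θ < 1; the iterates then contract geometrically,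
the two components being measured against v₁ and v₂ (`exists_unique_fixedPoint_of_bounds`).

At the zero, equivariance extends f_k = 0 from Z₀ to all k ≠ 0. As ν > 1, all moments of the
coefficients are finite for every positive κ, so the Fourier series may be differentiated term by
term, and the k-th coefficient of the residual of the equation is -Δ_k f_k
(`isPeriodicSolution_reSum`). In relative coordinates the plane waves do not depend on κ. The
quartic part of the energy is therefore constant in κ, and what remains is ∑ ½ (γ⁻² Δ_k κ + 1/Δ_k κ)
|c_k|², whose partial derivatives are the h_j (`energy_reSum`, `energy_stationary`). -/

theorem Ltilde_comm_dilation (t : Cell) (l : Fin t.J → ℝ) :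
    t.Ltilde * t.dilation l = t.dilation l * t.Ltilde := by
  cases t
  case hexagonal =>
    ext i j
    fin_cases i <;> fin_cases j <;>
      simp [Ltilde, dilation, scaleOf, Matrix.mul_apply, Fin.sum_univ_three, mul_comm]
  all_goals simp [Ltilde]

theorem Ltilde_det_ne (t : Cell) : t.Ltilde.det ≠ 0 := by
  cases t
  case hexagonal => simp [Ltilde, Matrix.det_fin_three]
  all_goals simp [Ltilde]

theorem L_det_ne (t : Cell) {κ : Fin t.J → ℝ} (hκ : ∀ j, 0 < κ j) : (t.L κ).det ≠ 0 := by
  rw [L, Matrix.det_mul]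
  refine mul_ne_zero t.Ltilde_det_ne ?_
  rw [dilation, Matrix.det_diagonal]
  exact Finset.prod_ne_zero_iff.2 fun i _ => (Real.sqrt_pos.2 (hκ _)).ne'

theorem isUnit_L_det (t : Cell) {κ : Fin t.J → ℝ} (hκ : ∀ j, 0 < κ j) : IsUnit (t.L κ).det :=
  (t.L_det_ne hκ).isUnit

/-- `|L̃ diag(l) k|² = ∑_j Δ_k^j l_j²`. -/
theorem dot_Ltilde_dilation (t : Cell) (l : Fin t.J → ℝ) (k : Idx) :
    ((t.Ltilde * t.dilation l) *ᵥ k.toReal) ⬝ᵥ ((t.Ltilde * t.dilation l) *ᵥ k.toReal)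
      = ∑ j, t.Del k j * l j ^ 2 := by
  have h3 : Real.sqrt 3 * Real.sqrt 3 = 3 := Real.mul_self_sqrt (by norm_num)
  rw [← Matrix.mulVec_mulVec]
  cases t
  case orthorhombic =>
    change _ = ∑ j : Fin 3, _
    simp [Ltilde, dilation, scaleOf, Matrix.mulVec_diagonal, dotProduct, Fin.sum_univ_three,
      Del, Idx.toReal]
    ring
  case tetragonal =>
    change _ = ∑ j : Fin 2, _
    simp [Ltilde, dilation, scaleOf, Matrix.mulVec_diagonal, dotProduct, Fin.sum_univ_three,
      Fin.sum_univ_two, Del, Idx.toReal]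
    ring
  case hexagonal =>
    change _ = ∑ j : Fin 2, _
    simp [Ltilde, dilation, scaleOf, Matrix.mulVec, dotProduct,
      Fin.sum_univ_three, Fin.sum_univ_two, Del, Idx.toReal, Matrix.diagonal]
    -- The second row contributes (√3/2)² = 3/4, which completes the 1/4 coming from the first row.
    linear_combination (1 / 4 * l (0 : Fin 2) ^ 2 * (k 1 : ℝ) ^ 2) * h3
  case cubic =>
    change _ = ∑ j : Fin 1, _
    simp [Ltilde, dilation, scaleOf, Matrix.mulVec_diagonal, dotProduct, Fin.sum_univ_three,
      Del, Idx.toReal]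
    ring

theorem dot_L (t : Cell) {κ : Fin t.J → ℝ} (hκ : ∀ j, 0 ≤ κ j) (k : Idx) :
    (t.L κ *ᵥ k.toReal) ⬝ᵥ (t.L κ *ᵥ k.toReal) = ∑ j, t.Del k j * κ j := by
  rw [L, dot_Ltilde_dilation]
  exact Finset.sum_congr rfl fun j _ => by rw [Real.sq_sqrt (hκ j)]

theorem Del_nonneg (t : Cell) (k : Idx) (j : Fin t.J) : 0 ≤ t.Del k j := by
  cases t
  case hexagonal =>
    revert j
    change ∀ j : Fin 2, _
    intro j
    fin_cases j
    · simp only [Del]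
      simp
      nlinarith [sq_nonneg ((k 0 : ℝ) + k 1), sq_nonneg (k 0 : ℝ), sq_nonneg (k 1 : ℝ)]
    · simp only [Del]
      simp
      positivity
  case orthorhombic =>
    revert j
    change ∀ j : Fin 3, _
    intro j
    fin_cases j <;> simp only [Del] <;> simp <;> positivity
  case tetragonal =>
    revert j
    change ∀ j : Fin 2, _
    intro j
    fin_cases j <;> simp only [Del] <;> simp <;> positivity
  case cubic =>
    revert j
    change ∀ j : Fin 1, _
    intro j
    fin_cases j
    simp only [Del]
    simp
    positivity

/-- The factor 2 is needed for the hexagonal form only: 2(a² + ab + b²) - a² = (a + b)² + b². -/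
theorem sq_le_Del (t : Cell) (k : Idx) (i : Fin 3) : (k i : ℝ) ^ 2 ≤ 2 * ∑ j, t.Del k j := by
  have h : ∀ i, 0 ≤ (k i : ℝ) ^ 2 := fun i => sq_nonneg _
  have h0 := h 0
  have h1 := h 1
  have h2 := h 2
  have h01 := sq_nonneg ((k 0 : ℝ) + k 1)
  cases t
  case orthorhombic =>
    change _ ≤ 2 * ∑ j : Fin 3, _
    fin_cases i <;> simp [Del, Fin.sum_univ_three] <;> nlinarith
  case tetragonal =>
    change _ ≤ 2 * ∑ j : Fin 2, _
    fin_cases i <;> simp [Del, Fin.sum_univ_two] <;> nlinarith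
  case hexagonal =>
    change _ ≤ 2 * ∑ j : Fin 2, _
    fin_cases i <;> simp [Del, Fin.sum_univ_two] <;> nlinarith
  case cubic =>
    change _ ≤ 2 * ∑ j : Fin 1, _
    fin_cases i <;> simp [Del] <;> nlinarith

/-- The form `Δ_k κ` for real length scales. -/
def DelR (t : Cell) (k : Idx) (κ : Fin t.J → ℝ) : ℝ := ∑ j, t.Del k j * κ j

theorem DelC_ofReal (t : Cell) (k : Idx) (κ : Fin t.J → ℝ) :
    t.DelC k (fun j => (κ j : ℂ)) = (t.DelR k κ : ℂ) := by
  simp [DelC, DelR]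

theorem DelR_nonneg (t : Cell) (k : Idx) {κ : Fin t.J → ℝ} (hκ : ∀ j, 0 ≤ κ j) :
    0 ≤ t.DelR k κ :=
  Finset.sum_nonneg fun j _ => mul_nonneg (t.Del_nonneg k j) (hκ j)

theorem DelR_mono (t : Cell) (k : Idx) {κ κ' : Fin t.J → ℝ} (hκ : ∀ j, κ j ≤ κ' j) :
    t.DelR k κ ≤ t.DelR k κ' :=
  Finset.sum_le_sum fun j _ => mul_le_mul_of_nonneg_left (hκ j) (t.Del_nonneg k j)

theorem DelR_smul (t : Cell) (k : Idx) (a : ℝ) (κ : Fin t.J → ℝ) :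
    t.DelR k (fun j => a * κ j) = a * t.DelR k κ := by
  simp only [DelR, Finset.mul_sum]
  exact Finset.sum_congr rfl fun j _ => by ring

theorem exists_pos_le (t : Cell) {κ : Fin t.J → ℝ} (hκ : ∀ j, 0 < κ j) :
    ∃ a, 0 < a ∧ ∀ j, a ≤ κ j := by
  have : Nonempty (Fin t.J) := by cases t <;> exact ⟨(0 : Fin (_ + 1))⟩
  obtain ⟨j, -, hj⟩ := Finset.exists_min_image Finset.univ κ Finset.univ_nonempty
  exact ⟨κ j, hκ j, fun i => hj i (Finset.mem_univ i)⟩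

theorem exists_sq_le_DelR (t : Cell) {κ : Fin t.J → ℝ} (hκ : ∀ j, 0 < κ j) :
    ∃ a, 0 < a ∧ ∀ (k : Idx) i, a * (k i : ℝ) ^ 2 ≤ t.DelR k κ := by
  obtain ⟨a, ha, h⟩ := t.exists_pos_le hκ
  refine ⟨a / 2, by positivity, fun k i => ?_⟩
  have h1 : a * ∑ j, t.Del k j ≤ t.DelR k κ := by
    rw [Finset.mul_sum]
    exact Finset.sum_le_sum fun j _ => by
      rw [mul_comm]; exact mul_le_mul_of_nonneg_left (h j) (t.Del_nonneg k j)
  nlinarith [t.sq_le_Del k i]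

theorem exists_pos_le_DelR (t : Cell) {κ : Fin t.J → ℝ} (hκ : ∀ j, 0 < κ j) :
    ∃ a, 0 < a ∧ ∀ k : Idx, k ≠ 0 → a ≤ t.DelR k κ := by
  obtain ⟨a, ha, h⟩ := t.exists_sq_le_DelR hκ
  refine ⟨a, ha, fun k hk => ?_⟩
  obtain ⟨i, hi⟩ := Function.ne_iff.1 hk
  have h1 : (1 : ℝ) ≤ (k i : ℝ) ^ 2 := by
    have : 1 ≤ k i ^ 2 := by
      have := sq_pos_of_ne_zero (show k i ≠ 0 from hi)
      omega
    exact_mod_cast this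
  nlinarith [h k i]

theorem DelR_pos (t : Cell) {κ : Fin t.J → ℝ} (hκ : ∀ j, 0 < κ j) {k : Idx} (hk : k ≠ 0) :
    0 < t.DelR k κ := by
  obtain ⟨a, ha, h⟩ := t.exists_pos_le_DelR hκ
  exact ha.trans_le (h k hk)

theorem finite_DelR_le (t : Cell) {κ : Fin t.J → ℝ} (hκ : ∀ j, 0 < κ j) (R : ℝ) :
    {k : Idx | t.DelR k κ ≤ R}.Finite := by
  obtain ⟨a, ha, h⟩ := t.exists_sq_le_DelR hκ
  -- The extra 1 forces N ≥ 1 when R / a ≥ 0, so that R / a ≤ N ≤ N².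
  obtain ⟨N, hN⟩ := exists_nat_ge (R / a + 1)
  refine (Set.Finite.pi' fun _ : Fin 3 => Set.finite_Icc (-(N : ℤ)) N).subset fun k hk i => ?_
  have h1 : (k i : ℝ) ^ 2 ≤ R / a := by
    rw [le_div_iff₀ ha, mul_comm]; exact (h k i).trans hk
  have h2 : (k i : ℝ) ^ 2 ≤ (N : ℝ) ^ 2 := by nlinarith [sq_nonneg (k i : ℝ)]
  have h3 := abs_le_of_sq_le_sq' h2 (Nat.cast_nonneg N)
  exact ⟨by exact_mod_cast h3.1, by exact_mod_cast h3.2⟩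

theorem Del_zero (t : Cell) (j : Fin t.J) : t.Del 0 j = 0 := by
  have h := t.dot_L (κ := fun _ => 1) (fun _ => zero_le_one) 0
  have h0 : (0 : Idx).toReal = 0 := by ext; simp [Idx.toReal]
  rw [h0] at h
  simp only [Matrix.mulVec_zero, zero_dotProduct, mul_one] at h
  exact (Finset.sum_eq_zero_iff_of_nonneg fun j _ => t.Del_nonneg 0 j).1 h.symm j
    (Finset.mem_univ j)

theorem DelR_zero (t : Cell) (κ : Fin t.J → ℝ) : t.DelR 0 κ = 0 := by
  simp [DelR, Del_zero]

/-- The coefficients `Δ_k^j` are determined by the form `Δ_k`. -/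
theorem Del_eq_of_DelR_eq (t : Cell) {k k' : Idx}
    (h : ∀ κ : Fin t.J → ℝ, (∀ j, 0 < κ j) → t.DelR k κ = t.DelR k' κ) (j : Fin t.J) :
    t.Del k j = t.Del k' j := by
  have h1 := h (fun _ => 1) fun _ => one_pos
  -- Both test points are positive, as the hypothesis requires; their difference is the j-th unit
  -- vector and isolates one coefficient.
  have h2 := h (fun i => if i = j then 2 else 1) fun i => by split_ifs <;> norm_num
  have e : ∀ k : Idx, t.DelR k (fun i => if i = j then (2 : ℝ) else 1)
      = t.DelR k (fun _ => 1) + t.Del k j := by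
    intro k
    simp only [DelR]
    have : ∀ i, t.Del k i * (if i = j then (2 : ℝ) else 1)
        = t.Del k i * 1 + if i = j then t.Del k i else 0 := by
      intro i; split_ifs <;> ring
    simp [this, Finset.sum_add_distrib]
  rw [e, e, h1] at h2
  linarith

theorem Del_neg (t : Cell) (k : Idx) (j : Fin t.J) : t.Del (-k) j = t.Del k j := by
  cases t <;> simp [Del]

theorem DelC_neg (t : Cell) (k : Idx) (κ : Fin t.J → ℂ) : t.DelC (-k) κ = t.DelC k κ := by
  simp [DelC, Del_neg]

theorem DelR_neg (t : Cell) (k : Idx) (κ : Fin t.J → ℝ) : t.DelR (-k) κ = t.DelR k κ := by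
  simp [DelR, Del_neg]

theorem DelC_re (t : Cell) (k : Idx) (κ : Fin t.J → ℂ) :
    (t.DelC k κ).re = t.DelR k fun j => (κ j).re := by
  simp [DelC, DelR]

theorem DelR_le_norm_DelC (t : Cell) (k : Idx) (κ : Fin t.J → ℂ) :
    (t.DelR k fun j => (κ j).re) ≤ ‖t.DelC k κ‖ := by
  rw [← DelC_re]; exact Complex.re_le_norm _

theorem DelC_ne_zero (t : Cell) {k : Idx} (hk : k ≠ 0) {κ : Fin t.J → ℂ}
    (hκ : ∀ j, 0 < (κ j).re) : t.DelC k κ ≠ 0 := by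
  intro h
  have := t.DelR_le_norm_DelC k κ
  rw [h, norm_zero] at this
  exact absurd (t.DelR_pos hκ hk) (not_lt.2 this)

/-- The square root of Δ_k κ is the Euclidean norm of L_κ k, so this is the triangle inequality. It
makes the weight ν^‖k‖ submultiplicative. -/
theorem DelR_sqrt_add (t : Cell) {κ : Fin t.J → ℝ} (hκ : ∀ j, 0 ≤ κ j) (k k' : Idx) :
    Real.sqrt (t.DelR (k + k') κ) ≤ Real.sqrt (t.DelR k κ) + Real.sqrt (t.DelR k' κ) := by
  have e : ∀ k : Idx, Real.sqrt (t.DelR k κ)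
      = ‖(WithLp.toLp 2 (t.L κ *ᵥ k.toReal) : E3)‖ := by
    intro k
    rw [EuclideanSpace.norm_eq, DelR, ← t.dot_L hκ]
    simp [dotProduct, sq]
  have ha : (k + k').toReal = k.toReal + k'.toReal := by ext; simp [Idx.toReal]
  rw [e, e, e, ha, Matrix.mulVec_add, WithLp.toLp_add]
  exact norm_add_le _ _

end Cell

end OhtaKawasaki

namespace OhtaKawasaki

/-! ### Symmetric sequences -/

theorem Idx.toReal_add (k k' : Idx) : (k + k').toReal = k.toReal + k'.toReal := by
  ext; simp [Idx.toReal]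

theorem Idx.toReal_neg (k : Idx) : (-k).toReal = -k.toReal := by
  ext; simp [Idx.toReal]

theorem Idx.toReal_dot (k n : Idx) : k.toReal ⬝ᵥ n.toReal = ((k ⬝ᵥ n : ℤ) : ℝ) := by
  simp [Idx.toReal, dotProduct]

theorem Cell.dot_inv_transpose {M : Matrix (Fin 3) (Fin 3) ℝ} (hM : IsUnit M.det)
    (v w : Fin 3 → ℝ) : (M *ᵥ v) ⬝ᵥ ((M⁻¹)ᵀ *ᵥ w) = v ⬝ᵥ w := by
  rw [Matrix.dotProduct_mulVec, Matrix.vecMul_transpose, Matrix.mulVec_mulVec,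
    Matrix.nonsing_inv_mul _ hM, Matrix.one_mulVec]

theorem exp_two_pi_int (x : ℝ) (n : ℤ) : Complex.exp (2 * Real.pi * Complex.I * ((x + n : ℝ) : ℂ))
    = Complex.exp (2 * Real.pi * Complex.I * (x : ℂ)) := by
  have : (2 * Real.pi * Complex.I * ((x + n : ℝ) : ℂ) : ℂ)
      = 2 * Real.pi * Complex.I * (x : ℂ) + n * (2 * Real.pi * Complex.I) := by
    push_cast; ring
  rw [this, Complex.exp_add, Complex.exp_int_mul_two_pi_mul_I, mul_one]

/-- The sequence `k ↦ conj c_{-k}`. -/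
def ref (c : Idx → ℂ) (k : Idx) : ℂ := starRingEnd ℂ (c (-k))

/-- On the level of functions `ref` is complex conjugation, hence multiplicative. No summability is
needed: conjugation commutes with `tsum`, and l ↦ -l reindexes the sum. -/
theorem conv_ref (c c' : Idx → ℂ) : conv (ref c) (ref c') = ref (conv c c') := by
  ext k
  simp only [conv, ref]
  rw [Complex.conj_tsum]
  rw [← (Equiv.neg Idx).tsum_eq]
  refine tsum_congr fun l => ?_
  simp only [Equiv.neg_apply, map_mul, neg_neg]
  rw [show -(k - -l) = -k - l by abel]

/-! ### The action on Fourier indices, its phases, and equivariant sequences -/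

namespace SpaceGroup

variable {t : Cell} {G : Type*} [Group G] (S : SpaceGroup t G)

theorem orthogonal_dot (g : G) (v w : Fin 3 → ℝ) :
    ((S.C g : Matrix (Fin 3) (Fin 3) ℝ) *ᵥ v) ⬝ᵥ ((S.C g : Matrix (Fin 3) (Fin 3) ℝ) *ᵥ w)
      = v ⬝ᵥ w := by
  have h : ((S.C g : Matrix (Fin 3) (Fin 3) ℝ))ᵀ * (S.C g : Matrix (Fin 3) (Fin 3) ℝ) = 1 := by
    simpa using (Matrix.mem_orthogonalGroup_iff' (Fin 3) ℝ).1 (S.C g).2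
  rw [Matrix.dotProduct_mulVec, ← Matrix.vecMul_transpose, Matrix.vecMul_vecMul, h,
    Matrix.vecMul_one]

theorem toReal_act (g : G) (k : Idx) :
    (S.act g k).toReal = (S.β g).map (fun n : ℤ => (n : ℝ)) *ᵥ k.toReal := by
  ext i
  simp [act, Idx.toReal, Matrix.mulVec, dotProduct]

theorem Ltilde_act (g : G) (k : Idx) : t.Ltilde *ᵥ (S.act g k).toReal
    = (S.C g : Matrix (Fin 3) (Fin 3) ℝ) *ᵥ (t.Ltilde *ᵥ k.toReal) := by
  rw [toReal_act, Matrix.mulVec_mulVec, S.β_spec, Matrix.mulVec_mulVec]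

theorem toReal_injective : Function.Injective Idx.toReal := by
  intro k k' h
  ext i
  have := congrFun h i
  simpa [Idx.toReal] using this

theorem Ltilde_injective {k k' : Idx} (h : t.Ltilde *ᵥ k.toReal = t.Ltilde *ᵥ k'.toReal) :
    k = k' :=
  toReal_injective <| Matrix.mulVec_injective_iff_isUnit.2
    ((Matrix.isUnit_iff_isUnit_det _).2 t.Ltilde_det_ne.isUnit) h

/-- Nothing multiplicative is assumed of the integer matrices `β`; the law is inherited from `C`,
because L̃ intertwines the two and is injective. -/
theorem act_mul (g h : G) (k : Idx) : S.act (g * h) k = S.act g (S.act h k) := by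
  apply Ltilde_injective (t := t)
  rw [Ltilde_act, Ltilde_act, Ltilde_act, map_mul, Matrix.mulVec_mulVec,
    Submonoid.coe_mul, Matrix.mulVec_mulVec, Matrix.mulVec_mulVec, Matrix.mul_assoc]

theorem act_one (k : Idx) : S.act 1 k = k := by
  apply Ltilde_injective (t := t)
  rw [Ltilde_act, map_one, Submonoid.coe_one, Matrix.one_mulVec]

theorem act_inv_act (g : G) (k : Idx) : S.act g⁻¹ (S.act g k) = k := by
  rw [← act_mul, inv_mul_cancel, act_one]

theorem act_act_inv (g : G) (k : Idx) : S.act g (S.act g⁻¹ k) = k := by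
  rw [← act_mul, mul_inv_cancel, act_one]

/-- The action of one element as a permutation of the Fourier indices. -/
def actEquiv (g : G) : Idx ≃ Idx where
  toFun := S.act g
  invFun := S.act g⁻¹
  left_inv := S.act_inv_act g
  right_inv := S.act_act_inv g

theorem act_add (g : G) (k k' : Idx) : S.act g (k + k') = S.act g k + S.act g k' :=
  Matrix.mulVec_add _ _ _

theorem act_neg (g : G) (k : Idx) : S.act g (-k) = -S.act g k := Matrix.mulVec_neg _ _

theorem act_sub (g : G) (k k' : Idx) : S.act g (k - k') = S.act g k - S.act g k' :=
  Matrix.mulVec_sub _ _ _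

theorem act_zero (g : G) : S.act g 0 = 0 := Matrix.mulVec_zero _

theorem act_eq_zero {g : G} {k : Idx} : S.act g k = 0 ↔ k = 0 := by
  constructor
  · intro h
    rw [← S.act_inv_act g k, h, act_zero]
  · rintro rfl
    exact S.act_zero g

theorem L_act {κ : Fin t.J → ℝ} (hκ : ∀ j, 0 < κ j) (g : G) (k : Idx) :
    t.L κ *ᵥ (S.act g k).toReal = (S.C g : Matrix (Fin 3) (Fin 3) ℝ) *ᵥ (t.L κ *ᵥ k.toReal) := by
  rw [Cell.L, Cell.Ltilde_comm_dilation, ← Matrix.mulVec_mulVec, Ltilde_act,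
    Matrix.mulVec_mulVec, ← S.comm g _ fun j => Real.sqrt_pos.2 (hκ j)]
  simp only [Matrix.mulVec_mulVec, Matrix.mul_assoc]

/-- Since C_g commutes with the dilations, L_κ intertwines the actions for every positive κ;
orthogonality then preserves Δ_k κ for all these κ, and this determines the coefficients. -/
theorem Del_act (g : G) (k : Idx) (j : Fin t.J) : t.Del (S.act g k) j = t.Del k j := by
  refine t.Del_eq_of_DelR_eq (fun κ hκ => ?_) j
  rw [Cell.DelR, Cell.DelR, ← t.dot_L fun j => (hκ j).le, ← t.dot_L fun j => (hκ j).le,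
    S.L_act hκ, orthogonal_dot]

theorem DelC_act (g : G) (k : Idx) (κ : Fin t.J → ℂ) : t.DelC (S.act g k) κ = t.DelC k κ := by
  simp [Cell.DelC, Del_act]

theorem DelR_act (g : G) (k : Idx) (κ : Fin t.J → ℝ) : t.DelR (S.act g k) κ = t.DelR k κ := by
  simp [Cell.DelR, Del_act]

theorem α_ne_zero (g : G) (k : Idx) : S.α g k ≠ 0 := Complex.exp_ne_zero _

theorem norm_α (g : G) (k : Idx) : ‖S.α g k‖ = 1 := by
  rw [α, show ∀ x : ℝ, (2 * Real.pi * Complex.I * (x : ℂ) : ℂ)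
    = ((2 * Real.pi * x : ℝ) : ℂ) * Complex.I by intro x; push_cast; ring]
  exact Complex.norm_exp_ofReal_mul_I _

theorem α_add (g : G) (k k' : Idx) : S.α g (k + k') = S.α g k * S.α g k' := by
  rw [α, α, α, ← Complex.exp_add, act_add, Idx.toReal_add, add_dotProduct]
  congr 1
  push_cast; ring

theorem α_zero (g : G) : S.α g 0 = 1 := by
  have h := S.α_add g 0 0
  rw [add_zero] at h
  exact (mul_eq_left₀ (S.α_ne_zero g 0)).1 h.symm

theorem α_neg (g : G) (k : Idx) : S.α g (-k) = (S.α g k)⁻¹ := by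
  apply eq_inv_of_mul_eq_one_left
  rw [← α_add, neg_add_cancel, α_zero]

theorem conj_α (g : G) (k : Idx) : starRingEnd ℂ (S.α g k) = S.α g (-k) := by
  rw [α_neg, Complex.inv_eq_conj (S.norm_α g k)]

/-- The composition law of the translations, paired with the vector L̃(gh.k), becomes additive in
the exponents up to the integer (gh.k)·n, which the exponential does not see. -/
theorem α_mul (g h : G) (k : Idx) : S.α (g * h) k = S.α g (S.act h k) * S.α h k := by
  obtain ⟨n, hn⟩ := S.D_mul g h
  have h1 := congrArg (fun w => (t.Ltilde *ᵥ (S.act (g * h) k).toReal) ⬝ᵥ w) hn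
  have hL := t.Ltilde_det_ne.isUnit
  simp only [dotProduct_add] at h1
  rw [Cell.dot_inv_transpose hL, Cell.dot_inv_transpose hL, dotProduct_add, act_mul, Ltilde_act,
    orthogonal_dot, Cell.dot_inv_transpose hL, Idx.toReal_dot, ← act_mul] at h1
  rw [α, α, α, ← Complex.exp_add, ← exp_two_pi_int _ _, h1, ← act_mul]
  congr 1
  push_cast; ring

theorem α_one (k : Idx) : S.α 1 k = 1 := by
  have h := S.α_mul 1 1 k
  rw [mul_one, act_one] at h
  exact (mul_eq_left₀ (S.α_ne_zero 1 k)).1 h.symm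

theorem orbit_act (g : G) (k : Idx) : S.orbit (S.act g k) = S.orbit k := by
  ext k'
  constructor
  · rintro ⟨h, rfl⟩
    exact ⟨h * g, S.act_mul h g k⟩
  · rintro ⟨h, rfl⟩
    exact ⟨h * g⁻¹, by simp only [act_mul, act_inv_act]⟩

theorem orbCard_act (g : G) (k : Idx) : S.orbCard (S.act g k) = S.orbCard k := by
  rw [orbCard, orbit_act, orbCard]

theorem orbCard_neg (k : Idx) : S.orbCard (-k) = S.orbCard k := by
  have : S.orbit (-k) = (fun k => -k) '' S.orbit k := by
    ext k'
    simp [orbit, act_neg, neg_eq_iff_eq_neg]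
  rw [orbCard, this, Set.ncard_image_of_injective _ neg_injective, orbCard]

/-- The sequences `c` with `c_{g.k} α_g(k) = c_k`, which are the Fourier coefficients of the
invariant functions. -/
def IsEquivariant (c : Idx → ℂ) : Prop := ∀ g k, c (S.act g k) * S.α g k = c k

namespace IsEquivariant

variable {S} {c c' : Idx → ℂ}

theorem apply (hc : S.IsEquivariant c) (g : G) (k : Idx) :
    c (S.act g k) = c k * (S.α g k)⁻¹ := by
  rw [← hc g k, mul_assoc, mul_inv_cancel₀ (S.α_ne_zero g k), mul_one]

theorem add (hc : S.IsEquivariant c) (hc' : S.IsEquivariant c') :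
    S.IsEquivariant fun k => c k + c' k := fun g k => by
  rw [add_mul, hc, hc']

theorem mul_invariant (hc : S.IsEquivariant c) {χ : Idx → ℂ} (hχ : ∀ g k, χ (S.act g k) = χ k) :
    S.IsEquivariant fun k => χ k * c k := fun g k => by
  rw [mul_assoc, hc, hχ]

theorem ref (hc : S.IsEquivariant c) : S.IsEquivariant (ref c) := fun g k => by
  have := congrArg (starRingEnd ℂ) (hc g (-k))
  rw [map_mul, conj_α, neg_neg, act_neg] at this
  exact this

/-- This is the invariance of a product of invariant functions: substitute l ↦ g.l and use that α_g
is a character in the index. -/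
theorem conv (hc : S.IsEquivariant c) (hc' : S.IsEquivariant c') :
    S.IsEquivariant (conv c c') := fun g k => by
  simp only [OhtaKawasaki.conv]
  rw [← (S.actEquiv g).tsum_eq, ← tsum_mul_right]
  refine tsum_congr fun l => ?_
  change c (S.act g l) * c' (S.act g k - S.act g l) * S.α g k = _
  rw [← act_sub, ← hc g l, ← hc' g (k - l)]
  have h : S.α g k = S.α g l * S.α g (k - l) := by rw [← α_add, add_sub_cancel]
  rw [h]
  ring

theorem single_zero (a : ℂ) : S.IsEquivariant fun k => if k = 0 then a else 0 := fun g k => by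
  by_cases hk : k = 0
  · subst hk
    simp [act_zero, α_zero]
  · simp [hk, act_eq_zero]

end IsEquivariant

variable [Fintype G]

/-- Every phase has modulus one, hence real part at most one; a sum of phases equal to their number
forces each of them to be one. -/
theorem mem_Zsym {k : Idx} : k ∈ S.Zsym ↔ ∀ g, S.act g k = k → S.α g k = 1 := by
  constructor
  · intro h g hg
    have h1 := congrArg Complex.re (Set.mem_ofPred_eq ▸ h)
    rw [Complex.re_sum, Complex.natCast_re] at h1
    have h2 : ∑ g with S.act g k = k, (1 - (S.α g k).re) = 0 := by
      rw [Finset.sum_sub_distrib, h1]; simp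
    have hle : ∀ g, (S.α g k).re ≤ 1 := fun g => by
      rw [← S.norm_α g k]; exact Complex.re_le_norm _
    have h3 := (Finset.sum_eq_zero_iff_of_nonneg fun g _ => sub_nonneg.2 (hle g)).1 h2 g
      (Finset.mem_filter.2 ⟨Finset.mem_univ g, hg⟩)
    have hre : (S.α g k).re = 1 := by linarith
    have hn := S.norm_α g k
    rw [Complex.norm_eq_sqrt_sq_add_sq, hre] at hn
    have him : (S.α g k).im = 0 := by
      have := (Real.sqrt_eq_one).1 hn
      nlinarith
    exact Complex.ext (by simpa using hre) (by simpa using him)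
  · intro h
    change ∑ g with S.act g k = k, S.α g k = _
    rw [Finset.sum_congr rfl fun g hg => h g (Finset.mem_filter.1 hg).2]
    simp

theorem zero_mem_Zsym : (0 : Idx) ∈ S.Zsym := S.mem_Zsym.2 fun g _ => S.α_zero g

/-- Some stabilizing g has α_g(k) ≠ 1, while equivariance reads c_k α_g(k) = c_k. This is why
indices outside `Zsym` may be discarded. -/
theorem IsEquivariant.eq_zero {S : SpaceGroup t G} {c : Idx → ℂ} (hc : S.IsEquivariant c) {k : Idx}
    (hk : k ∉ S.Zsym) : c k = 0 := by
  rw [mem_Zsym] at hk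
  push Not at hk
  obtain ⟨g, hg, hα⟩ := hk
  have h := hc g k
  rw [hg] at h
  by_contra h0
  exact hα ((mul_eq_left₀ h0).1 h)

/-- Two group elements sending k to the same index differ by a stabilizing one, whose phase is 1 on
`Zsym`; the chosen representative is therefore immaterial. -/
theorem αt_act {k : Idx} (hk : k ∈ S.Zsym) (g : G) : S.αt k (S.act g k) = (S.α g k)⁻¹ := by
  have hex : ∃ g', S.act g' k = S.act g k := ⟨g, rfl⟩
  rw [αt, dif_pos hex]
  congr 1
  have h1 := hex.choose_spec
  set g' := hex.choose
  have h2 := S.mem_Zsym.1 hk (g⁻¹ * g') (by rw [act_mul, h1, act_inv_act])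
  have h3 : S.α g' k = S.α (g * (g⁻¹ * g')) k := by rw [mul_inv_cancel_left]
  rw [h3, α_mul, h2, mul_one, act_mul, h1, act_inv_act]

end SpaceGroup

/-! ### Reduction to one index per orbit -/

namespace Setup

variable {t : Cell} {G : Type*} [Group G] (S : Setup t G)

theorem exists_rep (k : Idx) : ∃ k₀ ∈ S.dom, ∃ g, S.act g k₀ = k := by
  obtain ⟨k₀, ⟨h1, g, rfl⟩, -⟩ := S.dom_spec k
  exact ⟨_, h1, g⁻¹, S.act_inv_act g k⟩

theorem rep_unique {k k' : Idx} (hk : k ∈ S.dom) (hk' : k' ∈ S.dom) {g h : G}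
    (e : S.act g k = S.act h k') : k = k' := by
  refine (S.dom_spec k).unique ⟨hk, 1, S.act_one k⟩ ⟨hk', h⁻¹ * g, ?_⟩
  simp only [SpaceGroup.act_mul, e, SpaceGroup.act_inv_act]

theorem zero_mem_dom : (0 : Idx) ∈ S.dom := by
  obtain ⟨k₀, h, g, e⟩ := S.exists_rep 0
  rwa [S.act_eq_zero.1 e] at h

theorem knorm_eq (k : Idx) : S.knorm k = Real.sqrt (t.DelR k S.κbar) := rfl

theorem knorm_act (g : G) (k : Idx) : S.knorm (S.act g k) = S.knorm k := by
  rw [knorm_eq, knorm_eq, S.DelR_act]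

theorem knorm_neg (k : Idx) : S.knorm (-k) = S.knorm k := by
  rw [knorm_eq, knorm_eq, t.DelR_neg]

theorem knorm_nonneg (k : Idx) : 0 ≤ S.knorm k := Real.sqrt_nonneg _

theorem knorm_add_le (k k' : Idx) : S.knorm (k + k') ≤ S.knorm k + S.knorm k' :=
  t.DelR_sqrt_add (fun j => (S.κbar_pos j).le) k k'

theorem knorm_sq (k : Idx) : S.knorm k ^ 2 = t.DelR k S.κbar :=
  Real.sq_sqrt (t.DelR_nonneg k fun j => (S.κbar_pos j).le)

variable [Fintype G]

theorem zero_mem_Z : (0 : Idx) ∈ S.Z := ⟨S.zero_mem_Zsym, S.zero_mem_dom⟩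

/-- The fundamental domain meets each orbit once, so only one term of the defining sum survives. -/
theorem σ_act (b : S.Z → ℂ) (k : S.Z) (g : G) : S.σ b (S.act g k) = b k * (S.α g k)⁻¹ := by
  rw [σ, tsum_eq_single k, S.αt_act k.2.1]
  intro k' hk'
  rw [SpaceGroup.αt, dif_neg, mul_zero]
  rintro ⟨h, e⟩
  exact hk' (Subtype.ext (S.rep_unique k'.2.2 k.2.2 e))

theorem σ_apply (b : S.Z → ℂ) (k : S.Z) : S.σ b k = b k := by
  have := S.σ_act b k 1
  rwa [S.act_one, S.α_one, inv_one, mul_one] at this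

theorem σ_act_eq_zero (b : S.Z → ℂ) {k : Idx} (hd : k ∈ S.dom) (hk : k ∉ S.Zsym) (g : G) :
    S.σ b (S.act g k) = 0 := by
  have : ∀ k' : S.Z, b k' * S.αt k' (S.act g k) = 0 := by
    intro k'
    rw [SpaceGroup.αt, dif_neg, mul_zero]
    rintro ⟨h, e⟩
    exact hk (S.rep_unique k'.2.2 hd e ▸ k'.2.1)
  rw [σ, tsum_congr this, tsum_zero]

theorem σ_equivariant (b : S.Z → ℂ) : S.IsEquivariant (S.σ b) := by
  intro g k
  obtain ⟨k₀, hd, h, rfl⟩ := S.exists_rep k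
  rw [← S.act_mul]
  by_cases hk : k₀ ∈ S.Zsym
  · rw [S.σ_act b ⟨k₀, hk, hd⟩, S.σ_act b ⟨k₀, hk, hd⟩, S.α_mul, mul_inv]
    field_simp [S.α_ne_zero g]
  · rw [S.σ_act_eq_zero b hd hk, S.σ_act_eq_zero b hd hk, zero_mul]

variable {S} in
/-- Equivariant sequences are determined by their restriction to the symmetry reduced indices. -/
theorem equivariant_ext {c c' : Idx → ℂ} (hc : S.IsEquivariant c) (hc' : S.IsEquivariant c')
    (h : ∀ k ∈ S.Z, c k = c' k) : c = c' := by
  ext k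
  obtain ⟨k₀, hd, g, rfl⟩ := S.exists_rep k
  rw [hc.apply, hc'.apply]
  by_cases hk : k₀ ∈ S.Zsym
  · rw [h k₀ ⟨hk, hd⟩]
  · rw [hc.eq_zero hk, hc'.eq_zero hk]

/-- `σ` on the sequences indexed by the nonzero reduced indices. -/
def σ₀ (b : S.Z0 → ℂ) : Idx → ℂ := S.σ (S.extend 0 b)

theorem σ₀_equivariant (b : S.Z0 → ℂ) : S.IsEquivariant (S.σ₀ b) := S.σ_equivariant _

theorem σ₀_zero (b : S.Z0 → ℂ) : S.σ₀ b 0 = 0 := by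
  rw [σ₀, S.σ_apply _ ⟨0, S.zero_mem_Z⟩]
  simp [extend]

theorem σ₀_apply (b : S.Z0 → ℂ) (k : S.Z0) : S.σ₀ b k = b k := by
  rw [σ₀, S.σ_apply _ ⟨k, k.2.1⟩]
  simp [extend, k.2.2]

variable {S} in
theorem eq_σ₀ {c : Idx → ℂ} (hc : S.IsEquivariant c) (h0 : c 0 = 0) :
    c = S.σ₀ fun k => c k := by
  refine equivariant_ext hc (S.σ₀_equivariant _) fun k hk => ?_
  by_cases h : k = 0
  · rw [h, h0, σ₀_zero]
  · exact (S.σ₀_apply (fun k => c k) ⟨k, hk, h⟩).symm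

/-- Separates the part that is linear in b from the fixed mean value, which makes the coefficients
an affine function of b. -/
theorem coeff_eq (b : S.Z0 → ℂ) :
    S.coeff b = fun k => S.σ₀ b k + if k = 0 then (S.m : ℂ) else 0 := by
  refine equivariant_ext (S.σ_equivariant _)
    ((S.σ₀_equivariant b).add (.single_zero _)) fun k hk => ?_
  rw [coeff, S.σ_apply _ ⟨k, hk⟩, σ₀, S.σ_apply _ ⟨k, hk⟩]
  by_cases h : k = 0 <;> simp [extend, h]

theorem coeff_equivariant (b : S.Z0 → ℂ) : S.IsEquivariant (S.coeff b) := S.σ_equivariant _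

theorem coeff_zero (b : S.Z0 → ℂ) : S.coeff b 0 = S.m := by
  simp [coeff_eq, σ₀_zero]

theorem coeff_apply (b : S.Z0 → ℂ) (k : S.Z0) : S.coeff b k = b k := by
  simp [coeff_eq, σ₀_apply, k.2.2]

theorem conjSeq_eq (b : S.Z0 → ℂ) (k : S.Z0) : S.conjSeq b k = ref (S.σ₀ b) k := rfl

theorem σ₀_conjSeq (b : S.Z0 → ℂ) : S.σ₀ (S.conjSeq b) = ref (S.σ₀ b) := by
  have h := eq_σ₀ (S.σ₀_equivariant b).ref (by simp [ref, σ₀_zero])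
  exact h.symm

theorem conjSeq_eq_self_iff (b : S.Z0 → ℂ) : S.conjSeq b = b ↔ ref (S.σ₀ b) = S.σ₀ b := by
  constructor
  · intro h
    rw [← σ₀_conjSeq, h]
  · intro h
    ext k
    rw [conjSeq_eq, h, σ₀_apply]

theorem ref_coeff {b : S.Z0 → ℂ} (hb : S.conjSeq b = b) : ref (S.coeff b) = S.coeff b := by
  have h := (S.conjSeq_eq_self_iff b).1 hb
  ext k
  have hk := congrFun h k
  rw [coeff_eq]
  simp only [ref, map_add, neg_eq_zero] at hk ⊢
  rw [hk]
  split_ifs <;> simp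

/-- The conjugation commutes with the multiplication by real multipliers that are invariant
under the group and under `k ↦ -k`. -/
theorem conjSeq_mul (χ : Idx → ℝ) (hχ : ∀ g k, χ (S.act g k) = χ k) (hn : ∀ k, χ (-k) = χ k)
    (b : S.Z0 → ℂ) :
    S.conjSeq (fun k => (χ k : ℂ) * b k) = fun k : S.Z0 => (χ k : ℂ) * S.conjSeq b k := by
  have h : S.σ₀ (fun k => (χ k : ℂ) * b k) = fun k => (χ k : ℂ) * S.σ₀ b k := by
    refine ((eq_σ₀ ((S.σ₀_equivariant b).mul_invariant (χ := fun k => (χ k : ℂ)) fun g k => ?_)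
      ?_).trans ?_).symm
    · simp only [hχ]
    · simp [σ₀_zero]
    · congr 1
      ext k
      rw [σ₀_apply]
  ext k
  rw [conjSeq_eq, conjSeq_eq, ref, h, ref, map_mul, Complex.conj_ofReal, hn]

theorem conjSeq_of_ref {c : Idx → ℂ} (hc : S.IsEquivariant c) (h0 : c 0 = 0) (hr : ref c = c) :
    S.conjSeq (fun k => c k) = fun k : S.Z0 => c k := by
  rw [conjSeq_eq_self_iff, ← eq_σ₀ hc h0, hr]

theorem conjSeq_sub (b b' : S.Z0 → ℂ) :
    S.conjSeq (b - b') = S.conjSeq b - S.conjSeq b' := by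
  have h : (fun k => S.σ₀ b k + -1 * S.σ₀ b' k) = S.σ₀ (b - b') := by
    rw [eq_σ₀ ((S.σ₀_equivariant b).add ((S.σ₀_equivariant b').mul_invariant
      (χ := fun _ => -1) fun _ _ => rfl)) (by simp [σ₀_zero])]
    congr 1
    ext k
    simp only [σ₀_apply, Pi.sub_apply]
    ring
  ext k
  simp only [conjSeq_eq, Pi.sub_apply]
  rw [ref, ← h, ref, ref]
  simp [sub_eq_add_neg]

end Setup

end OhtaKawasaki

namespace OhtaKawasaki

open scoped ENNReal

/-! ### Weighted `ℓ¹` spaces -/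

namespace WC

variable {w : Set.Ioi (0 : ℝ)}

theorem ext {x y : WC w} (h : x.val = y.val) : x = y := h

instance : FiniteDimensional ℂ (WC w) := inferInstanceAs (FiniteDimensional ℂ ℂ)

instance : CompleteSpace (WC w) := FiniteDimensional.complete ℂ (WC w)

/-- The underlying complex number, as a continuous linear map. -/
def valL (w : Set.Ioi (0 : ℝ)) : WC w →L[ℂ] ℂ :=
  LinearMap.toContinuousLinearMap
    { toFun := fun z => z.val, map_add' := fun _ _ => rfl, map_smul' := fun _ _ => rfl }

end WC

/-- The weighted `ℓ¹` space of complex sequences. -/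
abbrev WL {I : Type*} (w : I → Set.Ioi (0 : ℝ)) : Type _ := lp (fun i => WC (w i)) 1

/-- Bounded complex sequences. -/
abbrev BS (I : Type*) : Type _ := lp (fun _ : I => ℂ) ∞

theorem BS.apply_le {I : Type*} (a : BS I) (i : I) : ‖a i‖ ≤ ‖a‖ :=
  lp.norm_apply_le_norm ENNReal.top_ne_zero a i

/-- A bounded sequence as an element of `BS`. -/
def BS.mk {I : Type*} (a : I → ℂ) (h : ∃ C, ∀ i, ‖a i‖ ≤ C) : BS I :=
  ⟨a, memℓp_infty (by obtain ⟨C, hC⟩ := h; exact ⟨C, by rintro _ ⟨i, rfl⟩; exact hC i⟩)⟩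

@[simp] theorem BS.mk_apply {I : Type*} (a : I → ℂ) (h : ∃ C, ∀ i, ‖a i‖ ≤ C) (i : I) :
    BS.mk a h i = a i := rfl

namespace WL

variable {I : Type*} {w : I → Set.Ioi (0 : ℝ)}

theorem memℓp_iff (a : ∀ i, WC (w i)) :
    Memℓp a 1 ↔ Summable fun i => (w i : ℝ) * ‖(a i).val‖ := by
  rw [memℓp_gen_iff (by simp)]
  simp only [ENNReal.toReal_one, Real.rpow_one, WC.norm_def]

theorem summable (b : WL w) : Summable fun i => (w i : ℝ) * ‖(b i).val‖ :=
  (memℓp_iff _).1 (lp.memℓp b)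

theorem norm_eq (b : WL w) : ‖b‖ = ∑' i, (w i : ℝ) * ‖(b i).val‖ := by
  rw [lp.norm_eq_tsum_rpow (by simp)]
  simp only [ENNReal.toReal_one, Real.rpow_one, WC.norm_def, div_one]

theorem apply_le (b : WL w) (i : I) : (w i : ℝ) * ‖(b i).val‖ ≤ ‖b‖ := by
  rw [← WC.norm_def]
  exact lp.norm_apply_le_norm one_ne_zero b i

theorem weight_nonneg (i : I) : 0 ≤ (w i : ℝ) := le_of_lt (w i).2

/-- A summable sequence as an element of the weighted space. -/
def mk (a : I → ℂ) (h : Summable fun i => (w i : ℝ) * ‖a i‖) : WL w :=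
  ⟨fun i => WC.mk (a i), (memℓp_iff _).2 h⟩

@[simp] theorem mk_val (a : I → ℂ) (h : Summable fun i => (w i : ℝ) * ‖a i‖) (i : I) :
    ((mk a h : WL w) i).val = a i := rfl

theorem norm_mk (a : I → ℂ) (h : Summable fun i => (w i : ℝ) * ‖a i‖) :
    ‖(mk a h : WL w)‖ = ∑' i, (w i : ℝ) * ‖a i‖ := norm_eq _

theorem ext {b b' : WL w} (h : ∀ i, (b i).val = (b' i).val) : b = b' :=
  lp.ext (funext fun i => WC.ext (h i))

@[simp] theorem add_val (b b' : WL w) (i : I) : ((b + b') i).val = (b i).val + (b' i).val := rfl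

@[simp] theorem smul_val (c : ℂ) (b : WL w) (i : I) : ((c • b) i).val = c * (b i).val := rfl

/-- Evaluation of a coordinate. -/
def eval (i : I) : WL w →L[ℂ] ℂ :=
  LinearMap.mkContinuous
    { toFun := fun b => (b i).val, map_add' := fun _ _ => rfl, map_smul' := fun _ _ => rfl }
    ((w i : ℝ)⁻¹) fun b => by
      change ‖(b i).val‖ ≤ _
      have hw : (0 : ℝ) < w i := (w i).2
      rw [inv_mul_eq_div, le_div_iff₀ hw, mul_comm]
      exact b.apply_le i

@[simp] theorem eval_apply (i : I) (b : WL w) : eval i b = (b i).val := rfl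

theorem mult_le (a : BS I) (b : WL w) (i : I) :
    (w i : ℝ) * ‖a i * (b i).val‖ ≤ ‖a‖ * ((w i : ℝ) * ‖(b i).val‖) := by
  rw [norm_mul]
  have := mul_le_mul_of_nonneg_right (a.apply_le i)
    (mul_nonneg (weight_nonneg (w := w) i) (norm_nonneg (b i).val))
  linarith

theorem mult_summable (a : BS I) (b : WL w) :
    Summable fun i => (w i : ℝ) * ‖a i * (b i).val‖ :=
  Summable.of_nonneg_of_le (fun i => mul_nonneg (weight_nonneg i) (norm_nonneg _))
    (mult_le a b) (b.summable.mul_left _)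

/-- Multiplication by bounded sequences. -/
def mult : BS I →L[ℂ] WL w →L[ℂ] WL w :=
  LinearMap.mkContinuous₂
    (LinearMap.mk₂ ℂ (fun a b => mk (fun i => a i * (b i).val) (mult_summable a b))
      (fun a a' b => ext fun i => add_mul (a i) (a' i) (b i).val)
      (fun c a b => ext fun i => mul_assoc c (a i) (b i).val)
      (fun a b b' => ext fun i => mul_add (a i) (b i).val (b' i).val)
      (fun c a b => ext fun i => mul_left_comm (a i) c (b i).val)) 1
    fun a b => by
      change ‖(mk (fun i => a i * (b i).val) (mult_summable a b) : WL w)‖ ≤ _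
      rw [norm_mk, one_mul, norm_eq b, ← tsum_mul_left]
      exact (mult_summable a b).tsum_le_tsum (mult_le a b) (b.summable.mul_left _)

@[simp] theorem mult_val (a : BS I) (b : WL w) (i : I) : (mult a b i).val = a i * (b i).val := rfl

/-- The sum of an unweighted summable sequence. -/
def sumL (hw : ∀ i, (w i : ℝ) = 1) : WL w →L[ℂ] ℂ :=
  LinearMap.mkContinuous
    { toFun := fun b => ∑' i, (b i).val
      map_add' := fun b b' => by
        have h : ∀ b : WL w, Summable fun i => (b i).val := fun b =>
          Summable.of_norm (by simpa [hw] using b.summable)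
        exact (h b).tsum_add (h b')
      map_smul' := fun c b => tsum_mul_left } 1
    fun b => by
      have h : Summable fun i => ‖(b i).val‖ := by simpa [hw] using b.summable
      have := norm_tsum_le_tsum_norm h
      change ‖∑' i, (b i).val‖ ≤ _
      simpa [norm_eq, hw] using this

end WL

/-- The bijection `(k, l) ↦ (l, k - l)`. -/
def convEquiv : Idx × Idx ≃ Idx × Idx where
  toFun p := (p.2, p.1 - p.2)
  invFun p := (p.1 + p.2, p.1)
  left_inv p := by simp
  right_inv p := by simp

/-! ### The convolution algebra of a submultiplicative weight -/

section Conv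

variable {w : Idx → Set.Ioi (0 : ℝ)}

theorem summable_conv_prod {a a' : Idx → ℂ} (ha : Summable fun i => (w i : ℝ) * ‖a i‖)
    (ha' : Summable fun i => (w i : ℝ) * ‖a' i‖) :
    Summable fun p : Idx × Idx =>
      ((w p.2 : ℝ) * ‖a p.2‖) * ((w (p.1 - p.2) : ℝ) * ‖a' (p.1 - p.2)‖) := by
  have := ha.mul_of_nonneg ha' (fun i => mul_nonneg (WL.weight_nonneg i) (norm_nonneg _))
    (fun i => mul_nonneg (WL.weight_nonneg i) (norm_nonneg _))
  exact (convEquiv.summable_iff (f := fun p : Idx × Idx =>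
    ((w p.1 : ℝ) * ‖a p.1‖) * ((w p.2 : ℝ) * ‖a' p.2‖))).2 this

theorem conv_term_le (hw : ∀ k l, (w (k + l) : ℝ) ≤ w k * w l)
    (a a' : Idx → ℂ) (k l : Idx) :
    (w k : ℝ) * ‖a l * a' (k - l)‖
      ≤ ((w l : ℝ) * ‖a l‖) * ((w (k - l) : ℝ) * ‖a' (k - l)‖) := by
  have h := hw l (k - l)
  rw [add_sub_cancel] at h
  rw [norm_mul]
  have := mul_le_mul_of_nonneg_right h (mul_nonneg (norm_nonneg (a l)) (norm_nonneg (a' (k - l))))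
  linarith

theorem conv_summable_term (hw : ∀ k l, (w (k + l) : ℝ) ≤ w k * w l)
    {a a' : Idx → ℂ} (ha : Summable fun i => (w i : ℝ) * ‖a i‖)
    (ha' : Summable fun i => (w i : ℝ) * ‖a' i‖) (k : Idx) :
    Summable fun l => ‖a l * a' (k - l)‖ := by
  have h := (summable_conv_prod ha ha').prod_factor k
  have h1 : Summable fun l => (w k : ℝ) * ‖a l * a' (k - l)‖ :=
    Summable.of_nonneg_of_le (fun l => mul_nonneg (WL.weight_nonneg k) (norm_nonneg _))
      (fun l => conv_term_le hw a a' k l) h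
  exact (summable_mul_left_iff (ne_of_gt (w k).2)).1 h1

theorem conv_le (hw : ∀ k l, (w (k + l) : ℝ) ≤ w k * w l)
    {a a' : Idx → ℂ} (ha : Summable fun i => (w i : ℝ) * ‖a i‖)
    (ha' : Summable fun i => (w i : ℝ) * ‖a' i‖) (k : Idx) :
    (w k : ℝ) * ‖conv a a' k‖
      ≤ ∑' l, ((w l : ℝ) * ‖a l‖) * ((w (k - l) : ℝ) * ‖a' (k - l)‖) := by
  have hs := conv_summable_term hw ha ha' k
  calc (w k : ℝ) * ‖conv a a' k‖ ≤ (w k : ℝ) * ∑' l, ‖a l * a' (k - l)‖ :=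
        mul_le_mul_of_nonneg_left (norm_tsum_le_tsum_norm hs) (WL.weight_nonneg k)
    _ = ∑' l, (w k : ℝ) * ‖a l * a' (k - l)‖ := tsum_mul_left.symm
    _ ≤ _ := (hs.mul_left _).tsum_le_tsum (fun l => conv_term_le hw a a' k l)
        ((summable_conv_prod ha ha').prod_factor k)

theorem conv_summable (hw : ∀ k l, (w (k + l) : ℝ) ≤ w k * w l)
    {a a' : Idx → ℂ} (ha : Summable fun i => (w i : ℝ) * ‖a i‖)
    (ha' : Summable fun i => (w i : ℝ) * ‖a' i‖) :
    Summable fun k => (w k : ℝ) * ‖conv a a' k‖ :=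
  Summable.of_nonneg_of_le (fun k => mul_nonneg (WL.weight_nonneg k) (norm_nonneg _))
    (conv_le hw ha ha') (summable_conv_prod ha ha').prod

/-- Submultiplicativity moves the weight inside the convolution; `convEquiv` then turns the double
sum into the product of the two norms. This is the Banach algebra inequality. -/
theorem tsum_conv_le (hw : ∀ k l, (w (k + l) : ℝ) ≤ w k * w l)
    {a a' : Idx → ℂ} (ha : Summable fun i => (w i : ℝ) * ‖a i‖)
    (ha' : Summable fun i => (w i : ℝ) * ‖a' i‖) :
    ∑' k, (w k : ℝ) * ‖conv a a' k‖
      ≤ (∑' k, (w k : ℝ) * ‖a k‖) * ∑' k, (w k : ℝ) * ‖a' k‖ := by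
  have hp := summable_conv_prod ha ha'
  refine ((conv_summable hw ha ha').tsum_le_tsum (conv_le hw ha ha') hp.prod).trans ?_
  rw [← hp.tsum_prod, tsum_mul_tsum_of_summable_norm ha.norm ha'.norm]
  exact (convEquiv.tsum_eq (fun p : Idx × Idx =>
    ((w p.1 : ℝ) * ‖a p.1‖) * ((w p.2 : ℝ) * ‖a' p.2‖))).le

/-- The convolution as a continuous bilinear map. -/
def convL (hw : ∀ k l, (w (k + l) : ℝ) ≤ w k * w l) : WL w →L[ℂ] WL w →L[ℂ] WL w :=
  LinearMap.mkContinuous₂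
    (LinearMap.mk₂ ℂ
      (fun a b => WL.mk (conv (fun i => (a i).val) fun i => (b i).val)
        (conv_summable hw a.summable b.summable))
      (fun a a' b => WL.ext fun k => by
        have h := (conv_summable_term hw a.summable b.summable k).of_norm
        have h' := (conv_summable_term hw a'.summable b.summable k).of_norm
        simp only [WL.mk_val, WL.add_val, conv, add_mul]
        exact h.tsum_add h')
      (fun c a b => WL.ext fun k => by
        simp only [WL.mk_val, WL.smul_val, conv, mul_assoc]
        exact tsum_mul_left)
      (fun a b b' => WL.ext fun k => by
        have h := (conv_summable_term hw a.summable b.summable k).of_norm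
        have h' := (conv_summable_term hw a.summable b'.summable k).of_norm
        simp only [WL.mk_val, WL.add_val, conv, mul_add]
        exact h.tsum_add h')
      (fun c a b => WL.ext fun k => by
        simp only [WL.mk_val, WL.smul_val, conv, mul_left_comm _ c]
        exact tsum_mul_left)) 1
    fun a b => by
      change ‖(WL.mk (conv (fun i => (a i).val) fun i => (b i).val)
        (conv_summable hw a.summable b.summable) : WL w)‖ ≤ _
      rw [WL.norm_mk, one_mul, WL.norm_eq a, WL.norm_eq b]
      exact tsum_conv_le hw a.summable b.summable

end Conv

end OhtaKawasaki

namespace OhtaKawasaki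

open scoped ENNReal

/-! ### Differentiability of the fixed point operator -/

namespace Setup

section NoFintype

variable {t : Cell} {G : Type*} [Group G] (S : Setup t G)

/-- The weight `ν^{‖k‖}`. -/
def wν (k : Idx) : Set.Ioi (0 : ℝ) :=
  ⟨S.ν ^ S.knorm k, Real.rpow_pos_of_pos (zero_lt_one.trans S.one_lt_ν) _⟩

theorem wν_coe (k : Idx) : (S.wν k : ℝ) = S.ν ^ S.knorm k := rfl

theorem wν_add (k l : Idx) : (S.wν (k + l) : ℝ) ≤ S.wν k * S.wν l := by
  simp only [wν_coe]
  rw [← Real.rpow_add (zero_lt_one.trans S.one_lt_ν)]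
  exact Real.rpow_le_rpow_of_exponent_le S.one_lt_ν.le (S.knorm_add_le k l)

theorem one_le_wν (k : Idx) : 1 ≤ (S.wν k : ℝ) :=
  Real.one_le_rpow S.one_lt_ν.le (S.knorm_nonneg k)

theorem wν_act (g : G) (k : Idx) : S.wν (S.act g k) = S.wν k := by
  simp only [wν, knorm_act]

/-- The constant n!/(log ν)^n comes from s^n / n! ≤ exp s with s = ‖k‖ log ν. This is a place where
ν > 1 is essential. -/
theorem exists_knorm_pow_le (n : ℕ) : ∃ C, 0 < C ∧ ∀ k, S.knorm k ^ n ≤ C * S.wν k := by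
  have hl := Real.log_pos S.one_lt_ν
  refine ⟨n.factorial / Real.log S.ν ^ n, by positivity, fun k => ?_⟩
  have h := Real.pow_div_factorial_le_exp (Real.log S.ν * S.knorm k)
    (mul_nonneg hl.le (S.knorm_nonneg k)) n
  rw [← Real.rpow_def_of_pos (zero_lt_one.trans S.one_lt_ν), ← wν_coe, mul_pow,
    div_le_iff₀ (by positivity)] at h
  rw [div_mul_eq_mul_div, le_div_iff₀ (by positivity)]
  linarith

/-- The term Δ_k^j κ̄_j is one of the nonnegative summands of ‖k‖², and the exponential weight
dominates the latter. -/
theorem exists_Del_le (j : Fin t.J) : ∃ C, 0 < C ∧ ∀ k, t.Del k j ≤ C * S.wν k := by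
  obtain ⟨C, hC, h⟩ := S.exists_knorm_pow_le 2
  have hκ := S.κbar_pos j
  refine ⟨C / S.κbar j, by positivity, fun k => ?_⟩
  rw [div_mul_eq_mul_div, le_div_iff₀ hκ]
  refine le_trans ?_ (h k)
  rw [S.knorm_sq]
  exact Finset.single_le_sum (f := fun j => t.Del k j * S.κbar j)
    (fun j _ => mul_nonneg (t.Del_nonneg k j) (S.κbar_pos j).le) (Finset.mem_univ j)

/-- The domain of `𝓕`. -/
def RePos (κ : S.CJ) : Prop := ∀ j, 0 < (coords κ j).re

/-- A coordinate of `ℂ^J`. -/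
def coordL (j : Fin t.J) : S.CJ →L[ℂ] ℂ :=
  (WC.valL _).comp (ContinuousLinearMap.proj j)

@[simp] theorem coordL_apply (j : Fin t.J) (κ : S.CJ) : S.coordL j κ = coords κ j := rfl

/-- The linear form `κ ↦ Δ_k κ`. -/
def DelL (k : Idx) : S.CJ →L[ℂ] ℂ := ∑ j, (t.Del k j : ℂ) • S.coordL j

@[simp] theorem DelL_apply (k : Idx) (κ : S.CJ) : S.DelL k κ = t.DelC k (coords κ) := by
  simp [DelL, Cell.DelC]

theorem norm_coords_le (κ : S.CJ) (j : Fin t.J) : ‖coords κ j‖ ≤ S.κbar j * ‖κ‖ := by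
  have h := norm_le_pi_norm κ j
  rw [WC.norm_def] at h
  change (S.κbar j)⁻¹ * ‖coords κ j‖ ≤ _ at h
  rwa [inv_mul_eq_div, div_le_iff₀ (S.κbar_pos j), mul_comm] at h

theorem norm_DelC_le (k : Idx) (κ : S.CJ) :
    ‖t.DelC k (coords κ)‖ ≤ t.DelR k S.κbar * ‖κ‖ := by
  rw [Cell.DelC, Cell.DelR, Finset.sum_mul]
  refine norm_sum_le_of_le _ fun j _ => ?_
  rw [norm_mul, Complex.norm_real, Real.norm_of_nonneg (t.Del_nonneg k j), mul_assoc]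
  exact mul_le_mul_of_nonneg_left (S.norm_coords_le κ j) (t.Del_nonneg k j)

theorem norm_quot_le (k : Idx) (κ : S.CJ) :
    ‖t.DelC k (coords κ) / (t.DelR k S.κbar : ℂ)‖ ≤ ‖κ‖ := by
  rw [norm_div, Complex.norm_real,
    Real.norm_of_nonneg (t.DelR_nonneg k fun j => (S.κbar_pos j).le)]
  exact div_le_of_le_mul₀ (t.DelR_nonneg k fun j => (S.κbar_pos j).le) (norm_nonneg _)
    (by rw [mul_comm]; exact S.norm_DelC_le k κ)

variable {I : Type*} (ι : I → Idx)

/-- The bounded sequence `Δ_k κ / Δ_k κ̄`, as a function of `κ`. -/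
def quotL : S.CJ →L[ℂ] BS I :=
  LinearMap.mkContinuous
    { toFun := fun κ => BS.mk (fun i => t.DelC (ι i) (coords κ) / (t.DelR (ι i) S.κbar : ℂ))
        ⟨‖κ‖, fun i => S.norm_quot_le (ι i) κ⟩
      map_add' := fun κ κ' => lp.ext <| funext fun i => by
        change t.DelC (ι i) (coords (κ + κ')) / (t.DelR (ι i) S.κbar : ℂ) =
          t.DelC (ι i) (coords κ) / (t.DelR (ι i) S.κbar : ℂ)
            + t.DelC (ι i) (coords κ') / (t.DelR (ι i) S.κbar : ℂ)
        rw [← S.DelL_apply, map_add, add_div, DelL_apply, DelL_apply]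
      map_smul' := fun c κ => lp.ext <| funext fun i => by
        change t.DelC (ι i) (coords (c • κ)) / (t.DelR (ι i) S.κbar : ℂ) =
          c * (t.DelC (ι i) (coords κ) / (t.DelR (ι i) S.κbar : ℂ))
        rw [← S.DelL_apply, map_smul, smul_eq_mul, mul_div_assoc, DelL_apply] } 1
    fun κ => by
      rw [one_mul]
      exact lp.norm_le_of_forall_le (norm_nonneg _) fun i => S.norm_quot_le (ι i) κ

theorem quotL_apply (κ : S.CJ) (i : I) :
    S.quotL ι κ i = t.DelC (ι i) (coords κ) / (t.DelR (ι i) S.κbar : ℂ) := rfl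

variable {ι}

/-- The inverse of `quotL`. -/
theorem exists_inverse_quotL (hι : ∀ i, ι i ≠ 0) {κ : S.CJ} (hκ : S.RePos κ) :
    ∃ u : (BS I)ˣ, (u : BS I) = S.quotL ι κ ∧
      ∀ i, ((u⁻¹ : (BS I)ˣ) : BS I) i = (t.DelR (ι i) S.κbar : ℂ) / t.DelC (ι i) (coords κ) := by
  -- With a ≤ Re κ_j / κ̄_j for all j, |Δ_k κ| ≥ Re Δ_k κ ≥ a Δ_k κ̄ uniformly in k, so the
  -- pointwise inverse is bounded by 1/a.
  obtain ⟨a, ha, h⟩ := t.exists_pos_le (κ := fun j => (coords κ j).re / S.κbar j)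
    fun j => div_pos (hκ j) (S.κbar_pos j)
  have hb : ∀ i, ‖(t.DelR (ι i) S.κbar : ℂ) / t.DelC (ι i) (coords κ)‖ ≤ a⁻¹ := by
    intro i
    have h1 : a * t.DelR (ι i) S.κbar ≤ ‖t.DelC (ι i) (coords κ)‖ := by
      rw [← t.DelR_smul]
      exact (t.DelR_mono _ fun j => (le_div_iff₀ (S.κbar_pos j)).1 (h j)).trans
        (t.DelR_le_norm_DelC _ _)
    have hpos : 0 < ‖t.DelC (ι i) (coords κ)‖ := norm_pos_iff.2 (t.DelC_ne_zero (hι i) hκ)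
    rw [norm_div, Complex.norm_real, Real.norm_of_nonneg (t.DelR_pos S.κbar_pos (hι i)).le,
      div_le_iff₀ hpos, inv_mul_eq_div, le_div_iff₀ ha]
    linarith
  have hne : ∀ i, t.DelC (ι i) (coords κ) ≠ 0 := fun i => t.DelC_ne_zero (hι i) hκ
  have hne' : ∀ i, (t.DelR (ι i) S.κbar : ℂ) ≠ 0 := fun i =>
    Complex.ofReal_ne_zero.2 (t.DelR_pos S.κbar_pos (hι i)).ne'
  refine ⟨⟨S.quotL ι κ, BS.mk _ ⟨a⁻¹, hb⟩, ?_, ?_⟩, rfl, fun i => rfl⟩ <;>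
  · refine lp.ext (funext fun i => ?_)
    rw [lp.infty_coeFn_mul, lp.infty_coeFn_one]
    simp only [Pi.mul_apply, Pi.one_apply, quotL_apply, BS.mk_apply]
    have := hne i
    have := hne' i
    field_simp

theorem inverse_quotL_apply (hι : ∀ i, ι i ≠ 0) {κ : S.CJ} (hκ : S.RePos κ) (i : I) :
    (Ring.inverse (S.quotL ι κ) : BS I) i
      = (t.DelR (ι i) S.κbar : ℂ) / t.DelC (ι i) (coords κ) := by
  obtain ⟨u, hu, h⟩ := S.exists_inverse_quotL hι hκ
  rw [← hu, Ring.inverse_unit, h]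

/-- Inversion is differentiable at the units of the Banach algebra ℓ^∞; this treats all indices at
once, with no separate remainder estimates. -/
theorem differentiableAt_inverse_quotL (hι : ∀ i, ι i ≠ 0) {κ : S.CJ} (hκ : S.RePos κ) :
    DifferentiableAt ℂ (fun κ => (Ring.inverse (S.quotL ι κ) : BS I)) κ := by
  obtain ⟨u, hu, -⟩ := S.exists_inverse_quotL hι hκ
  have h : DifferentiableAt ℂ (Ring.inverse : BS I → BS I) (S.quotL ι κ) := by
    rw [← hu]
    exact (hasFDerivAt_ringInverse (𝕜 := ℂ) u).differentiableAt
  exact h.comp κ (S.quotL ι).differentiableAt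

/-- The nonzero Fourier indices. -/
abbrev NzIdx : Type := {k : Idx // k ≠ 0}

/-- The bounded sequence `P'(Δ_k κ)`, `k ≠ 0`. -/
def P'seq (κ : S.CJ) : BS NzIdx :=
  (1 / (S.γ : ℂ) ^ 2) • (1 : BS NzIdx)
    - (BS.mk (fun k : NzIdx => 1 / (t.DelR k S.κbar : ℂ) ^ 2) (by
        obtain ⟨a, ha, h⟩ := t.exists_pos_le_DelR S.κbar_pos
        refine ⟨1 / a ^ 2, fun k => ?_⟩
        have := h k k.2
        rw [norm_div, norm_one, norm_pow, Complex.norm_real, Real.norm_of_nonneg (by linarith)]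
        gcongr)) * (Ring.inverse (S.quotL (fun k : NzIdx => (k : Idx)) κ)
          * Ring.inverse (S.quotL (fun k : NzIdx => (k : Idx)) κ))

/-- On the domain `Ring.inverse` is a true inverse, and γ⁻² - (Δ_k κ̄)⁻² (Δ_k κ̄ / Δ_k κ)² = P'(Δ_k
κ). -/
theorem P'seq_apply {κ : S.CJ} (hκ : S.RePos κ) (k : NzIdx) :
    S.P'seq κ k = P' S.γ (t.DelC k (coords κ)) := by
  have h := S.inverse_quotL_apply (ι := fun k : NzIdx => (k : Idx)) (fun k => k.2) hκ k
  have h1 : (t.DelR k S.κbar : ℂ) ≠ 0 := Complex.ofReal_ne_zero.2 (t.DelR_pos S.κbar_pos k.2).ne'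
  have h2 := t.DelC_ne_zero k.2 hκ
  rw [P'seq, lp.coeFn_sub, lp.infty_coeFn_mul, lp.infty_coeFn_mul, lp.coeFn_smul,
    lp.infty_coeFn_one]
  simp only [Pi.sub_apply, Pi.smul_apply, Pi.mul_apply, Pi.one_apply, BS.mk_apply, h, smul_eq_mul,
    P']
  field_simp

theorem differentiableAt_P'seq {κ : S.CJ} (hκ : S.RePos κ) : DifferentiableAt ℂ S.P'seq κ := by
  have h := S.differentiableAt_inverse_quotL (ι := fun k : NzIdx => (k : Idx)) (fun k => k.2) hκ
  exact (differentiableAt_const _).sub ((differentiableAt_const _).mul (h.mul h))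

/-- The growth of Δ_k^j is charged to the weight of the first sequence, while the second is only
bounded by its norm. -/
theorem pair_le (j : Fin t.J) {C : ℝ} (hC : ∀ k, t.Del k j ≤ C * S.wν k) (c c' : WL S.wν)
    (k : NzIdx) : ‖(t.Del k j : ℂ) * (c (k : Idx)).val * (c' (-(k : Idx))).val‖
      ≤ C * ‖c'‖ * ((S.wν k : ℝ) * ‖(c (k : Idx)).val‖) := by
  rw [norm_mul, norm_mul, Complex.norm_real, Real.norm_of_nonneg (t.Del_nonneg _ j)]
  have h1 := hC k
  have h2 : ‖(c' (-(k : Idx))).val‖ ≤ ‖c'‖ :=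
    (le_mul_of_one_le_left (norm_nonneg _) (S.one_le_wν _)).trans (c'.apply_le _)
  calc t.Del k j * ‖(c (k : Idx)).val‖ * ‖(c' (-(k : Idx))).val‖
      ≤ (C * S.wν k) * ‖(c (k : Idx)).val‖ * ‖c'‖ :=
        mul_le_mul (mul_le_mul_of_nonneg_right h1 (norm_nonneg _)) h2 (norm_nonneg _)
          (mul_nonneg ((t.Del_nonneg k j).trans h1) (norm_nonneg _))
    _ = _ := by ring

/-- The unit weights. -/
def wOne : NzIdx → Set.Ioi (0 : ℝ) := fun _ => ⟨1, Set.mem_Ioi.2 one_pos⟩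

theorem wOne_coe (k : NzIdx) : (wOne k : ℝ) = 1 := rfl

theorem pair_summable (j : Fin t.J) (c c' : WL S.wν) :
    Summable fun k : NzIdx => (wOne k : ℝ) *
      ‖(t.Del k j : ℂ) * (c (k : Idx)).val * (c' (-(k : Idx))).val‖ := by
  obtain ⟨C, -, hC⟩ := S.exists_Del_le j
  simp only [wOne, one_mul]
  exact Summable.of_nonneg_of_le (fun _ => norm_nonneg _) (S.pair_le j hC c c')
    ((c.summable.subtype _).mul_left _)

/-- The bilinear map `(c, c') ↦ (Δ_k^j c_k c'_{-k})_{k ≠ 0}`. -/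
def pairL (j : Fin t.J) : WL S.wν →L[ℂ] WL S.wν →L[ℂ] WL wOne :=
  LinearMap.mkContinuous₂
    (LinearMap.mk₂ ℂ (fun c c' => WL.mk _ (S.pair_summable j c c'))
      (fun a a' b => WL.ext fun i => by simp only [WL.mk_val, WL.add_val]; ring)
      (fun c a b => WL.ext fun i => by simp only [WL.mk_val, WL.smul_val]; ring)
      (fun a b b' => WL.ext fun i => by simp only [WL.mk_val, WL.add_val]; ring)
      (fun c a b => WL.ext fun i => by simp only [WL.mk_val, WL.smul_val]; ring))
    (S.exists_Del_le j).choose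
    fun c c' => by
      change ‖(WL.mk _ (S.pair_summable j c c') : WL wOne)‖ ≤ _
      obtain ⟨h0, hC⟩ := (S.exists_Del_le j).choose_spec
      set C := (S.exists_Del_le j).choose
      have hs : Summable fun k : NzIdx => (S.wν k : ℝ) * ‖(c (k : Idx)).val‖ :=
        c.summable.subtype _
      rw [WL.norm_mk]
      calc _ ≤ ∑' k : NzIdx, C * ‖c'‖ * ((S.wν k : ℝ) * ‖(c (k : Idx)).val‖) :=
            (S.pair_summable j c c').tsum_le_tsum
              (fun k => (one_mul _).le.trans (S.pair_le j hC c c' k)) (hs.mul_left _)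
        _ = C * ‖c'‖ * ∑' k : NzIdx, (S.wν k : ℝ) * ‖(c (k : Idx)).val‖ := tsum_mul_left
        _ ≤ C * ‖c'‖ * ‖c‖ := by
            gcongr
            rw [WL.norm_eq]
            exact c.summable.tsum_subtype_le _ _
              fun k => mul_nonneg (WL.weight_nonneg k) (norm_nonneg _)
        _ = _ := by ring

theorem pairL_val (j : Fin t.J) (c c' : WL S.wν) (k : NzIdx) :
    (S.pairL j c c' k).val = (t.Del k j : ℂ) * (c (k : Idx)).val * (c' (-(k : Idx))).val := rfl

/-- Writes the infinite sum h_j through continuous linear and bilinear maps and a differentiable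
multiplier, from which its differentiability can be read off. -/
theorem h_eq (j : Fin t.J) {κ : S.CJ} (hκ : S.RePos κ) (c : WL S.wν) :
    h t S.γ (coords κ) (fun k => (c k).val) j
      = 1 / 2 * WL.sumL wOne_coe (WL.mult (S.P'seq κ) (S.pairL j c c)) := by
  change _ = 1 / 2 * ∑' k : NzIdx, (WL.mult (S.P'seq κ) (S.pairL j c c) k).val
  rw [h]
  congr 1
  refine tsum_congr fun k => ?_
  rw [WL.mult_val, S.P'seq_apply hκ, pairL_val]
  ring

end NoFintype

end Setup

end OhtaKawasaki

/-! ### Growth of `P` and the operator `T` between Banach spaces -/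

namespace OhtaKawasaki

open scoped ENNReal

/-- For γ ≥ 2, y_P is the larger zero of y² - γ² y + γ² = γ² y P(y). At γ = 2 the two branches of
the definition agree. -/
theorem yP_root {γ : ℝ} (hγ : 2 ≤ γ) :
    yP γ ^ 2 - γ ^ 2 * yP γ + γ ^ 2 = 0 ∧ 2 ≤ yP γ := by
  have h4 : 0 ≤ γ ^ 4 - 4 * γ ^ 2 := by nlinarith [sq_nonneg γ, mul_self_nonneg (γ ^ 2 - 4)]
  have hs := Real.sq_sqrt h4
  have hs0 := Real.sqrt_nonneg (γ ^ 4 - 4 * γ ^ 2)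
  have e : yP γ = (γ ^ 2 + Real.sqrt (γ ^ 4 - 4 * γ ^ 2)) / 2 := by
    unfold yP
    split_ifs with h
    · obtain rfl : γ = 2 := le_antisymm h hγ
      norm_num
    · rfl
  rw [e]
  constructor
  · linear_combination (1 / 4) * hs
  · nlinarith

/-- Beyond `y_P` the function `P` grows at least linearly. -/
theorem exists_le_P {γ : ℝ} (hγ : 0 < γ) {y₀ : ℝ} (hy : yP γ < y₀) :
    0 < y₀ ∧ ∃ c, 0 < c ∧ ∀ y, y₀ ≤ y → c * y ≤ 1 / γ ^ 2 * y - 1 + 1 / y := by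
  -- With s = 1/y the quotient P(y)/y is the quadratic γ⁻² - s + s², so it suffices to bound the
  -- latter from below for 0 < s ≤ 1/y₀.
  have main : ∀ c, 0 < y₀ → (∀ s, 0 < s → s ≤ 1 / y₀ → c ≤ 1 / γ ^ 2 - s + s ^ 2) →
      ∀ y, y₀ ≤ y → c * y ≤ 1 / γ ^ 2 * y - 1 + 1 / y := by
    intro c h0 hc y hy
    have hy0 : 0 < y := h0.trans_le hy
    have := mul_le_mul_of_nonneg_right (hc (1 / y) (by positivity)
      (one_div_le_one_div_of_le h0 hy)) hy0.le
    have e : (1 / γ ^ 2 - 1 / y + (1 / y) ^ 2) * y = 1 / γ ^ 2 * y - 1 + 1 / y := by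
      field_simp
    rwa [e] at this
  rcases lt_or_ge γ 2 with h | h
  · have h0 : 0 < y₀ := by
      have : yP γ = γ := if_pos h.le
      linarith
    -- For γ < 2 the quadratic has no real zero; its minimum, at s = 1/2, serves as the constant.
    refine ⟨h0, 1 / γ ^ 2 - 1 / 4, ?_, main _ h0 fun s _ _ => ?_⟩
    · rw [sub_pos]
      exact one_div_lt_one_div_of_lt (by positivity) (by nlinarith)
    · nlinarith [sq_nonneg (s - 1 / 2)]
  · obtain ⟨h1, h2⟩ := yP_root h
    set w := yP γ
    have h0 : 0 < y₀ := by linarith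
    have hr : 1 / y₀ < 1 / w := one_div_lt_one_div_of_lt (by linarith) hy
    have hr2 : 1 / w ≤ 1 / 2 := one_div_le_one_div_of_le (by norm_num) h2
    have hroot : 1 / γ ^ 2 - 1 / w + (1 / w) ^ 2 = 0 := by
      have : w ≠ 0 := by linarith
      field_simp
      linarith
    refine ⟨h0, (1 / w - 1 / y₀) ^ 2, by have := sub_pos.2 hr; positivity,
      main _ h0 fun s _ hs => ?_⟩
    -- Here 1/w is the smaller zero of the quadratic. As s ≤ 1/y₀ < 1/w ≤ 1/2, both factors are at
    -- least 1/w - 1/y₀.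
    have e : 1 / γ ^ 2 - s + s ^ 2 = (1 / w - s) * (1 - 1 / w - s) := by
      linear_combination hroot
    rw [e, sq]
    apply mul_le_mul <;> linarith

theorem differentiableAt_affine_comb {E R : Type*} [NormedAddCommGroup E] [NormedSpace ℂ E]
    [NormedRing R] [NormedAlgebra ℂ R] {f g : E → R} {x : E} (hf : DifferentiableAt ℂ f x)
    (hg : DifferentiableAt ℂ g x) (s : ℂ) (a b c : R) :
    DifferentiableAt ℂ (fun x => s • (a * f x) - b + c * g x) x :=
  (((hf.const_mul a).const_smul s).sub (differentiableAt_const b)).add (hg.const_mul c)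

/-- Comparison of sums along a map whose fibres are enumerated by a finite type. -/
theorem tsum_le_card_mul_tsum {I K G : Type*} [Fintype G] {f : I → ℝ} {ψ : K → ℝ} (rep : I → K)
    (gr : I → G) (hinj : Function.Injective fun k => (gr k, rep k)) (hf : ∀ k, 0 ≤ f k)
    (hψ : ∀ k, 0 ≤ ψ k) (hs : Summable ψ) (hle : ∀ k, f k ≤ ψ (rep k)) :
    Summable f ∧ ∑' k, f k ≤ Fintype.card G * ∑' k, ψ k := by
  have h1 : Summable fun _ : G => (1 : ℝ) := (hasSum_fintype _).summable
  have hprod : Summable fun p : G × K => (1 : ℝ) * ψ p.2 :=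
    h1.mul_of_nonneg hs (fun _ => zero_le_one) hψ
  have htsum : ∑' p : G × K, (1 : ℝ) * ψ p.2 = Fintype.card G * ∑' k, ψ k := by
    rw [← tsum_mul_tsum_of_summable_norm h1.norm hs.norm, tsum_fintype]
    simp
  have hcomp : Summable fun k => (1 : ℝ) * ψ (rep k) := hprod.comp_injective hinj
  have hle' : ∀ k, f k ≤ 1 * ψ (rep k) := fun k => by rw [one_mul]; exact hle k
  have hfin := Summable.of_nonneg_of_le hf hle' hcomp
  refine ⟨hfin, ?_⟩
  calc _ ≤ ∑' k, (1 : ℝ) * ψ (rep k) := hfin.tsum_le_tsum hle' hcomp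
    _ ≤ ∑' p : G × K, (1 : ℝ) * ψ p.2 :=
        hcomp.tsum_le_tsum_of_inj (fun k => (gr k, rep k)) hinj
          (fun p _ => mul_nonneg zero_le_one (hψ _)) (fun _ => le_rfl) hprod
    _ = _ := htsum

namespace Setup

section NoFintype

variable {t : Cell} {G : Type*} [Group G] (S : Setup t G)

theorem P_κbar (k : Idx) : P S.γ (t.DelC k fun j => (S.κbar j : ℂ))
    = ((1 / S.γ ^ 2 * t.DelR k S.κbar - 1 + 1 / t.DelR k S.κbar : ℝ) : ℂ) := by
  rw [Cell.DelC_ofReal, P]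
  push_cast
  rfl

/-- The cut-off condition enters here: ‖k‖ > K gives Δ_k κ̄ = ‖k‖² ≥ K² > y_P, so the growth bound
applies with y₀ = K². -/
theorem exists_le_P_tail : ∃ c, 0 < c ∧ ∀ k : Idx, S.K < S.knorm k →
    c * t.DelR k S.κbar ≤ 1 / S.γ ^ 2 * t.DelR k S.κbar - 1 + 1 / t.DelR k S.κbar ∧
    0 < t.DelR k S.κbar := by
  have hK := S.K_gt
  have hK0 : 0 ≤ S.K := (Real.sqrt_nonneg _).trans hK.le
  obtain ⟨h0, c, hc, h⟩ := exists_le_P S.γ_pos (Real.lt_sq_of_sqrt_lt hK)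
  refine ⟨c, hc, fun k hk => ?_⟩
  have : S.K ^ 2 ≤ t.DelR k S.κbar := by
    rw [← S.knorm_sq]; gcongr
  exact ⟨h _ this, h0.trans_le this⟩

open Classical in
/-- The multiplier `1 / P(Δ_k κ̄)`, cut off to the indices with `‖k‖ > K`. -/
def lam (k : Idx) : ℝ :=
  if S.knorm k ≤ S.K then 0
  else 1 / (1 / S.γ ^ 2 * t.DelR k S.κbar - 1 + 1 / t.DelR k S.κbar)

theorem lam_act (g : G) (k : Idx) : S.lam (S.act g k) = S.lam k := by
  simp only [lam, knorm_act, S.DelR_act]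

theorem lam_neg (k : Idx) : S.lam (-k) = S.lam k := by
  simp only [lam, knorm_neg, t.DelR_neg]

/-- Linear growth of P on the tail makes λ_k Δ_k κ̄ bounded; this compensates the linear growth of
P(Δ_k κ) in the tail of 𝒜𝓕. -/
theorem lam_nonneg_and_le : ∃ C, ∀ k : Idx, 0 ≤ S.lam k ∧ S.lam k * t.DelR k S.κbar ≤ C := by
  obtain ⟨c, hc, h⟩ := S.exists_le_P_tail
  refine ⟨1 / c, fun k => ?_⟩
  rw [lam]
  split_ifs with hk
  · simp [hc.le]
  · obtain ⟨h1, h2⟩ := h k (not_le.1 hk)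
    have h3 : 0 < c * t.DelR k S.κbar := mul_pos hc h2
    have h4 := h3.trans_le h1
    refine ⟨(one_div_pos.2 h4).le, ?_⟩
    rw [one_div_mul_eq_div, div_le_div_iff₀ h4 hc]
    linarith

theorem summable_m : Summable fun k : Idx =>
    (S.wν k : ℝ) * ‖(if k = 0 then (S.m : ℂ) else 0)‖ :=
  summable_of_ne_finset_zero (s := {0}) fun k hk => by
    rw [if_neg (by simpa using hk), norm_zero, mul_zero]

end NoFintype

variable {t : Cell} {G : Type*} [Group G] [Fintype G] (S : Setup t G)

instance finite_ZK : Finite S.ZK := by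
  have h := t.finite_DelR_le S.κbar_pos (S.K ^ 2)
  have h1 : S.ZK.Finite := by
    refine (h.preimage (Set.injOn_of_injective Subtype.val_injective)).subset fun k hk => ?_
    change t.DelR _ _ ≤ _
    rw [← S.knorm_sq]
    have : S.knorm k ≤ S.K := hk
    have := S.knorm_nonneg k
    gcongr
  exact h1.to_subtype

instance fintype_ZK : Fintype S.ZK := Fintype.ofFinite _

theorem lam_of_mem {k : S.Z0} (hk : k ∈ S.ZK) : S.lam k = 0 := if_pos hk

theorem lam_of_not_mem {k : S.Z0} (hk : k ∉ S.ZK) :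
    (S.lam k : ℂ) = 1 / P S.γ (t.DelC k fun j => (S.κbar j : ℂ)) := by
  rw [lam, if_neg (show ¬ S.knorm k ≤ S.K from hk), P_κbar]
  push_cast
  rfl

theorem lam_ne_zero {k : S.Z0} (hk : k ∉ S.ZK) : S.lam k ≠ 0 := by
  obtain ⟨c, hc, h⟩ := S.exists_le_P_tail
  have hk' : ¬ S.knorm k ≤ S.K := hk
  obtain ⟨h1, h2⟩ := h k (not_le.1 hk')
  rw [lam, if_neg hk']
  have : 0 < c * t.DelR k S.κbar := mul_pos hc h2
  exact one_div_ne_zero (by linarith)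

theorem Λinv_eq (b : S.Z0 → ℂ) (k : S.Z0) :
    S.Λinv b k = (S.lam k : ℂ) / (S.orbCard k : ℂ) * b k := by
  by_cases hk : k ∈ S.ZK
  · rw [Λinv, if_pos hk, S.lam_of_mem hk]; simp
  · rw [Λinv, if_neg hk, S.lam_of_not_mem hk, div_div]

theorem exists_lam_mul_le : ∃ C, ∀ k : S.Z0, ‖(S.lam k * t.DelR k S.κbar : ℂ)‖ ≤ C := by
  obtain ⟨C, h⟩ := S.lam_nonneg_and_le
  refine ⟨C, fun k => ?_⟩
  obtain ⟨h1, h2⟩ := h k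
  rw [← Complex.ofReal_mul, Complex.norm_real,
    Real.norm_of_nonneg (mul_nonneg h1 (t.DelR_pos S.κbar_pos k.2.2).le)]
  exact h2

theorem exists_lam_le : ∃ C, ∀ k : S.Z0, ‖(S.lam k : ℂ)‖ ≤ C := by
  obtain ⟨C, h⟩ := S.lam_nonneg_and_le
  obtain ⟨a, ha, h'⟩ := t.exists_pos_le_DelR S.κbar_pos
  refine ⟨C / a, fun k => ?_⟩
  obtain ⟨h1, h2⟩ := h k
  rw [Complex.norm_real, Real.norm_of_nonneg h1, le_div_iff₀ ha]
  exact (mul_le_mul_of_nonneg_left (h' k k.2.2) h1).trans h2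

theorem exists_lam_div_le : ∃ C, ∀ k : S.Z0, ‖(S.lam k / t.DelR k S.κbar : ℂ)‖ ≤ C := by
  obtain ⟨C, h⟩ := S.exists_lam_le
  obtain ⟨a, ha, h'⟩ := t.exists_pos_le_DelR S.κbar_pos
  refine ⟨C / a, fun k => ?_⟩
  have := h' k k.2.2
  rw [norm_div, Complex.norm_real (t.DelR k S.κbar),
    Real.norm_of_nonneg (t.DelR_pos S.κbar_pos k.2.2).le]
  have := h k
  have := norm_nonneg (S.lam k : ℂ)
  gcongr
  linarith

/-- The inclusion of the reduced indices. -/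
abbrev ιZ (k : S.Z0) : Idx := k

/-- The bounded sequence `P(Δ_k κ) / P(Δ_k κ̄)`, cut off. -/
def tailMult (κ : S.CJ) : BS S.Z0 :=
  (1 / (S.γ : ℂ) ^ 2) • (BS.mk _ S.exists_lam_mul_le * S.quotL S.ιZ κ)
    - BS.mk _ S.exists_lam_le + BS.mk _ S.exists_lam_div_le * Ring.inverse (S.quotL S.ιZ κ)

/-- Expand λ_k P(Δ_k κ) as γ⁻² (λ_k Δ_k κ̄)(Δ_k κ/Δ_k κ̄) - λ_k + (λ_k/Δ_k κ̄)(Δ_k κ̄/Δ_k κ); every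
factor is a bounded sequence. -/
theorem tailMult_apply {κ : S.CJ} (hκ : S.RePos κ) (k : S.Z0) :
    S.tailMult κ k = (S.lam k : ℂ) * P S.γ (t.DelC k (coords κ)) := by
  have h := S.inverse_quotL_apply (ι := S.ιZ) (fun k => k.2.2) hκ k
  have h1 : (t.DelR k S.κbar : ℂ) ≠ 0 := Complex.ofReal_ne_zero.2 (t.DelR_pos S.κbar_pos k.2.2).ne'
  have h2 := t.DelC_ne_zero k.2.2 hκ
  rw [tailMult, lp.coeFn_add, lp.coeFn_sub, lp.infty_coeFn_mul, lp.coeFn_smul, lp.infty_coeFn_mul]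
  simp only [Pi.add_apply, Pi.sub_apply, Pi.smul_apply, Pi.mul_apply, BS.mk_apply, h, smul_eq_mul,
    P, quotL_apply]
  field_simp

theorem differentiableAt_tailMult {κ : S.CJ} (hκ : S.RePos κ) :
    DifferentiableAt ℂ S.tailMult κ := by
  have h := S.differentiableAt_inverse_quotL (ι := S.ιZ) (fun k => k.2.2) hκ
  exact differentiableAt_affine_comb (S.quotL S.ιZ).differentiableAt h _ _ _ _

theorem orbCard_le (k : Idx) : S.orbCard k ≤ Fintype.card G := by
  rw [SpaceGroup.orbCard, SpaceGroup.orbit, ← Set.image_univ]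
  refine (Set.ncard_image_le Set.finite_univ).trans ?_
  rw [Set.ncard_univ, Nat.card_eq_fintype_card]

theorem ω_coe (k : Idx) : (S.ω k : ℝ) = S.orbCard k * S.wν k := rfl

theorem wν_le_ω (k : Idx) : (S.wν k : ℝ) ≤ S.ω k := by
  rw [ω_coe]
  exact le_mul_of_one_le_left (WL.weight_nonneg k) (by exact_mod_cast S.orbCard_pos k)

theorem ω_le (k : Idx) : (S.ω k : ℝ) ≤ Fintype.card G * S.wν k := by
  rw [ω_coe]
  exact mul_le_mul_of_nonneg_right (by exact_mod_cast S.orbCard_le k) (WL.weight_nonneg k)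

theorem res_le (c : WL S.wν) (k : S.Z0) : (S.ω k : ℝ) * ‖(c (k : Idx)).val‖
    ≤ Fintype.card G * ((S.wν k : ℝ) * ‖(c (k : Idx)).val‖) := by
  rw [← mul_assoc]
  exact mul_le_mul_of_nonneg_right (S.ω_le k) (norm_nonneg _)

theorem res_summable (c : WL S.wν) :
    Summable fun k : S.Z0 => (S.ω k : ℝ) * ‖(c (k : Idx)).val‖ :=
  Summable.of_nonneg_of_le (fun k => mul_nonneg (WL.weight_nonneg (k : Idx)) (norm_nonneg _))
    (S.res_le c) ((c.summable.subtype _).mul_left _)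

/-- The restriction to the reduced indices. -/
def resL : WL S.wν →L[ℂ] S.X0 :=
  LinearMap.mkContinuous
    { toFun := fun c => (WL.mk (fun k : S.Z0 => (c (k : Idx)).val) (S.res_summable c) :
        WL fun k : S.Z0 => S.ω k)
      map_add' := fun _ _ => rfl
      map_smul' := fun _ _ => rfl } (Fintype.card G)
    fun c => by
      change ‖(WL.mk (fun k : S.Z0 => (c (k : Idx)).val) (S.res_summable c) :
        WL fun k : S.Z0 => S.ω k)‖ ≤ _
      rw [WL.norm_mk, WL.norm_eq, ← tsum_mul_left]
      refine ((S.res_summable c).tsum_le_tsum (S.res_le c)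
        ((c.summable.subtype _).mul_left _)).trans ?_
      exact (c.summable.mul_left _).tsum_subtype_le _ _
        fun k => mul_nonneg (Nat.cast_nonneg _) (mul_nonneg (WL.weight_nonneg k) (norm_nonneg _))

theorem seq_apply (b : S.X0) (k : S.Z0) : seq b k = (b k).val := rfl

theorem σ₀_add (b b' : S.Z0 → ℂ) (k : Idx) : S.σ₀ (b + b') k = S.σ₀ b k + S.σ₀ b' k := by
  have h := eq_σ₀ ((S.σ₀_equivariant b).add (S.σ₀_equivariant b')) (by simp [σ₀_zero])
  simp only [σ₀_apply] at h
  exact (congrFun h k).symm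

theorem σ₀_smul (c : ℂ) (b : S.Z0 → ℂ) (k : Idx) : S.σ₀ (c • b) k = c * S.σ₀ b k := by
  have h := eq_σ₀ ((S.σ₀_equivariant b).mul_invariant (χ := fun _ => c) fun _ _ => rfl)
    (by simp [σ₀_zero])
  simp only [σ₀_apply] at h
  exact (congrFun h k).symm

theorem summable_σ₀_aux (b : S.X0) :
    Summable (S.Z0.indicator fun k => (S.wν k : ℝ) * ‖S.σ₀ (seq b) k‖) ∧
    ∑' k, S.Z0.indicator (fun k => (S.wν k : ℝ) * ‖S.σ₀ (seq b) k‖) k ≤ ‖b‖ := by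
  have hle : ∀ k : S.Z0, (S.wν k : ℝ) * ‖S.σ₀ (seq b) k‖ ≤ (S.ω k : ℝ) * ‖(b k).val‖ := fun k => by
    rw [σ₀_apply]
    exact mul_le_mul_of_nonneg_right (S.wν_le_ω k) (norm_nonneg _)
  have hb : Summable fun k : S.Z0 => (S.ω k : ℝ) * ‖(b k).val‖ := WL.summable b
  have hs0 : Summable fun k : S.Z0 => (S.wν k : ℝ) * ‖S.σ₀ (seq b) k‖ :=
    Summable.of_nonneg_of_le (fun k => mul_nonneg (WL.weight_nonneg (k : Idx)) (norm_nonneg _))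
      hle hb
  refine ⟨summable_subtype_iff_indicator.1 hs0, ?_⟩
  rw [← tsum_subtype S.Z0 (fun k => (S.wν k : ℝ) * ‖S.σ₀ (seq b) k‖), WL.norm_eq]
  exact hs0.tsum_le_tsum hle hb

/-- Modulus and weight are constant on orbits, and an index is determined by its representative and
a group element carrying the one to the other. So each representative is counted at most |G| times,
and those outside `Z0` contribute nothing. -/
theorem summable_σ₀ (b : S.X0) :
    Summable (fun k => (S.wν k : ℝ) * ‖S.σ₀ (seq b) k‖) ∧
    ∑' k, (S.wν k : ℝ) * ‖S.σ₀ (seq b) k‖ ≤ Fintype.card G * ‖b‖ := by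
  choose rep hrep gr hgr using S.exists_rep
  obtain ⟨hs, hsum⟩ := S.summable_σ₀_aux b
  have h := tsum_le_card_mul_tsum (f := fun k => (S.wν k : ℝ) * ‖S.σ₀ (seq b) k‖) rep gr
    (fun k k' h => by
      have h' := Prod.mk.inj h
      rw [← hgr k, h'.1, h'.2, hgr])
    (fun k => mul_nonneg (WL.weight_nonneg k) (norm_nonneg _))
    (fun k => Set.indicator_nonneg
      (fun k _ => mul_nonneg (WL.weight_nonneg k) (norm_nonneg _)) k) hs fun k => by
    have e1 : S.wν k = S.wν (rep k) := by conv_lhs => rw [← hgr k, S.wν_act]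
    have e2 : ‖S.σ₀ (seq b) k‖ = ‖S.σ₀ (seq b) (rep k)‖ := by
      conv_lhs => rw [← hgr k, (S.σ₀_equivariant _).apply, norm_mul, norm_inv, S.norm_α, inv_one,
        mul_one]
    rw [e1, e2]
    by_cases hz : rep k ∈ S.Z0
    · rw [Set.indicator_of_mem hz]
    · rw [Set.indicator_of_notMem hz]
      suffices S.σ₀ (seq b) (rep k) = 0 by rw [this, norm_zero, mul_zero]
      by_cases hk : rep k = 0
      · rw [hk, σ₀_zero]
      · exact (S.σ₀_equivariant _).eq_zero fun h => hz ⟨⟨h, hrep k⟩, hk⟩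
  exact ⟨h.1, h.2.trans (mul_le_mul_of_nonneg_left hsum (Nat.cast_nonneg _))⟩

/-- `σ` as a continuous linear map. -/
def σ₀L : S.X0 →L[ℂ] WL S.wν :=
  LinearMap.mkContinuous
    { toFun := fun b => WL.mk (S.σ₀ (seq b)) (S.summable_σ₀ b).1
      map_add' := fun b b' => WL.ext fun k => S.σ₀_add (seq b) (seq b') k
      map_smul' := fun c b => WL.ext fun k => S.σ₀_smul c (seq b) k } (Fintype.card G)
    fun b => by
      change ‖(WL.mk (S.σ₀ (seq b)) (S.summable_σ₀ b).1 : WL S.wν)‖ ≤ _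
      rw [WL.norm_mk]
      exact (S.summable_σ₀ b).2

/-- `b ↦ σ(m e₀ + b)` as a map between Banach spaces. -/
def coeffW (b : S.X0) : WL S.wν :=
  S.σ₀L b + WL.mk (fun k => if k = 0 then (S.m : ℂ) else 0) S.summable_m

theorem coeffW_val (b : S.X0) (k : Idx) : (S.coeffW b k).val = S.coeff (seq b) k := by
  rw [coeff_eq]
  rfl

theorem coeffW_fun (b : S.X0) : (fun k => (S.coeffW b k).val) = S.coeff (seq b) :=
  funext (S.coeffW_val b)

theorem summable_coeff (b : S.X0) : Summable fun k => (S.wν k : ℝ) * ‖S.coeff (seq b) k‖ := by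
  have := (S.coeffW b).summable
  simpa only [coeffW_val] using this

theorem differentiable_coeffW : Differentiable ℂ S.coeffW :=
  S.σ₀L.differentiable.add_const _

/-- The cubic term. -/
def cube (b : S.X0) : WL S.wν :=
  convL S.wν_add (S.coeffW b) (convL S.wν_add (S.coeffW b) (S.coeffW b))

theorem cube_val (b : S.X0) (k : Idx) : (S.cube b k).val
    = conv (S.coeff (seq b)) (conv (S.coeff (seq b)) (S.coeff (seq b))) k := by
  rw [← coeffW_fun]
  rfl

theorem differentiable_cube : Differentiable ℂ S.cube := by
  have h := S.differentiable_coeffW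
  have h2 : Differentiable ℂ fun b => convL S.wν_add (S.coeffW b) :=
    (convL S.wν_add).differentiable.comp h
  exact h2.clm_apply (h2.clm_apply h)

/-- The components of `𝓕` with `‖k‖ ≤ K`. -/
def headF (x : S.CJ × S.X0) : S.Fin0 := S.proj (S.F x)

theorem differentiableAt_headF {x : S.CJ × S.X0} (hx : S.RePos x.1) :
    DifferentiableAt ℂ S.headF x := by
  have hc : DifferentiableAt ℂ (fun x : S.CJ × S.X0 => S.coeffW x.2) x :=
    (S.differentiable_coeffW x.2).comp x differentiableAt_snd
  have hopen : ∀ᶠ y : S.CJ × S.X0 in nhds x, S.RePos y.1 := by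
    refine Filter.eventually_all.2 fun j => ?_
    have : Continuous fun y : S.CJ × S.X0 => (coords y.1 j).re :=
      Complex.continuous_re.comp ((S.coordL j).continuous.comp continuous_fst)
    exact (this.tendsto x).eventually_const_lt (hx j)
  refine DifferentiableAt.prodMk ?_ ?_
  · refine differentiableAt_pi.2 fun j => ?_
    -- The factored form of h_j is valid only where Re κ > 0, hence an equality near x rather than
    -- everywhere.
    have e : (fun y : S.CJ × S.X0 => (S.F y).1 j) =ᶠ[nhds x] fun y =>
        1 / 2 * WL.sumL wOne_coe (WL.mult (S.P'seq y.1) (S.pairL j (S.coeffW y.2) (S.coeffW y.2)))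
        := by
      filter_upwards [hopen] with y hy
      rw [← S.h_eq j hy, coeffW_fun]
      rfl
    refine DifferentiableAt.congr_of_eventuallyEq ?_ e
    have h1 : DifferentiableAt ℂ (fun y : S.CJ × S.X0 => S.P'seq y.1) x :=
      (S.differentiableAt_P'seq hx).comp x differentiableAt_fst
    have h2 : DifferentiableAt ℂ
        (fun y : S.CJ × S.X0 => S.pairL j (S.coeffW y.2) (S.coeffW y.2)) x :=
      ((S.pairL j).differentiableAt.comp x hc).clm_apply hc
    have h3 := ((WL.mult (w := wOne)).differentiableAt.comp x h1).clm_apply h2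
    exact ((WL.sumL wOne_coe).differentiableAt.comp x h3).const_mul _
  · refine differentiableAt_pi.2 fun k => ?_
    have e : (fun y : S.CJ × S.X0 => (S.F y).2 k) = fun y =>
        (S.orbCard (k : S.Z0) : ℂ) * (P S.γ (S.DelL (k : S.Z0) y.1)
          * WL.eval ((k : S.Z0) : Idx) (S.coeffW y.2) + WL.eval ((k : S.Z0) : Idx) (S.cube y.2))
        := by
      ext y
      rw [WL.eval_apply, WL.eval_apply, cube_val, coeffW_val, DelL_apply]
      rfl
    change DifferentiableAt ℂ (fun y : S.CJ × S.X0 => (S.F y).2 k) x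
    rw [e]
    have hD : DifferentiableAt ℂ (fun y : S.CJ × S.X0 => S.DelL (k : S.Z0) y.1) x :=
      (S.DelL _).differentiableAt.comp x differentiableAt_fst
    have hne : S.DelL (k : S.Z0) x.1 ≠ 0 := by
      rw [DelL_apply]; exact t.DelC_ne_zero (k : S.Z0).2.2 hx
    have hP : DifferentiableAt ℂ (fun y : S.CJ × S.X0 => P S.γ (S.DelL (k : S.Z0) y.1)) x := by
      simp only [P, div_eq_mul_inv]
      exact ((hD.const_mul _).sub (differentiableAt_const _)).add
        ((hD.fun_inv hne).const_mul 1)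
    have h1 : DifferentiableAt ℂ
        (fun y : S.CJ × S.X0 => WL.eval ((k : S.Z0) : Idx) (S.coeffW y.2)) x :=
      (WL.eval _).differentiableAt.comp x hc
    have h2 : DifferentiableAt ℂ
        (fun y : S.CJ × S.X0 => WL.eval ((k : S.Z0) : Idx) (S.cube y.2)) x :=
      (WL.eval _).differentiableAt.comp x ((S.differentiable_cube x.2).comp x differentiableAt_snd)
    exact ((hP.mul h1).add h2).const_mul _

/-- The inclusion into `ℂ^J`. -/
def inclJ : S.Fin0 →L[ℂ] S.CJ :=
  LinearMap.toContinuousLinearMap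
    { toFun := fun y => S.toCJ y.1, map_add' := fun _ _ => rfl, map_smul' := fun _ _ => rfl }

theorem incl_summable (y : S.Fin0) :
    Summable fun k : S.Z0 => (S.ω k : ℝ) * ‖(S.incl y).2 k‖ := by
  refine summable_of_hasFiniteSupport ((Set.toFinite S.ZK).subset fun k hk => ?_)
  by_contra h
  exact hk (by simp [incl, h])

/-- The inclusion into `X₀`. -/
def inclX : S.Fin0 →L[ℂ] S.X0 :=
  LinearMap.toContinuousLinearMap
    { toFun := fun y => (WL.mk (S.incl y).2 (S.incl_summable y) : WL fun k : S.Z0 => S.ω k)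
      map_add' := fun y y' => WL.ext fun k => by
        simp only [WL.mk_val, WL.add_val, incl]
        split_ifs <;> simp
      map_smul' := fun c y => WL.ext fun k => by
        simp only [WL.mk_val, incl, RingHom.id_apply, WL.smul_val]
        split_ifs <;> simp }

theorem inclX_val (y : S.Fin0) (k : S.Z0) : (S.inclX y k).val = (S.incl y).2 k := rfl

/-- The tail of `𝒜 𝓕`. -/
def tail (x : S.CJ × S.X0) : S.X0 :=
  WL.mult (S.tailMult x.1) x.2 + WL.mult (BS.mk _ S.exists_lam_le) (S.resL (S.cube x.2))

/-- The orbit sizes in 𝓕 and in `Λinv` cancel, leaving λ_k P(Δ_k κ) b_k + λ_k ⟨c³⟩_k. -/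
theorem tail_val {x : S.CJ × S.X0} (hx : S.RePos x.1) (k : S.Z0) :
    (S.tail x k).val = S.Λinv (S.F x).2 k := by
  have hn : (S.orbCard k : ℂ) ≠ 0 := Nat.cast_ne_zero.2 (S.orbCard_pos k).ne'
  change S.tailMult x.1 k * (x.2 k).val + (S.lam k : ℂ) * (S.cube x.2 (k : Idx)).val = _
  rw [Λinv_eq, S.tailMult_apply hx, cube_val]
  change _ = (S.lam k : ℂ) / (S.orbCard k : ℂ) * ((S.orbCard k : ℂ) *
    (P S.γ (t.DelC k (coords x.1)) * S.coeff (seq x.2) k + conv (S.coeff (seq x.2))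
      (conv (S.coeff (seq x.2)) (S.coeff (seq x.2))) k))
  rw [coeff_apply, seq_apply]
  field_simp

theorem toX0_seq (b : S.X0) : S.toX0 (seq b) = b := by
  rw [toX0, dif_pos (show Memℓp (fun k : S.Z0 => (WC.mk (seq b k) : WC (S.ω k))) 1 from b.2)]
  rfl

/-- Exhibits the raw sequence in the definition of T as that of an element of X₀, so on the domain
the default value 0 of `toX0` plays no role. -/
theorem T_snd {x : S.CJ × S.X0} (hx : S.RePos x.1) (A : Module.End ℂ S.Fin0) :
    seq x.2 - (S.AA A (S.F x)).2 = seq (x.2 - S.inclX (A (S.headF x)) - S.tail x) := by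
  ext k
  change _ = (x.2 k).val - (S.inclX (A (S.headF x)) k).val - (S.tail x k).val
  rw [S.tail_val hx, inclX_val, sub_sub]
  rfl

theorem T_eq {x : S.CJ × S.X0} (hx : S.RePos x.1) (A : Module.End ℂ S.Fin0) :
    S.T A x = (x.1 - S.inclJ (A (S.headF x)), x.2 - S.inclX (A (S.headF x)) - S.tail x) := by
  refine Prod.ext ?_ ?_
  · change x.1 - S.toCJ ((A (S.headF x)).1 + 0) = _
    rw [add_zero]
    rfl
  · change S.toX0 _ = _
    rw [S.T_snd hx, toX0_seq]

theorem isOpen_RePos : IsOpen {x : S.CJ × S.X0 | S.RePos x.1} := by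
  have : {x : S.CJ × S.X0 | S.RePos x.1} = ⋂ j, {x | 0 < (coords x.1 j).re} := by
    ext x; simp [RePos]
  rw [this]
  refine isOpen_iInter_of_finite fun j => isOpen_lt continuous_const ?_
  exact Complex.continuous_re.comp ((S.coordL j).continuous.comp continuous_fst)

theorem differentiableAt_T {x : S.CJ × S.X0} (hx : S.RePos x.1) (A : Module.End ℂ S.Fin0) :
    DifferentiableAt ℂ (S.T A) x := by
  have hA : DifferentiableAt ℂ (fun x => A (S.headF x)) x :=
    (LinearMap.toContinuousLinearMap A).differentiableAt.comp x (S.differentiableAt_headF hx)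
  have ht : DifferentiableAt ℂ S.tail x := by
    have h1 : DifferentiableAt ℂ (fun y : S.CJ × S.X0 => S.tailMult y.1) x :=
      (S.differentiableAt_tailMult hx).comp x differentiableAt_fst
    have h2 : DifferentiableAt ℂ (fun y : S.CJ × S.X0 => S.cube y.2) x :=
      (S.differentiable_cube x.2).comp x differentiableAt_snd
    have h3 : DifferentiableAt ℂ (fun y : S.CJ × S.X0 => WL.mult (w := fun k : S.Z0 => S.ω k)
        (S.tailMult y.1) y.2) x :=
      ((WL.mult (w := fun k : S.Z0 => S.ω k)).differentiableAt.comp x h1).clm_apply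
        differentiableAt_snd
    have h4 : DifferentiableAt ℂ (fun y : S.CJ × S.X0 => WL.mult (w := fun k : S.Z0 => S.ω k)
        (BS.mk _ S.exists_lam_le) (S.resL (S.cube y.2))) x :=
      (WL.mult _).differentiableAt.comp x (S.resL.differentiableAt.comp x h2)
    exact h3.add h4
  have h : DifferentiableAt ℂ (fun x : S.CJ × S.X0 => (x.1 - S.inclJ (A (S.headF x)),
      x.2 - S.inclX (A (S.headF x)) - S.tail x)) x :=
    (differentiableAt_fst.sub (S.inclJ.differentiableAt.comp x hA)).prodMk
      ((differentiableAt_snd.sub (S.inclX.differentiableAt.comp x hA)).sub ht)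
  refine h.congr_of_eventuallyEq ?_
  filter_upwards [S.isOpen_RePos.mem_nhds hx] with y hy
  exact S.T_eq hy A

end Setup

end OhtaKawasaki

namespace OhtaKawasaki

/-! ### A contraction argument with two components -/

section Contraction

open Set

variable {E₁ E₂ F : Type*} [NormedAddCommGroup E₁] [NormedSpace ℂ E₁] [NormedAddCommGroup E₂]
  [NormedSpace ℂ E₂] [NormedAddCommGroup F] [NormedSpace ℂ F]

theorem fderiv_eq_partial {g : E₁ × E₂ → F} {x : E₁ × E₂} (hg : DifferentiableAt ℂ g x)
    (v : E₁ × E₂) : fderiv ℂ g x v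
      = fderiv ℂ (fun y => g (y, x.2)) x.1 v.1 + fderiv ℂ (fun y => g (x.1, y)) x.2 v.2 := by
  have h1 : HasFDerivAt (fun y => g (y, x.2)) _ x.1 :=
    HasFDerivAt.comp x.1 (g := g) (f := fun y => (y, x.2)) hg.hasFDerivAt
      (hasFDerivAt_prodMk_left x.1 x.2)
  have h2 : HasFDerivAt (fun y => g (x.1, y)) _ x.2 :=
    HasFDerivAt.comp x.2 (g := g) (f := fun y => (x.1, y)) hg.hasFDerivAt
      (hasFDerivAt_prodMk_right x.1 x.2)
  rw [h1.fderiv, h2.fderiv]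
  simp only [ContinuousLinearMap.comp_apply, ContinuousLinearMap.inl_apply,
    ContinuousLinearMap.inr_apply, ← map_add]
  simp

/-- The mean value inequality along a segment, with bounds on the partial derivatives that
increase linearly along the segment. -/
theorem norm_sub_le_of_partial_bounds {g : E₁ × E₂ → F} {x y : E₁ × E₂} {a₁ a₂ b₁ b₂ d₁ d₂ : ℝ}
    (hg : ∀ s ∈ Icc (0 : ℝ) 1, DifferentiableAt ℂ g (x + (s : ℂ) • (y - x)))
    (h₁ : ∀ s ∈ Icc (0 : ℝ) 1, ‖fderiv ℂ (fun z => g (z, (x + (s : ℂ) • (y - x)).2))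
      (x + (s : ℂ) • (y - x)).1‖ ≤ a₁ + s * b₁)
    (h₂ : ∀ s ∈ Icc (0 : ℝ) 1, ‖fderiv ℂ (fun z => g ((x + (s : ℂ) • (y - x)).1, z))
      (x + (s : ℂ) • (y - x)).2‖ ≤ a₂ + s * b₂)
    (hd₁ : ‖(y - x).1‖ ≤ d₁) (hd₂ : ‖(y - x).2‖ ≤ d₂) :
    ‖g y - g x‖ ≤ (a₁ + 1 / 2 * b₁) * d₁ + (a₂ + 1 / 2 * b₂) * d₂ := by
  set γ : ℝ → E₁ × E₂ := fun s => x + (s : ℂ) • (y - x) with hγ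
  have hγ' : ∀ s : ℝ, HasDerivAt γ (y - x) s := fun s => by
    have h : HasDerivAt (fun s : ℝ => (s : ℂ)) 1 s := Complex.ofRealCLM.hasDerivAt
    simpa [hγ] using (h.smul_const (y - x)).const_add x
  have hφ : ∀ s ∈ Icc (0 : ℝ) 1,
      HasDerivAt (fun s => g (γ s) - g x) (fderiv ℂ g (γ s) (y - x)) s := fun s hs => by
    have := ((hg s hs).hasFDerivAt.restrictScalars ℝ).comp_hasDerivAt s (hγ' s)
    exact this.sub_const _
  -- The comparison function is the antiderivative of the bound; the linear growth in s integrates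
  -- to the factor ½ at s = 1.
  have hB : ∀ s : ℝ, HasDerivAt
      (fun s => (a₁ * s + 1 / 2 * b₁ * s ^ 2) * d₁ + (a₂ * s + 1 / 2 * b₂ * s ^ 2) * d₂)
      ((a₁ + s * b₁) * d₁ + (a₂ + s * b₂) * d₂) s := fun s => by
    have h0 := hasDerivAt_id s
    have := ((((h0.const_mul a₁).add ((h0.pow 2).const_mul (1 / 2 * b₁))).mul_const d₁).add
      (((h0.const_mul a₂).add ((h0.pow 2).const_mul (1 / 2 * b₂))).mul_const d₂))
    refine this.congr_deriv ?_
    simp only [id]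
    ring
  have := image_norm_le_of_norm_deriv_right_le_deriv_boundary (a := (0 : ℝ)) (b := 1)
    (f := fun s => g (γ s) - g x) (f' := fun s => fderiv ℂ g (γ s) (y - x))
    (fun s hs => (hφ s hs).continuousAt.continuousWithinAt)
    (fun s hs => (hφ s (Ico_subset_Icc_self hs)).hasDerivWithinAt) (by simp [hγ]) hB
    (fun s hs => by
      have hs' := Ico_subset_Icc_self hs
      rw [fderiv_eq_partial (hg s hs')]
      refine (norm_add_le _ _).trans (add_le_add ?_ ?_)
      · exact ContinuousLinearMap.le_of_opNorm_le_of_le _ (h₁ s hs') hd₁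
      · exact ContinuousLinearMap.le_of_opNorm_le_of_le _ (h₂ s hs') hd₂)
    (x := 1) (by simp)
  simpa [hγ] using this

/-- A nonnegative `2 × 2` matrix of spectral radius less than one contracts a positive vector. -/
theorem exists_contracted_vector {a b c d : ℝ} (ha : 0 ≤ a) (hb : 0 ≤ b) (hc : 0 ≤ c)
    (had : a < 1) (hd1 : d < 1) (hδ : 0 < (1 - a) * (1 - d) - b * c) :
    ∃ v₁ v₂ θ : ℝ, 0 < v₁ ∧ 0 < v₂ ∧ 0 ≤ θ ∧ θ < 1 ∧
      a * v₁ + b * v₂ ≤ θ * v₁ ∧ c * v₁ + d * v₂ ≤ θ * v₂ := by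
  set δ := (1 - a) * (1 - d) - b * c with hδ'
  have h1 : 0 < 1 - d + b := by linarith
  have h2 : 0 < 1 - a + c := by linarith
  have e1 : a * (1 - d + b) + b * (1 - a + c) = (1 - d + b) - δ := by rw [hδ']; ring
  have e2 : c * (1 - d + b) + d * (1 - a + c) = (1 - a + c) - δ := by rw [hδ']; ring
  have hn1 : 0 ≤ a * (1 - d + b) + b * (1 - a + c) := by positivity
  -- The vector v is the adjugate of I - M applied to (1, 1), so M v = v - δ (1, 1), and θ is the
  -- larger of 1 - δ/v₁ and 1 - δ/v₂.
  refine ⟨1 - d + b, 1 - a + c, max (1 - δ / (1 - d + b)) (1 - δ / (1 - a + c)), h1, h2, ?_, ?_,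
    ?_, ?_⟩
  · refine le_max_of_le_left ?_
    rw [sub_nonneg, div_le_one h1]
    linarith
  · have := div_pos hδ h1
    have := div_pos hδ h2
    exact max_lt (by linarith) (by linarith)
  · rw [e1]
    refine le_trans (le_of_eq ?_) (mul_le_mul_of_nonneg_right (le_max_left _ _) h1.le)
    field_simp
  · rw [e2]
    refine le_trans (le_of_eq ?_) (mul_le_mul_of_nonneg_right (le_max_right _ _) h2.le)
    field_simp

/-- A map of a closed set into itself that contracts componentwise has a unique fixed point. -/
theorem exists_unique_fixedPoint {E₁ E₂ : Type*} [NormedAddCommGroup E₁] [NormedAddCommGroup E₂]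
    [CompleteSpace E₁] [CompleteSpace E₂] {T : E₁ × E₂ → E₁ × E₂}
    {B : Set (E₁ × E₂)} (hB : IsClosed B) {x₀ : E₁ × E₂} (hx₀ : x₀ ∈ B) (hT : ∀ x ∈ B, T x ∈ B)
    (hcont : ∀ x ∈ B, ContinuousAt T x) {a b c d : ℝ} (ha : 0 ≤ a) (hb : 0 ≤ b) (hc : 0 ≤ c)
    (hd : 0 ≤ d) (htr : a + d < 2) (hdet : a + d - (a * d - b * c) - 1 < 0)
    (h₁ : ∀ x ∈ B, ∀ y ∈ B, ‖(T y - T x).1‖ ≤ a * ‖(y - x).1‖ + b * ‖(y - x).2‖)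
    (h₂ : ∀ x ∈ B, ∀ y ∈ B, ‖(T y - T x).2‖ ≤ c * ‖(y - x).1‖ + d * ‖(y - x).2‖) :
    ∃ x ∈ B, T x = x ∧ ∀ y ∈ B, T y = y → y = x := by
  have hδ : 0 < (1 - a) * (1 - d) - b * c := by linarith
  have hbc : 0 ≤ b * c := mul_nonneg hb hc
  -- Since (1 - a)(1 - d) > bc ≥ 0, the numbers a and d lie on the same side of 1; both above would
  -- contradict a + d < 2.
  have ha1 : a < 1 := by
    by_contra h
    have h' : 0 < (a - 1) * (d - 1) := by linarith
    have : 0 < d - 1 := pos_of_mul_pos_right h' (by linarith)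
    linarith
  have hd1 : d < 1 := by
    by_contra h
    nlinarith
  obtain ⟨v₁, v₂, θ, hv₁, hv₂, hθ0, hθ1, e₁, e₂⟩ :=
    exists_contracted_vector ha hb hc ha1 hd1 hδ
  set x : ℕ → E₁ × E₂ := fun n => T^[n] x₀ with hx
  have hstep : ∀ n, x (n + 1) = T (x n) := fun n => Function.iterate_succ_apply' T n x₀
  have hxB : ∀ n, x n ∈ B := fun n => by
    induction n with
    | zero => exact hx₀
    | succ n ih => rw [hstep]; exact hT _ ih
  -- C measures the first step in the norm max(‖·‖/v₁, ‖·‖/v₂), for which T contracts by θ.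
  obtain ⟨C, hC0, hC₁, hC₂⟩ : ∃ C : ℝ, 0 ≤ C ∧ ‖(x 1 - x 0).1‖ ≤ C * v₁ ∧
      ‖(x 1 - x 0).2‖ ≤ C * v₂ := by
    refine ⟨max (‖(x 1 - x 0).1‖ / v₁) (‖(x 1 - x 0).2‖ / v₂),
      le_max_of_le_left (by positivity), ?_, ?_⟩
    · rw [← div_le_iff₀ hv₁]; exact le_max_left _ _
    · rw [← div_le_iff₀ hv₂]; exact le_max_right _ _
  have hdec : ∀ n, ‖(x (n + 1) - x n).1‖ ≤ C * θ ^ n * v₁ ∧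
      ‖(x (n + 1) - x n).2‖ ≤ C * θ ^ n * v₂ := fun n => by
    induction n with
    | zero => simpa using ⟨hC₁, hC₂⟩
    | succ n ih =>
      have hp : 0 ≤ C * θ ^ n := by positivity
      rw [show x (n + 1 + 1) - x (n + 1) = T (x (n + 1)) - T (x n) from
        congrArg₂ (· - ·) (hstep (n + 1)) (hstep n), pow_succ]
      constructor
      · refine (h₁ _ (hxB n) _ (hxB (n + 1))).trans ?_
        calc _ ≤ a * (C * θ ^ n * v₁) + b * (C * θ ^ n * v₂) := by
              gcongr
              exacts [ih.1, ih.2]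
          _ = C * θ ^ n * (a * v₁ + b * v₂) := by ring
          _ ≤ C * θ ^ n * (θ * v₁) := by gcongr
          _ = _ := by ring
      · refine (h₂ _ (hxB n) _ (hxB (n + 1))).trans ?_
        calc _ ≤ c * (C * θ ^ n * v₁) + d * (C * θ ^ n * v₂) := by
              gcongr
              exacts [ih.1, ih.2]
          _ = C * θ ^ n * (c * v₁ + d * v₂) := by ring
          _ ≤ C * θ ^ n * (θ * v₂) := by gcongr
          _ = _ := by ring
  have hcauchy : CauchySeq x := by
    refine cauchySeq_of_le_geometric θ (C * max v₁ v₂) hθ1 fun n => ?_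
    rw [dist_comm, dist_eq_norm]
    have hp : 0 ≤ C * θ ^ n := by positivity
    refine max_le ((hdec n).1.trans ?_) ((hdec n).2.trans ?_)
    · calc C * θ ^ n * v₁ ≤ C * θ ^ n * max v₁ v₂ := by gcongr; exact le_max_left _ _
        _ = _ := by ring
    · calc C * θ ^ n * v₂ ≤ C * θ ^ n * max v₁ v₂ := by gcongr; exact le_max_right _ _
        _ = _ := by ring
  obtain ⟨z, hz⟩ := cauchySeq_tendsto_of_complete hcauchy
  have hzB : z ∈ B := hB.mem_of_tendsto hz (Filter.Eventually.of_forall hxB)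
  have hTz : T z = z := by
    have h1 : Filter.Tendsto (fun n => x (n + 1)) Filter.atTop (nhds (T z)) := by
      simp only [hstep]
      exact (hcont z hzB).tendsto.comp hz
    exact tendsto_nhds_unique h1 (hz.comp (Filter.tendsto_add_atTop_nat 1))
  refine ⟨z, hzB, hTz, fun y hy hTy => ?_⟩
  have k₁ := h₁ z hzB y hy
  have k₂ := h₂ z hzB y hy
  rw [hTy, hTz] at k₁ k₂
  have n₁ := norm_nonneg (y - z).1
  have n₂ := norm_nonneg (y - z).2
  have z₁ : ‖(y - z).1‖ ≤ 0 := by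
    by_contra h
    -- Eliminating the second component between the two inequalities leaves δ ‖(y - z).1‖ ≤ 0.
    have h3 : (1 - d) * ((1 - a) * ‖(y - z).1‖) ≤ (1 - d) * (b * ‖(y - z).2‖) :=
      mul_le_mul_of_nonneg_left (by linarith) (by linarith)
    have h4 : b * ((1 - d) * ‖(y - z).2‖) ≤ b * (c * ‖(y - z).1‖) :=
      mul_le_mul_of_nonneg_left (by linarith) hb
    have h5 := mul_pos hδ (not_le.1 h)
    linarith
  have z₂ : ‖(y - z).2‖ ≤ 0 := by
    have h6 : ‖(y - z).1‖ = 0 := le_antisymm z₁ n₁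
    rw [h6] at k₂
    by_contra h
    nlinarith [not_le.1 h]
  rw [norm_le_zero_iff] at z₁ z₂
  exact sub_eq_zero.1 (Prod.ext z₁ z₂)

theorem norm_segment_sub_le {r s : ℝ} (hs : s ∈ Icc (0 : ℝ) 1) {u v w : F} (hu : ‖u - w‖ ≤ r)
    (hv : ‖v - w‖ ≤ r) : ‖u + (s : ℂ) • (v - u) - w‖ ≤ r := by
  have e : u + (s : ℂ) • (v - u) - w = ((1 - s : ℝ) : ℂ) • (u - w) + (s : ℂ) • (v - w) := by
    push_cast; module
  rw [e]
  refine (norm_add_le _ _).trans ?_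
  rw [norm_smul, norm_smul, Complex.norm_real, Complex.norm_real, Real.norm_of_nonneg hs.1,
    Real.norm_of_nonneg (sub_nonneg.2 hs.2)]
  have := mul_le_mul_of_nonneg_left hu (sub_nonneg.2 hs.2)
  have := mul_le_mul_of_nonneg_left hv hs.1
  linarith

/-- Existence and uniqueness of a fixed point from bounds on the residual and on the partial
derivatives (radii polynomials). -/
theorem exists_unique_fixedPoint_of_bounds [CompleteSpace E₁] [CompleteSpace E₂]
    {T : E₁ × E₂ → E₁ × E₂} {V : Set (E₁ × E₂)} (hV : IsClosed V)
    (hconv : ∀ x ∈ V, ∀ y ∈ V, ∀ s ∈ Icc (0 : ℝ) 1, x + (s : ℂ) • (y - x) ∈ V)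
    {x₀ : E₁ × E₂} (hx₀ : x₀ ∈ V) {rh : Fin 2 → ℝ} (hrh : ∀ i, 0 < rh i)
    (hT : ∀ x ∈ V, ‖x.1 - x₀.1‖ ≤ rh 0 → DifferentiableAt ℂ T x ∧ T x ∈ V)
    {Y : Fin 2 → ℝ} {Z : Fin 2 → Fin 2 → ℝ} {W : Fin 2 → Fin 2 → Fin 2 → ℝ}
    (hZ : ∀ i i', 0 ≤ Z i i') (hW : ∀ i i' i'', 0 ≤ W i i' i'')
    (hY₀ : ‖(T x₀ - x₀).1‖ ≤ Y 0) (hY₁ : ‖(T x₀ - x₀).2‖ ≤ Y 1)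
    (h₀₀ : ∀ s ∈ Icc (0 : ℝ) 1, ∀ x ∈ V, ‖x.1 - x₀.1‖ ≤ s * rh 0 → ‖x.2 - x₀.2‖ ≤ s * rh 1 →
      ‖fderiv ℂ (fun z => (T (z, x.2)).1) x.1‖ ≤ Z 0 0 + s * Wlin W rh 0 0)
    (h₀₁ : ∀ s ∈ Icc (0 : ℝ) 1, ∀ x ∈ V, ‖x.1 - x₀.1‖ ≤ s * rh 0 → ‖x.2 - x₀.2‖ ≤ s * rh 1 →
      ‖fderiv ℂ (fun z => (T (x.1, z)).1) x.2‖ ≤ Z 0 1 + s * Wlin W rh 0 1)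
    (h₁₀ : ∀ s ∈ Icc (0 : ℝ) 1, ∀ x ∈ V, ‖x.1 - x₀.1‖ ≤ s * rh 0 → ‖x.2 - x₀.2‖ ≤ s * rh 1 →
      ‖fderiv ℂ (fun z => (T (z, x.2)).2) x.1‖ ≤ Z 1 0 + s * Wlin W rh 1 0)
    (h₁₁ : ∀ s ∈ Icc (0 : ℝ) 1, ∀ x ∈ V, ‖x.1 - x₀.1‖ ≤ s * rh 0 → ‖x.2 - x₀.2‖ ≤ s * rh 1 →
      ‖fderiv ℂ (fun z => (T (x.1, z)).2) x.2‖ ≤ Z 1 1 + s * Wlin W rh 1 1)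
    (hp₁ : p₁ Y Z W rh < 0) (hp₂ : p₂ Y Z W rh < 0)
    (hp₃ : p₃ Z W rh < 0) (hp₄ : p₄ Z W rh < 0) :
    ∃ x, (x ∈ V ∧ ‖x.1 - x₀.1‖ ≤ rh 0 ∧ ‖x.2 - x₀.2‖ ≤ rh 1) ∧ T x = x ∧
      ∀ y ∈ V, ‖y.1 - x₀.1‖ ≤ rh 0 → ‖y.2 - x₀.2‖ ≤ rh 1 → T y = y → y = x := by
  set B : Set (E₁ × E₂) := {x | x ∈ V ∧ ‖x.1 - x₀.1‖ ≤ rh 0 ∧ ‖x.2 - x₀.2‖ ≤ rh 1} with hBdef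
  have hBclosed : IsClosed B :=
    hV.inter ((isClosed_le (continuous_fst.sub continuous_const).norm continuous_const).inter
      (isClosed_le (continuous_snd.sub continuous_const).norm continuous_const))
  have hsegB : ∀ x ∈ B, ∀ y ∈ B, ∀ s ∈ Icc (0 : ℝ) 1, x + (s : ℂ) • (y - x) ∈ B :=
    fun x hx y hy s hs => ⟨hconv x hx.1 y hy.1 s hs, norm_segment_sub_le hs hx.2.1 hy.2.1,
      norm_segment_sub_le hs hx.2.2 hy.2.2⟩
  have hx₀B : x₀ ∈ B := ⟨hx₀, by simp [(hrh 0).le], by simp [(hrh 1).le]⟩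
  have hdiff : ∀ x ∈ B, DifferentiableAt ℂ T x := fun x hx => (hT x hx.1 hx.2.1).1
  have hone : (1 : ℝ) ∈ Icc (0 : ℝ) 1 := ⟨zero_le_one, le_rfl⟩
  have hWl : ∀ i i', 0 ≤ Wlin W rh i i' := fun i i' =>
    add_nonneg (mul_nonneg (hW _ _ _) (hrh 0).le) (mul_nonneg (hW _ _ _) (hrh 1).le)
  have hself : ∀ x ∈ B, T x ∈ B := by
    intro x hx
    -- At parameter s the segment from the centre is still in the ball of radii s · rh, so the
    -- derivative bound there is Z + s W; hence ½ W in p₁ and p₂.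
    have hp : ∀ s ∈ Icc (0 : ℝ) 1, x₀ + (s : ℂ) • (x - x₀) ∈ V ∧
        ‖(x₀ + (s : ℂ) • (x - x₀)).1 - x₀.1‖ ≤ s * rh 0 ∧
        ‖(x₀ + (s : ℂ) • (x - x₀)).2 - x₀.2‖ ≤ s * rh 1 := fun s hs => by
      refine ⟨hconv _ hx₀ _ hx.1 s hs, ?_, ?_⟩
      · rw [Prod.fst_add, add_sub_cancel_left, Prod.smul_fst, norm_smul, Complex.norm_real,
          Real.norm_of_nonneg hs.1]
        exact mul_le_mul_of_nonneg_left hx.2.1 hs.1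
      · rw [Prod.snd_add, add_sub_cancel_left, Prod.smul_snd, norm_smul, Complex.norm_real,
          Real.norm_of_nonneg hs.1]
        exact mul_le_mul_of_nonneg_left hx.2.2 hs.1
    have g₁ := norm_sub_le_of_partial_bounds (g := fun x => (T x).1) (x := x₀) (y := x)
      (fun s hs => (hdiff _ (hsegB _ hx₀B _ hx s hs)).fst)
      (fun s hs => h₀₀ s hs _ (hp s hs).1 (hp s hs).2.1 (hp s hs).2.2)
      (fun s hs => h₀₁ s hs _ (hp s hs).1 (hp s hs).2.1 (hp s hs).2.2) hx.2.1 hx.2.2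
    have g₂ := norm_sub_le_of_partial_bounds (g := fun x => (T x).2) (x := x₀) (y := x)
      (fun s hs => (hdiff _ (hsegB _ hx₀B _ hx s hs)).snd)
      (fun s hs => h₁₀ s hs _ (hp s hs).1 (hp s hs).2.1 (hp s hs).2.2)
      (fun s hs => h₁₁ s hs _ (hp s hs).1 (hp s hs).2.1 (hp s hs).2.2) hx.2.1 hx.2.2
    rw [Prod.fst_sub] at hY₀
    rw [Prod.snd_sub] at hY₁
    refine ⟨(hT x hx.1 hx.2.1).2, ?_, ?_⟩
    · have := norm_sub_le_norm_sub_add_norm_sub (T x).1 (T x₀).1 x₀.1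
      unfold p₁ at hp₁
      linarith
    · have := norm_sub_le_norm_sub_add_norm_sub (T x).2 (T x₀).2 x₀.2
      unfold p₂ at hp₂
      linarith
  have hM : ∀ i i', 0 ≤ Z i i' + Wlin W rh i i' := fun i i' => add_nonneg (hZ _ _) (hWl _ _)
  simp only [p₃, p₄, contrM, Matrix.trace_fin_two, Matrix.det_fin_two, Matrix.of_apply] at hp₃ hp₄
  -- Between two arbitrary points of the ball only the bound at full radius is available: s = 1 and
  -- no growth along the segment, which gives the matrix Z + W.
  obtain ⟨x, hx, hTx, huniq⟩ := exists_unique_fixedPoint hBclosed hx₀B hself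
    (fun x hx => (hdiff x hx).continuousAt) (hM 0 0) (hM 0 1) (hM 1 0) (hM 1 1)
    (by linarith) hp₄
    (fun x hx y hy => by
      have := norm_sub_le_of_partial_bounds (g := fun x => (T x).1) (x := x) (y := y)
        (a₁ := Z 0 0 + Wlin W rh 0 0) (a₂ := Z 0 1 + Wlin W rh 0 1) (b₁ := 0) (b₂ := 0)
        (fun s hs => (hdiff _ (hsegB _ hx _ hy s hs)).fst)
        (fun s hs => by
          have h := hsegB _ hx _ hy s hs
          simpa using h₀₀ 1 hone _ h.1 (by simpa using h.2.1) (by simpa using h.2.2))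
        (fun s hs => by
          have h := hsegB _ hx _ hy s hs
          simpa using h₀₁ 1 hone _ h.1 (by simpa using h.2.1) (by simpa using h.2.2))
        le_rfl le_rfl
      simpa using this)
    (fun x hx y hy => by
      have := norm_sub_le_of_partial_bounds (g := fun x => (T x).2) (x := x) (y := y)
        (a₁ := Z 1 0 + Wlin W rh 1 0) (a₂ := Z 1 1 + Wlin W rh 1 1) (b₁ := 0) (b₂ := 0)
        (fun s hs => (hdiff _ (hsegB _ hx _ hy s hs)).snd)
        (fun s hs => by
          have h := hsegB _ hx _ hy s hs
          simpa using h₁₀ 1 hone _ h.1 (by simpa using h.2.1) (by simpa using h.2.2))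
        (fun s hs => by
          have h := hsegB _ hx _ hy s hs
          simpa using h₁₁ 1 hone _ h.1 (by simpa using h.2.1) (by simpa using h.2.2))
        le_rfl le_rfl
      simpa using this)
  exact ⟨x, hx, hTx, fun y h1 h2 h3 h4 => huniq y ⟨h1, h2, h3⟩ h4⟩

end Contraction

end OhtaKawasaki

namespace OhtaKawasaki

/-! ### Symmetry and zeros -/

theorem P_conj (γ y : ℝ) : starRingEnd ℂ (P γ (y : ℂ)) = P γ (y : ℂ) := by
  simp [P]

theorem P'_conj (γ y : ℝ) : starRingEnd ℂ (P' γ (y : ℂ)) = P' γ (y : ℂ) := by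
  simp [P']

theorem ref_f {t : Cell} (γ : ℝ) (κ : Fin t.J → ℝ) {c : Idx → ℂ} (hc : ref c = c) (k : Idx) :
    starRingEnd ℂ (f t γ (fun j => (κ j : ℂ)) c (-k)) = f t γ (fun j => (κ j : ℂ)) c k := by
  have h1 : ref (conv c (conv c c)) = conv c (conv c c) := by
    rw [← conv_ref, ← conv_ref, hc]
  have h2 := congrFun h1 k
  have h3 := congrFun hc k
  simp only [ref] at h2 h3
  rw [f, f, map_add, map_mul, h2, h3, t.DelC_neg, t.DelC_ofReal, P_conj]

theorem conj_h {t : Cell} (γ : ℝ) (κ : Fin t.J → ℝ) {c : Idx → ℂ} (hc : ref c = c)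
    (j : Fin t.J) : starRingEnd ℂ (h t γ (fun j => (κ j : ℂ)) c j)
      = h t γ (fun j => (κ j : ℂ)) c j := by
  have hc' : ∀ k, starRingEnd ℂ (c k) = c (-k) := fun k => by
    have := congrFun hc (-k)
    rwa [ref, neg_neg] at this
  rw [h, map_mul, Complex.conj_tsum]
  congr 1
  · rw [map_div₀, map_one, map_ofNat]
  · refine tsum_congr fun k => ?_
    rw [map_mul, map_mul, map_mul, hc', hc', neg_neg, t.DelC_ofReal, P'_conj, Complex.conj_ofReal]
    ring

theorem SpaceGroup.f_equivariant {t : Cell} {G : Type*} [Group G] {S : SpaceGroup t G} (γ : ℝ)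
    (κ : Fin t.J → ℂ) {c : Idx → ℂ} (hc : S.IsEquivariant c) : S.IsEquivariant (f t γ κ c) :=
  (hc.mul_invariant (χ := fun k => P γ (t.DelC k κ)) fun g k => by rw [S.DelC_act]).add
    (hc.conv (hc.conv hc))

namespace Setup

/-- The norm on ℂ^J is relative to κ̄: a distance below 1 means |κ_j - κ̄_j| < κ̄_j. This is the
role of r₁* < 1. -/
theorem re_pos_of_norm_sub_lt {t : Cell} {G : Type*} [Group G] (S : Setup t G)
    {κ : S.CJ} (hκ : ‖κ - S.toCJ fun j => (S.κbar j : ℂ)‖ < 1) :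
    S.RePos κ := by
  intro j
  have h1 := S.norm_coords_le (κ - S.toCJ fun j => (S.κbar j : ℂ)) j
  have h2 : ‖coords κ j - (S.κbar j : ℂ)‖ ≤ S.κbar j * _ := h1
  have h3 := mul_lt_mul_of_pos_left hκ (S.κbar_pos j)
  have h4 := Complex.abs_re_le_norm (coords κ j - (S.κbar j : ℂ))
  rw [Complex.sub_re, Complex.ofReal_re] at h4
  have h5 := (abs_le.1 h4).1
  linarith

variable {t : Cell} {G : Type*} [Group G] [Fintype G] (S : Setup t G)

variable {S} in
/-- The real length scales of a symmetric point. -/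
def reκ (x : S.CJ × S.X0) : Fin t.J → ℝ := fun j => (coords x.1 j).re

variable {S} in
theorem coords_eq_reκ {x : S.CJ × S.X0} (hx : x ∈ S.symm) :
    coords x.1 = fun j => ((reκ x j : ℝ) : ℂ) :=
  funext fun j => (Complex.conj_eq_iff_re.1 (hx.1 j)).symm

theorem conj_F_fst {x : S.CJ × S.X0} (hx : x ∈ S.symm) (j : Fin t.J) :
    starRingEnd ℂ ((S.F x).1 j) = (S.F x).1 j := by
  change starRingEnd ℂ (h t S.γ (coords x.1) (S.coeff (seq x.2)) j) = _
  rw [coords_eq_reκ hx, conj_h _ _ (S.ref_coeff hx.2)]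
  change _ = h t S.γ (coords x.1) (S.coeff (seq x.2)) j
  rw [coords_eq_reκ hx]

theorem conjSeq_F_snd {x : S.CJ × S.X0} (hx : x ∈ S.symm) :
    S.conjSeq (S.F x).2 = (S.F x).2 := by
  -- The entry at 0 is no component of 𝓕. Replacing it by 0 gives an equivariant sequence on all of
  -- ℤ³, to which the criterion for conjugation symmetry applies.
  set d : Idx → ℂ := fun k => (if k = 0 then 0 else (S.orbCard k : ℂ))
    * f t S.γ (coords x.1) (S.coeff (seq x.2)) k with hd
  have e : (S.F x).2 = fun k : S.Z0 => d k := funext fun k => by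
    simp only [hd, if_neg k.2.2]
    rfl
  rw [e]
  refine S.conjSeq_of_ref ?_ (by simp [hd]) ?_
  · refine (SpaceGroup.f_equivariant _ _ (S.coeff_equivariant _)).mul_invariant fun g k => ?_
    simp only [S.act_eq_zero, S.orbCard_act]
  · ext k
    simp only [ref, hd, map_mul, neg_eq_zero, S.orbCard_neg]
    rw [coords_eq_reκ hx, ref_f _ _ (S.ref_coeff hx.2)]
    split_ifs <;> simp

open Classical in
theorem incl_snd_eq (y : (Fin t.J → ℂ) × (S.Z0 → ℂ)) : (S.incl (S.proj y)).2
    = fun k : S.Z0 => ((if S.knorm k ≤ S.K then 1 else 0 : ℝ) : ℂ) * y.2 k := by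
  ext k
  by_cases hk : k ∈ S.ZK
  · simp [incl, proj, hk, show S.knorm k ≤ S.K from hk]
  · simp [incl, hk, show ¬ S.knorm k ≤ S.K from hk]

theorem proj_incl (y : S.Fin0) : S.proj (S.incl y) = y := by
  refine Prod.ext rfl (funext fun k => ?_)
  simp [incl, proj]

open Classical in
theorem conjSeq_cut (b : S.Z0 → ℂ) :
    S.conjSeq (fun k : S.Z0 => ((if S.knorm k ≤ S.K then 1 else 0 : ℝ) : ℂ) * b k)
      = fun k : S.Z0 => ((if S.knorm k ≤ S.K then 1 else 0 : ℝ) : ℂ) * S.conjSeq b k :=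
  S.conjSeq_mul (fun k => if S.knorm k ≤ S.K then 1 else 0)
    (fun g k => by simp only [knorm_act]) (fun k => by simp only [knorm_neg]) b

theorem conjFin_proj {y : (Fin t.J → ℂ) × (S.Z0 → ℂ)} (h1 : ∀ j, starRingEnd ℂ (y.1 j) = y.1 j)
    (h2 : S.conjSeq y.2 = y.2) : S.conjFin (S.proj y) = S.proj y := by
  rw [conjFin, incl_snd_eq, conjSeq_cut, h2, ← incl_snd_eq]
  refine Eq.trans ?_ (S.proj_incl (S.proj y))
  congr 1
  exact Prod.ext (funext fun j => h1 j) rfl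

theorem conjSeq_incl {z : S.Fin0} (hz : S.conjFin z = z) :
    S.conjSeq (S.incl z).2 = (S.incl z).2 := by
  have e := S.incl_snd_eq (S.incl z)
  rw [proj_incl] at e
  have h1 := S.conjSeq_cut (S.incl z).2
  rw [← e] at h1
  ext k
  by_cases hk : k ∈ S.ZK
  · have := congrFun (congrArg Prod.snd hz) ⟨k, hk⟩
    simp only [incl, dif_pos hk]
    exact this
  · rw [h1]
    simp [incl, hk, show ¬ S.knorm k ≤ S.K from hk]

theorem conjSeq_Λinv (b : S.Z0 → ℂ) : S.conjSeq (S.Λinv b) = S.Λinv (S.conjSeq b) := by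
  have e : ∀ b, S.Λinv b = fun k : S.Z0 => ((S.lam k / S.orbCard k : ℝ) : ℂ) * b k := fun b => by
    ext k
    rw [Λinv_eq]
    push_cast
    rfl
  rw [e, e, S.conjSeq_mul (fun k => S.lam k / S.orbCard k)]
  · intro g k
    simp only [lam_act, S.orbCard_act]
  · intro k
    simp only [lam_neg, S.orbCard_neg]

/-- The fixed point operator preserves the conjugate symmetric elements. -/
theorem T_mem_symm {A : Module.End ℂ S.Fin0} (hA : ∀ y, A (S.conjFin y) = S.conjFin (A y))
    {x : S.CJ × S.X0} (hx : x ∈ S.symm) (hpos : S.RePos x.1) : S.T A x ∈ S.symm := by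
  have hF := S.conjFin_proj (S.conj_F_fst hx) (S.conjSeq_F_snd hx)
  have hz : S.conjFin (A (S.proj (S.F x))) = A (S.proj (S.F x)) := by rw [← hA, hF]
  constructor
  · intro j
    change starRingEnd ℂ (coords x.1 j - ((A (S.proj (S.F x))).1 j + 0))
      = coords x.1 j - ((A (S.proj (S.F x))).1 j + 0)
    rw [add_zero, map_sub, hx.1 j]
    have : starRingEnd ℂ ((A (S.proj (S.F x))).1 j) = (A (S.proj (S.F x))).1 j :=
      congrFun (congrArg Prod.fst hz) j
    rw [this]
  · have e : seq (S.T A x).2 = seq x.2 - (S.incl (A (S.proj (S.F x)))).2 - S.Λinv (S.F x).2 := by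
      rw [S.T_eq hpos, ← S.T_snd hpos, sub_sub]
      rfl
    rw [e, conjSeq_sub, conjSeq_sub, hx.2, S.conjSeq_incl hz, conjSeq_Λinv, S.conjSeq_F_snd hx]

theorem T_eq_self_of_F_eq_zero {A : Module.End ℂ S.Fin0} {x : S.CJ × S.X0} (hF : S.F x = 0) :
    S.T A x = x := by
  have hp : S.proj (0 : (Fin t.J → ℂ) × (S.Z0 → ℂ)) = 0 := rfl
  have hi : S.incl (0 : S.Fin0) = 0 := by
    refine Prod.ext rfl (funext fun k => ?_)
    simp [incl]
  have hl : S.Λinv 0 = 0 := funext fun k => by rw [Λinv_eq]; simp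
  have h0 : S.AA A (S.F x) = 0 := by
    rw [AA, hF, hp, map_zero, hi, Prod.snd_zero, hl, zero_add]
    rfl
  rw [T, h0]
  refine Prod.ext ?_ ?_
  · change x.1 - 0 = x.1
    rw [sub_zero]
  · change S.toX0 (seq x.2 - 0) = x.2
    rw [sub_zero, toX0_seq]

/-- A fixed point satisfies 𝒜𝓕 = 0. The image of A and that of `Λinv` are supported on complementary
indices, so each vanishes; then use injectivity of A on the head and λ_k ≠ 0 on the tail. -/
theorem F_eq_zero_of_T_eq_self {A : Module.End ℂ S.Fin0} (hA : IsUnit A) {x : S.CJ × S.X0}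
    (hpos : S.RePos x.1) (hT : S.T A x = x) : S.F x = 0 := by
  have hA' : Function.Injective A := ((Module.End.isUnit_iff A).1 hA).1
  have h1 : (A (S.proj (S.F x))).1 = 0 := by
    have h := congrArg Prod.fst hT
    change x.1 - S.toCJ ((A (S.proj (S.F x))).1 + 0) = x.1 at h
    rw [add_zero, sub_eq_self] at h
    exact h
  have h2 : ∀ k, (S.incl (A (S.proj (S.F x)))).2 k + S.Λinv (S.F x).2 k = 0 := fun k => by
    have h := S.T_snd hpos A
    have h' := congrArg Prod.snd hT
    rw [S.T_eq hpos] at h'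
    change x.2 - S.inclX (A (S.headF x)) - S.tail x = x.2 at h'
    rw [h', sub_eq_self] at h
    exact congrFun h k
  have hz : A (S.proj (S.F x)) = 0 := by
    refine Prod.ext h1 (funext fun k => ?_)
    have := h2 k
    rw [Λinv_eq, S.lam_of_mem k.2] at this
    simpa [incl] using this
  have hp : S.proj (S.F x) = 0 := hA' (by rw [hz, map_zero])
  refine Prod.ext (congrArg (fun z : S.Fin0 => z.1) hp) (funext fun k => ?_)
  by_cases hk : k ∈ S.ZK
  · exact congrFun (congrArg Prod.snd hp) ⟨k, hk⟩
  · have := h2 k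
    rw [Λinv_eq] at this
    simp only [incl, dif_neg hk, zero_add] at this
    have hn : (S.lam k : ℂ) / (S.orbCard k : ℂ) ≠ 0 :=
      div_ne_zero (Complex.ofReal_ne_zero.2 (S.lam_ne_zero hk))
        (Nat.cast_ne_zero.2 (S.orbCard_pos k).ne')
    exact (mul_eq_zero.1 this).resolve_left hn

/-- Symmetry is expressed through continuous linear functionals, from which closedness and stability
under real segments follow. -/
theorem mem_symm_iff (x : S.CJ × S.X0) : x ∈ S.symm ↔
    (∀ j, starRingEnd ℂ (S.coordL j x.1) = S.coordL j x.1) ∧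
    ∀ k : S.Z0, starRingEnd ℂ (WL.eval (-(k : Idx)) (S.σ₀L x.2))
      = WL.eval (k : Idx) (S.σ₀L x.2) := by
  refine and_congr Iff.rfl ?_
  rw [funext_iff]
  refine forall_congr' fun k => ?_
  rw [conjSeq_eq, ← S.σ₀_apply (seq x.2) k]
  rfl

theorem isClosed_symm : IsClosed S.symm := by
  have : S.symm = (⋂ j, {x | starRingEnd ℂ (S.coordL j x.1) = S.coordL j x.1}) ∩
      ⋂ k : S.Z0, {x | starRingEnd ℂ (WL.eval (-(k : Idx)) (S.σ₀L x.2))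
        = WL.eval (k : Idx) (S.σ₀L x.2)} := by
    ext x
    rw [mem_symm_iff]
    simp
  rw [this]
  refine (isClosed_iInter fun j => ?_).inter (isClosed_iInter fun k => ?_)
  · have h : Continuous fun x : S.CJ × S.X0 => S.coordL j x.1 :=
      (S.coordL j).continuous.comp continuous_fst
    exact isClosed_eq (Complex.continuous_conj.comp h) h
  · have h : ∀ k, Continuous fun x : S.CJ × S.X0 => WL.eval k (S.σ₀L x.2) := fun k =>
      (WL.eval k).continuous.comp (S.σ₀L.continuous.comp continuous_snd)
    exact isClosed_eq (Complex.continuous_conj.comp (h _)) (h _)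

theorem symm_segment {x y : S.CJ × S.X0} (hx : x ∈ S.symm) (hy : y ∈ S.symm) (s : ℝ) :
    x + (s : ℂ) • (y - x) ∈ S.symm := by
  rw [mem_symm_iff] at hx hy ⊢
  constructor
  · intro j
    simp only [Prod.fst_add, Prod.smul_fst, Prod.fst_sub, map_add, map_smul, map_sub, smul_eq_mul,
      map_mul, Complex.conj_ofReal, hx.1, hy.1]
  · intro k
    simp only [Prod.snd_add, Prod.smul_snd, Prod.snd_sub, map_add, map_smul, map_sub, smul_eq_mul,
      map_mul, Complex.conj_ofReal, hx.2, hy.2]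

theorem F_snd_apply (x : S.CJ × S.X0) (k : S.Z0) : (S.F x).2 k
    = (S.orbCard k : ℂ) * f t S.γ (coords x.1) (S.coeff (seq x.2)) k := rfl

/-- At a zero of `𝓕`, all the equations `f_k = 0` with `k ≠ 0` hold. -/
theorem f_eq_zero_of_F_eq_zero {x : S.CJ × S.X0} (hF : S.F x = 0) {k : Idx} (hk : k ≠ 0) :
    f t S.γ (coords x.1) (S.coeff (seq x.2)) k = 0 := by
  have he : S.IsEquivariant (f t S.γ (coords x.1) (S.coeff (seq x.2))) :=
    SpaceGroup.f_equivariant _ _ (S.coeff_equivariant _)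
  obtain ⟨k₀, hd, g, rfl⟩ := S.exists_rep k
  rw [he.apply]
  by_cases hz : k₀ ∈ S.Zsym
  · have h := congrFun (congrArg Prod.snd hF) ⟨k₀, ⟨hz, hd⟩, fun h => hk (S.act_eq_zero.2 h)⟩
    rw [F_snd_apply] at h
    have hn : (S.orbCard k₀ : ℂ) ≠ 0 := Nat.cast_ne_zero.2 (S.orbCard_pos k₀).ne'
    rw [(mul_eq_zero.1 h).resolve_left hn, zero_mul]
  · rw [he.eq_zero hz, zero_mul]

theorem exists_unique_zero (bbar : S.X0) (hsymm : S.xbar bbar ∈ S.symm)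
    (A : Module.End ℂ S.Fin0) (hA : IsUnit A) (hAconj : ∀ y, A (S.conjFin y) = S.conjFin (A y))
    (rs : Fin 2 → ℝ) (hrs1 : rs 0 < 1)
    (Y : Fin 2 → ℝ) (Z : Fin 2 → Fin 2 → ℝ) (W : Fin 2 → Fin 2 → Fin 2 → ℝ)
    (hZ : ∀ i i', 0 ≤ Z i i') (hW : ∀ i i' i'', 0 ≤ W i i' i'')
    (hbounds : S.Bounds A bbar rs Y Z W)
    (rh : Fin 2 → ℝ) (hrh : ∀ i, 0 < rh i) (hrhs : ∀ i, rh i ≤ rs i)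
    (hp₁ : p₁ Y Z W rh < 0) (hp₂ : p₂ Y Z W rh < 0)
    (hp₃ : p₃ Z W rh < 0) (hp₄ : p₄ Z W rh < 0) :
    ∃ xh : S.CJ × S.X0, xh ∈ S.ball rh (S.xbar bbar) ∧ S.RePos xh.1 ∧ S.F xh = 0 ∧
        ∀ x ∈ S.ball rh (S.xbar bbar), S.F x = 0 → x = xh := by
  have hpos : ∀ x : S.CJ × S.X0, ‖x.1 - (S.xbar bbar).1‖ ≤ rh 0 → S.RePos x.1 := fun x hx =>
    S.re_pos_of_norm_sub_lt (hx.trans_lt ((hrhs 0).trans_lt hrs1))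
  -- The W bounds hold for all radii up to rs, so they may be used on every shrunken ball s · rh.
  have hr : ∀ s ∈ Set.Icc (0 : ℝ) 1, (0 : Fin 2 → ℝ) ≤ (fun i => s * rh i) ∧
      (fun i => s * rh i) ≤ rs := fun s hs =>
    ⟨fun i => mul_nonneg hs.1 (hrh i).le,
      fun i => (mul_le_of_le_one_left (hrh i).le hs.2).trans (hrhs i)⟩
  have hb : ∀ s x, x ∈ S.symm → ‖x.1 - (S.xbar bbar).1‖ ≤ s * rh 0 →
      ‖x.2 - (S.xbar bbar).2‖ ≤ s * rh 1 → x ∈ S.ball (fun i => s * rh i) (S.xbar bbar) :=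
    fun s x h1 h2 h3 => ⟨⟨h2, h3⟩, h1⟩
  have comb : ∀ {E E' : Type _} [NormedAddCommGroup E] [NormedSpace ℂ E] [NormedAddCommGroup E']
      [NormedSpace ℂ E'] {L L₀ : E →L[ℂ] E'} {z w₀ w₁ s : ℝ}, ‖L₀‖ ≤ z →
      ‖L - L₀‖ ≤ w₀ * (s * rh 0) + w₁ * (s * rh 1) →
      ‖L‖ ≤ z + s * (w₀ * rh 0 + w₁ * rh 1) := by
    intro E E' _ _ _ _ L L₀ z w₀ w₁ s h0 h1
    have := norm_le_norm_add_norm_sub' L L₀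
    linarith
  obtain ⟨x, ⟨hxs, hx1, hx2⟩, hTx, huniq⟩ := exists_unique_fixedPoint_of_bounds
    (T := S.T A) S.isClosed_symm (fun x hx y hy s _ => S.symm_segment hx hy s) hsymm hrh
    (fun x hx hx1 => ⟨S.differentiableAt_T (hpos x hx1) A, S.T_mem_symm hAconj hx (hpos x hx1)⟩)
    hZ hW hbounds.Y0 hbounds.Y1
    (fun s hs x hx h1 h2 => comb hbounds.Z00
      (hbounds.W00 _ (hr s hs).1 (hr s hs).2 x (hb s x hx h1 h2)))
    (fun s hs x hx h1 h2 => comb hbounds.Z01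
      (hbounds.W01 _ (hr s hs).1 (hr s hs).2 x (hb s x hx h1 h2)))
    (fun s hs x hx h1 h2 => comb hbounds.Z10
      (hbounds.W10 _ (hr s hs).1 (hr s hs).2 x (hb s x hx h1 h2)))
    (fun s hs x hx h1 h2 => comb hbounds.Z11
      (hbounds.W11 _ (hr s hs).1 (hr s hs).2 x (hb s x hx h1 h2)))
    hp₁ hp₂ hp₃ hp₄
  exact ⟨x, ⟨⟨hx1, hx2⟩, hxs⟩, hpos x hx1, S.F_eq_zero_of_T_eq_self hA (hpos x hx1) hTx,
    fun y hy hFy => huniq y hy.2 hy.1.1 hy.1.2 (S.T_eq_self_of_F_eq_zero hFy)⟩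

end Setup

end OhtaKawasaki

namespace OhtaKawasaki

/-! ### Sums of plane waves -/

/-- The plane wave with frequency `ξ`. -/
def planeWave (ξ x : E3) : ℂ := Complex.exp (Complex.I * (inner ℝ ξ x : ℝ))

theorem inner_basisFun (ξ : E3) (i : Fin 3) :
    inner ℝ ξ (EuclideanSpace.basisFun (Fin 3) ℝ i) = ξ i := by
  simp [EuclideanSpace.inner_single_right]

/-- A function of the form `x ↦ ∑ a_k exp(i ξ_k · x)`. -/
def waveSum {ι : Type*} (ξ : ι → E3) (a : ι → ℂ) (x : E3) : ℂ := ∑' k, a k * planeWave (ξ k) x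

/-- All the moments of the coefficients are finite. -/
def Rapid {ι : Type*} (ξ : ι → E3) (a : ι → ℂ) : Prop :=
  ∀ n : ℕ, Summable fun k => ‖ξ k‖ ^ n * ‖a k‖

theorem norm_planeWave (ξ x : E3) : ‖planeWave ξ x‖ = 1 := by
  rw [planeWave, mul_comm]
  exact Complex.norm_exp_ofReal_mul_I _

theorem planeWave_eq_comp (ξ : E3) :
    planeWave ξ = (fun s : ℝ => Complex.exp (Complex.I * (s : ℂ))) ∘ innerSL ℝ ξ := by
  ext x
  simp [planeWave]

theorem iteratedDeriv_exp_I (n : ℕ) : iteratedDeriv n (fun s : ℝ => Complex.exp (Complex.I * (s : ℂ)))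
    = fun s : ℝ => Complex.I ^ n * Complex.exp (Complex.I * (s : ℂ)) := by
  induction n with
  | zero => simp
  | succ n ih =>
    rw [iteratedDeriv_succ, ih]
    ext s
    have h : HasDerivAt (fun s : ℝ => (s : ℂ)) 1 s := Complex.ofRealCLM.hasDerivAt
    have := ((h.const_mul Complex.I).cexp.const_mul (Complex.I ^ n)).deriv
    rw [this]
    ring

theorem contDiff_exp_I {n : WithTop ℕ∞} :
    ContDiff ℝ n (fun s : ℝ => Complex.exp (Complex.I * (s : ℂ))) :=
  (contDiff_const.mul Complex.ofRealCLM.contDiff).cexp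

theorem contDiff_planeWave (ξ : E3) {n : WithTop ℕ∞} : ContDiff ℝ n (planeWave ξ) := by
  rw [planeWave_eq_comp]
  exact contDiff_exp_I.comp (innerSL ℝ ξ).contDiff

theorem iteratedFDeriv_planeWave (ξ x : E3) (n : ℕ) : iteratedFDeriv ℝ n (planeWave ξ) x
    = (iteratedFDeriv ℝ n (fun s : ℝ => Complex.exp (Complex.I * (s : ℂ)))
        (inner ℝ ξ x)).compContinuousLinearMap fun _ => innerSL ℝ ξ := by
  rw [planeWave_eq_comp]
  exact (innerSL ℝ ξ).iteratedFDeriv_comp_right contDiff_exp_I x le_rfl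

theorem norm_iteratedFDeriv_planeWave_le (ξ x : E3) (n : ℕ) :
    ‖iteratedFDeriv ℝ n (planeWave ξ) x‖ ≤ ‖ξ‖ ^ n := by
  rw [iteratedFDeriv_planeWave]
  refine (ContinuousMultilinearMap.norm_compContinuousLinearMap_le _ _).trans ?_
  rw [norm_iteratedFDeriv_eq_norm_iteratedDeriv, iteratedDeriv_exp_I, norm_mul, norm_pow,
    Complex.norm_I, one_pow, mul_comm Complex.I, Complex.norm_exp_ofReal_mul_I]
  simp

theorem laplacian_planeWave (ξ x : E3) :
    Laplacian.laplacian (planeWave ξ) x = -((‖ξ‖ ^ 2 : ℝ) : ℂ) * planeWave ξ x := by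
  have e := congrFun (InnerProductSpace.laplacian_eq_iteratedFDeriv_orthonormalBasis (planeWave ξ)
    (EuclideanSpace.basisFun (Fin 3) ℝ)) x
  rw [e]
  have h : ∀ i : Fin 3, iteratedFDeriv ℝ 2 (planeWave ξ) x
      ![EuclideanSpace.basisFun (Fin 3) ℝ i, EuclideanSpace.basisFun (Fin 3) ℝ i]
      = -((ξ i ^ 2 : ℝ) : ℂ) * planeWave ξ x := fun i => by
    rw [iteratedFDeriv_planeWave, ContinuousMultilinearMap.compContinuousLinearMap_apply,
      iteratedFDeriv_apply_eq_iteratedDeriv_mul_prod, iteratedDeriv_exp_I]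
    simp only [Fin.prod_univ_two, Matrix.cons_val_zero, Matrix.cons_val_one, innerSL_apply_apply,
      inner_basisFun, Complex.I_sq, planeWave, Complex.real_smul]
    push_cast
    ring
  simp only [h]
  rw [← Finset.sum_mul, EuclideanSpace.norm_sq_eq, Finset.sum_neg_distrib]
  simp only [Real.norm_eq_abs, sq_abs, Complex.ofReal_sum]

section Sums

variable {ι : Type*} {ξ : ι → E3} {a b : ι → ℂ}

theorem Rapid.summable (ha : Rapid ξ a) : Summable fun k => ‖a k‖ := by
  simpa using ha 0

theorem summable_mul_planeWave (ha : Summable fun k => ‖a k‖) (x : E3) :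
    Summable fun k => a k * planeWave (ξ k) x :=
  Summable.of_norm (by simpa [norm_planeWave] using ha)

theorem hasSum_waveSum (ha : Summable fun k => ‖a k‖) (x : E3) :
    HasSum (fun k => a k * planeWave (ξ k) x) (waveSum ξ a x) :=
  (summable_mul_planeWave ha x).hasSum

theorem waveSum_add (ha : Summable fun k => ‖a k‖) (hb : Summable fun k => ‖b k‖) (x : E3) :
    waveSum ξ (fun k => a k + b k) x = waveSum ξ a x + waveSum ξ b x := by
  simp only [waveSum, add_mul]
  exact (summable_mul_planeWave ha x).tsum_add (summable_mul_planeWave hb x)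

theorem waveSum_const_mul (c : ℂ) (x : E3) :
    waveSum ξ (fun k => c * a k) x = c * waveSum ξ a x := by
  simp only [waveSum, mul_assoc]
  exact tsum_mul_left

theorem waveSum_sub (ha : Summable fun k => ‖a k‖) (hb : Summable fun k => ‖b k‖) (x : E3) :
    waveSum ξ (fun k => a k - b k) x = waveSum ξ a x - waveSum ξ b x := by
  simp only [waveSum, sub_mul]
  exact (summable_mul_planeWave ha x).tsum_sub (summable_mul_planeWave hb x)

theorem contDiff_mul_planeWave (ξ : E3) (c : ℂ) {n : WithTop ℕ∞} :
    ContDiff ℝ n fun x => c * planeWave ξ x :=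
  contDiff_const.mul (contDiff_planeWave ξ)

theorem norm_iteratedFDeriv_mul_planeWave_le (ξ : E3) (c : ℂ) (x : E3) (n : ℕ) :
    ‖iteratedFDeriv ℝ n (fun x => c * planeWave ξ x) x‖ ≤ ‖ξ‖ ^ n * ‖c‖ := by
  have : (fun x => c * planeWave ξ x) = fun x => c • planeWave ξ x := rfl
  rw [this, iteratedFDeriv_const_smul_apply' (contDiff_planeWave ξ).contDiffAt, norm_smul, mul_comm]
  exact mul_le_mul_of_nonneg_right (norm_iteratedFDeriv_planeWave_le ξ x n) (norm_nonneg _)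

/-- The n-th derivative of a plane wave has norm at most ‖ξ‖^n, so the moments dominate the series
of derivatives uniformly in x. -/
theorem Rapid.contDiff (ha : Rapid ξ a) (n : ℕ) : ContDiff ℝ n (waveSum ξ a) :=
  contDiff_tsum (N := (n : ℕ∞)) (v := fun k i => ‖ξ i‖ ^ k * ‖a i‖)
    (fun i => contDiff_mul_planeWave (ξ i) (a i)) (fun k _ => ha k)
    fun k i x _ => norm_iteratedFDeriv_mul_planeWave_le (ξ i) (a i) x k

theorem Rapid.laplacian (ha : Rapid ξ a) (x : E3) : Laplacian.laplacian (waveSum ξ a) x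
    = waveSum ξ (fun k => -((‖ξ k‖ ^ 2 : ℝ) : ℂ) * a k) x := by
  have hf : ∀ i, ContDiff ℝ ((2 : ℕ∞) : WithTop ℕ∞) fun x => a i * planeWave (ξ i) x :=
    fun i => contDiff_mul_planeWave (ξ i) (a i)
  have h2 := iteratedFDeriv_tsum_apply (N := (2 : ℕ∞)) (v := fun k i => ‖ξ i‖ ^ k * ‖a i‖)
    hf (fun k _ => ha k)
    (fun k i x _ => norm_iteratedFDeriv_mul_planeWave_le (ξ i) (a i) x k) (k := 2) le_rfl x
  have hs : Summable fun i => iteratedFDeriv ℝ 2 (fun x => a i * planeWave (ξ i) x) x :=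
    Summable.of_norm_bounded (ha 2)
      fun i => norm_iteratedFDeriv_mul_planeWave_le (ξ i) (a i) x 2
  set v := EuclideanSpace.basisFun (Fin 3) ℝ
  have e := congrFun (InnerProductSpace.laplacian_eq_iteratedFDeriv_orthonormalBasis (waveSum ξ a)
    v) x
  rw [e]
  have h3 : ∀ i : Fin 3, HasSum
      (fun k => iteratedFDeriv ℝ 2 (fun x => a k * planeWave (ξ k) x) x ![v i, v i])
      (iteratedFDeriv ℝ 2 (waveSum ξ a) x ![v i, v i]) := fun i => by
    have := hs.hasSum
    rw [← h2] at this
    exact this.mapL (ContinuousMultilinearMap.apply ℝ (fun _ : Fin 2 => E3) ℂ ![v i, v i])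
  have h4 := hasSum_sum fun i (_ : i ∈ Finset.univ) => h3 i
  rw [← h4.tsum_eq, waveSum]
  refine tsum_congr fun k => ?_
  have e' := congrFun (InnerProductSpace.laplacian_eq_iteratedFDeriv_orthonormalBasis
    (fun x => a k * planeWave (ξ k) x) v) x
  rw [← e']
  have := InnerProductSpace.laplacian_smul (a k) ((contDiff_planeWave (ξ k)).contDiffAt (x := x))
  change Laplacian.laplacian (a k • planeWave (ξ k)) x = _
  rw [this, laplacian_planeWave, smul_eq_mul]
  ring

theorem Rapid.fderiv_apply (ha : Rapid ξ a) (x y : E3) : fderiv ℝ (waveSum ξ a) x y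
    = waveSum ξ (fun k => Complex.I * (inner ℝ (ξ k) y : ℝ) * a k) x := by
  have hd : ∀ k, HasFDerivAt (fun x => a k * planeWave (ξ k) x)
      (fderiv ℝ (fun x => a k * planeWave (ξ k) x) x) x := fun k =>
    ((contDiff_mul_planeWave (n := 1) (ξ k) (a k)).differentiable one_ne_zero x).hasFDerivAt
  have hb : ∀ k x, ‖fderiv ℝ (fun x => a k * planeWave (ξ k) x) x‖ ≤ ‖ξ k‖ ^ 1 * ‖a k‖ :=
    fun k x => by
      rw [← norm_iteratedFDeriv_one]
      exact norm_iteratedFDeriv_mul_planeWave_le (ξ k) (a k) x 1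
  have h1 := fderiv_tsum_apply (𝕜 := ℝ) (ha 1)
    (fun k => (contDiff_mul_planeWave (n := 1) (ξ k) (a k)).differentiable one_ne_zero) hb
    (summable_mul_planeWave ha.summable 0) x
  have hs : Summable fun k => fderiv ℝ (fun x => a k * planeWave (ξ k) x) x :=
    Summable.of_norm_bounded (ha 1) fun k => hb k x
  have h2 := hs.hasSum.mapL (ContinuousLinearMap.apply ℝ ℂ y)
  rw [← h1] at h2
  refine h2.tsum_eq.symm.trans (tsum_congr fun k => ?_)
  have h : HasFDerivAt (fun x => a k * planeWave (ξ k) x)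
      (a k • (planeWave (ξ k) x • (Complex.I • Complex.ofRealCLM.comp (innerSL ℝ (ξ k))))) x := by
    have h0 : HasFDerivAt (fun x => ((inner ℝ (ξ k) x : ℝ) : ℂ))
        (Complex.ofRealCLM.comp (innerSL ℝ (ξ k))) x :=
      Complex.ofRealCLM.hasFDerivAt.comp x (innerSL ℝ (ξ k)).hasFDerivAt
    exact ((h0.const_mul Complex.I).cexp).const_mul (a k)
  change fderiv ℝ (fun x => a k * planeWave (ξ k) x) x y = _
  rw [h.fderiv]
  simp
  ring

theorem Rapid.norm_sq_mul (ha : Rapid ξ a) (c : ℂ) :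
    Rapid ξ fun k => c * ((‖ξ k‖ ^ 2 : ℝ) : ℂ) * a k := fun n => by
  refine ((ha (n + 2)).mul_left ‖c‖).congr fun k => ?_
  rw [norm_mul, norm_mul, Complex.norm_real, Real.norm_of_nonneg (by positivity)]
  ring

theorem Rapid.summable_deriv (ha : Rapid ξ a) (y : E3) :
    Summable fun k => ‖Complex.I * (inner ℝ (ξ k) y : ℝ) * a k‖ := by
  refine Summable.of_nonneg_of_le (fun k => norm_nonneg _) (fun k => ?_) ((ha 1).mul_left ‖y‖)
  rw [norm_mul, norm_mul, Complex.norm_I, one_mul, Complex.norm_real, ← mul_assoc, pow_one]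
  exact mul_le_mul_of_nonneg_right (by rw [mul_comm]; exact norm_inner_le_norm _ _) (norm_nonneg _)

theorem Rapid.add (ha : Rapid ξ a) (hb : Rapid ξ b) : Rapid ξ fun k => a k + b k := fun n =>
  Summable.of_nonneg_of_le (fun k => by positivity)
    (fun k => by rw [← mul_add]; gcongr; exact norm_add_le _ _) ((ha n).add (hb n))

theorem Rapid.const_mul (ha : Rapid ξ a) (c : ℂ) : Rapid ξ fun k => c * a k := fun n =>
  ((ha n).mul_left ‖c‖).congr fun k => by rw [norm_mul]; ring

theorem Rapid.of_le (ha : Rapid ξ a) {C : ℝ} (h : ∀ k, ‖b k‖ ≤ C * ‖a k‖) : Rapid ξ b := fun n =>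
  Summable.of_nonneg_of_le (fun k => by positivity)
    (fun k => by
      have := mul_le_mul_of_nonneg_left (h k) (pow_nonneg (norm_nonneg (ξ k)) n)
      linarith) ((ha n).mul_left C)

/-! Real-valued sums of plane waves -/

variable {w : E3 → ℝ}

theorem contDiff_of_waveSum (hw : ∀ x, (w x : ℂ) = waveSum ξ a x) (ha : Rapid ξ a) (n : ℕ) :
    ContDiff ℝ n w := by
  have : w = Complex.reCLM ∘ waveSum ξ a := funext fun x => by simp [← hw]
  rw [this]
  exact Complex.reCLM.contDiff.comp (ha.contDiff n)

theorem lap_of_waveSum (hw : ∀ x, (w x : ℂ) = waveSum ξ a x) (ha : Rapid ξ a) (x : E3) :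
    (lap w x : ℂ) = waveSum ξ (fun k => -((‖ξ k‖ ^ 2 : ℝ) : ℂ) * a k) x := by
  rw [← ha.laplacian]
  have e : waveSum ξ a = Complex.ofRealCLM ∘ w := funext fun x => (hw x).symm
  have h := (contDiff_of_waveSum hw ha 2).contDiffAt (x := x)
  rw [e, ContDiffAt.laplacian_CLM_comp_left (l := Complex.ofRealCLM) h]
  rfl

theorem norm_gradient_sq_of_waveSum (hw : ∀ x, (w x : ℂ) = waveSum ξ a x) (ha : Rapid ξ a)
    (x : E3) : ((‖gradient w x‖ ^ 2 : ℝ) : ℂ)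
      = ∑ i, waveSum ξ (fun k => Complex.I * (ξ k i : ℝ) * a k) x ^ 2 := by
  have h1 : DifferentiableAt ℝ w x :=
    (contDiff_of_waveSum hw ha 1).differentiable one_ne_zero x
  rw [EuclideanSpace.norm_sq_eq]
  push_cast
  refine Finset.sum_congr rfl fun i _ => ?_
  have e : waveSum ξ a = Complex.ofRealCLM ∘ w := funext fun x => (hw x).symm
  have h2 := ha.fderiv_apply x (EuclideanSpace.basisFun (Fin 3) ℝ i)
  rw [e, fderiv_comp x Complex.ofRealCLM.differentiableAt h1] at h2
  have h3 : (gradient w x) i = fderiv ℝ w x (EuclideanSpace.basisFun (Fin 3) ℝ i) := by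
    rw [← inner_basisFun, gradient, InnerProductSpace.toDual_symm_apply]
  simp only [inner_basisFun] at h2
  rw [← h2, ← Complex.ofReal_pow, Real.norm_eq_abs, sq_abs, h3]
  simp

end Sums

end OhtaKawasaki

namespace OhtaKawasaki

open MeasureTheory

/-! ### Fourier series and averages over the periodicity cell -/

theorem planeWave_add (ξ η x : E3) : planeWave (ξ + η) x = planeWave ξ x * planeWave η x := by
  rw [planeWave, planeWave, planeWave, ← Complex.exp_add, inner_add_left]
  congr 1
  push_cast
  ring

theorem planeWave_zero (x : E3) : planeWave 0 x = 1 := by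
  simp [planeWave]

theorem summable_conv {a b : Idx → ℂ} (ha : Summable fun k => ‖a k‖)
    (hb : Summable fun k => ‖b k‖) : Summable fun k => ‖conv a b k‖ := by
  have := conv_summable (w := fun _ => ⟨1, Set.mem_Ioi.2 one_pos⟩) (fun _ _ => by simp)
    (a := a) (a' := b) (by simpa using ha) (by simpa using hb)
  simpa using this

theorem tsum_mul_tsum_eq_tsum_conv {a b : Idx → ℂ} (ha : Summable fun k => ‖a k‖)
    (hb : Summable fun k => ‖b k‖) : (∑' k, a k) * ∑' k, b k = ∑' k, conv a b k := by
  have hs : Summable fun p : Idx × Idx => a p.1 * b p.2 := summable_mul_of_summable_norm ha hb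
  have hs' : Summable fun p : Idx × Idx => a p.2 * b (p.1 - p.2) :=
    (convEquiv.summable_iff (f := fun p : Idx × Idx => a p.1 * b p.2)).2 hs
  rw [tsum_mul_tsum_of_summable_norm ha hb]
  exact (convEquiv.tsum_eq (fun p : Idx × Idx => a p.1 * b p.2)).symm.trans hs'.tsum_prod

/-- The frequencies are additive in the index, so the product of two absolutely convergent wave sums
regroups as a Cauchy product over ℤ³. -/
theorem waveSum_conv {ξ : Idx → E3} (hξ : ∀ k l, ξ (k + l) = ξ k + ξ l) {a b : Idx → ℂ}
    (ha : Summable fun k => ‖a k‖) (hb : Summable fun k => ‖b k‖) (x : E3) :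
    waveSum ξ (conv a b) x = waveSum ξ a x * waveSum ξ b x := by
  rw [waveSum, waveSum, waveSum, tsum_mul_tsum_eq_tsum_conv (by simpa [norm_planeWave] using ha)
    (by simpa [norm_planeWave] using hb)]
  refine tsum_congr fun k => ?_
  rw [conv, conv, ← tsum_mul_right]
  refine tsum_congr fun l => ?_
  have h := planeWave_add (ξ l) (ξ (k - l)) x
  rw [← hξ, add_sub_cancel] at h
  rw [h]
  ring

theorem integral_exp_int (n : ℤ) :
    ∫ s in Set.Icc (0 : ℝ) 1, Complex.exp (Complex.I * ((2 * Real.pi * (n * s) : ℝ) : ℂ))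
      = if n = 0 then 1 else 0 := by
  split_ifs with h
  · simp [h]
  · rw [integral_Icc_eq_integral_Ioc, ← intervalIntegral.integral_of_le zero_le_one]
    have hc : (2 * Real.pi * Complex.I * n : ℂ) ≠ 0 := by
      simp [Real.pi_ne_zero, h]
    have e : ∀ s : ℝ, Complex.exp (Complex.I * ((2 * Real.pi * (n * s) : ℝ) : ℂ))
        = Complex.exp ((2 * Real.pi * Complex.I * n : ℂ) * s) := fun s => by
      congr 1
      push_cast
      ring
    simp only [e]
    rw [integral_exp_mul_complex hc]
    have : (2 * Real.pi * Complex.I * n : ℂ) * ((1 : ℝ) : ℂ) = n * (2 * Real.pi * Complex.I) := by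
      push_cast; ring
    rw [this, Complex.exp_int_mul_two_pi_mul_I]
    simp

theorem integral_cube_exp (k : Idx) :
    ∫ s in Set.Icc (0 : Fin 3 → ℝ) 1, Complex.exp (Complex.I * ((2 * Real.pi * (k.toReal ⬝ᵥ s) : ℝ) : ℂ))
      = if k = 0 then 1 else 0 := by
  have e : ∀ s : Fin 3 → ℝ, Complex.exp (Complex.I * ((2 * Real.pi * (k.toReal ⬝ᵥ s) : ℝ) : ℂ))
      = ∏ i, Complex.exp (Complex.I * ((2 * Real.pi * (k i * s i) : ℝ) : ℂ)) := fun s => by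
    rw [← Complex.exp_sum]
    congr 1
    simp only [dotProduct, Idx.toReal, Finset.mul_sum, Complex.ofReal_sum]
  simp only [e]
  have hr : (volume : Measure (Fin 3 → ℝ)).restrict (Set.Icc 0 1)
      = Measure.pi fun _ : Fin 3 => (volume : Measure ℝ).restrict (Set.Icc 0 1) := by
    rw [← Set.pi_univ_Icc, volume_pi, Measure.restrict_pi_pi]
    rfl
  rw [hr, integral_fintype_prod_eq_prod (𝕜 := ℂ)
    (fun i s => Complex.exp (Complex.I * ((2 * Real.pi * (k i * s) : ℝ) : ℂ)))]
  simp only [integral_exp_int]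
  split_ifs with h
  · simp [h]
  · obtain ⟨i, hi⟩ := Function.ne_iff.1 h
    exact Finset.prod_eq_zero (Finset.mem_univ i) (if_neg hi)

theorem volume_cube : (volume : Measure (Fin 3 → ℝ)).real (Set.Icc 0 1) = 1 := by
  rw [Measure.real, Real.volume_Icc_pi]
  simp

namespace Cell

variable (t : Cell)

/-- The frequency `L_κ k`. -/
def freq (κ : Fin t.J → ℝ) (k : Idx) : E3 := WithLp.toLp 2 (t.L κ *ᵥ k.toReal)

theorem inner_freq (κ : Fin t.J → ℝ) (k : Idx) (x : E3) :
    inner ℝ (t.freq κ k) x = (t.L κ *ᵥ k.toReal) ⬝ᵥ (x : Fin 3 → ℝ) := by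
  rw [EuclideanSpace.inner_eq_star_dotProduct]
  simp [freq, dotProduct_comm]

theorem wave_eq (κ : Fin t.J → ℝ) (k : Idx) : t.wave κ k = planeWave (t.freq κ k) := by
  ext x
  rw [planeWave, inner_freq]
  rfl

theorem freq_add (κ : Fin t.J → ℝ) (k l : Idx) : t.freq κ (k + l) = t.freq κ k + t.freq κ l := by
  rw [freq, Idx.toReal_add, Matrix.mulVec_add, WithLp.toLp_add]
  rfl

theorem freq_neg (κ : Fin t.J → ℝ) (k : Idx) : t.freq κ (-k) = -t.freq κ k := by
  rw [freq, Idx.toReal_neg, Matrix.mulVec_neg, WithLp.toLp_neg]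
  rfl

theorem freq_zero (κ : Fin t.J → ℝ) : t.freq κ 0 = 0 := by
  have := t.freq_add κ 0 0
  rwa [add_zero, left_eq_add] at this

theorem norm_freq_sq {κ : Fin t.J → ℝ} (hκ : ∀ j, 0 ≤ κ j) (k : Idx) :
    ‖t.freq κ k‖ ^ 2 = t.DelR k κ := by
  rw [EuclideanSpace.norm_sq_eq, DelR, ← t.dot_L hκ]
  simp [freq, dotProduct, sq]

variable {κ : Fin t.J → ℝ}

theorem inner_freq_latticePoint (hκ : ∀ j, 0 < κ j) (k : Idx) (s : Fin 3 → ℝ) :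
    inner ℝ (t.freq κ k) (t.latticePoint κ s) = 2 * Real.pi * (k.toReal ⬝ᵥ s) := by
  rw [inner_freq]
  change (t.L κ *ᵥ k.toReal) ⬝ᵥ ((2 * Real.pi) • (((t.L κ)⁻¹)ᵀ *ᵥ s)) = _
  rw [dotProduct_smul, Cell.dot_inv_transpose (t.isUnit_L_det hκ), smul_eq_mul]

/-- The linear map `s ↦ 2π (L_κ⁻¹)ᵀ s`. -/
def latticeMap (κ : Fin t.J → ℝ) : E3 →L[ℝ] E3 :=
  LinearMap.toContinuousLinearMap
    { toFun := fun s => t.latticePoint κ s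
      map_add' := fun s s' => by
        simp [latticePoint, Matrix.mulVec_add]
      map_smul' := fun c s => by
        simp [latticePoint, Matrix.mulVec_smul, smul_smul, mul_comm] }

theorem latticeMap_injective (hκ : ∀ j, 0 < κ j) : Function.Injective (t.latticeMap κ) := by
  intro s s' h
  have h1 := congrArg (fun v : E3 => ((2 * Real.pi)⁻¹ : ℝ) • ((t.L κ)ᵀ *ᵥ (v : Fin 3 → ℝ))) h
  have e : ∀ s : E3, ((2 * Real.pi)⁻¹ : ℝ) • ((t.L κ)ᵀ *ᵥ (t.latticeMap κ s : Fin 3 → ℝ))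
      = (s : Fin 3 → ℝ) := fun s => by
    change ((2 * Real.pi)⁻¹ : ℝ) • ((t.L κ)ᵀ *ᵥ ((2 * Real.pi) • (((t.L κ)⁻¹)ᵀ *ᵥ _))) = _
    rw [Matrix.mulVec_smul, smul_smul, Matrix.mulVec_mulVec, ← Matrix.transpose_mul,
      Matrix.nonsing_inv_mul _ (t.isUnit_L_det hκ), Matrix.transpose_one, Matrix.one_mulVec,
      inv_mul_cancel₀ (by positivity), one_smul]
  simp only [e] at h1
  exact WithLp.ofLp_injective 2 h1

theorem latticeMap_det_ne (hκ : ∀ j, 0 < κ j) : (t.latticeMap κ).det ≠ 0 := by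
  have : IsUnit (LinearMap.det (t.latticeMap κ : E3 →ₗ[ℝ] E3)) :=
    LinearMap.isUnit_det _ ((Module.End.isUnit_iff _).2
      ⟨t.latticeMap_injective hκ, LinearMap.injective_iff_surjective.1
        (t.latticeMap_injective hκ)⟩)
  exact this.ne_zero

/-- The cell is the image of the unit cube under an injective linear map, whose Jacobian is constant
and cancels in averages. -/
theorem integral_Omega {F : Type*} [NormedAddCommGroup F] [NormedSpace ℝ F]
    (hκ : ∀ j, 0 < κ j) (g : E3 → F) : ∫ x in t.Omega κ, g x
      = |(t.latticeMap κ).det| • ∫ s in Set.Icc (0 : Fin 3 → ℝ) 1, g (t.latticePoint κ s) := by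
  set Q : Set E3 := (WithLp.ofLp) ⁻¹' Set.Icc (0 : Fin 3 → ℝ) 1 with hQ
  have hQm : MeasurableSet Q :=
    (PiLp.volume_preserving_ofLp (Fin 3)).measurable measurableSet_Icc
  have hO : t.Omega κ = t.latticeMap κ '' Q := by
    ext x
    constructor
    · rintro ⟨s, hs, rfl⟩
      exact ⟨WithLp.toLp 2 s, ⟨fun i => (hs i).1, fun i => (hs i).2⟩, rfl⟩
    · rintro ⟨s, hs, rfl⟩
      exact ⟨s, fun i => ⟨hs.1 i, hs.2 i⟩, rfl⟩
  rw [hO, integral_image_eq_integral_abs_det_fderiv_smul volume hQm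
    (fun x _ => (t.latticeMap κ).hasFDerivWithinAt) (t.latticeMap_injective hκ).injOn,
    integral_smul]
  congr 1
  exact (PiLp.volume_preserving_ofLp (Fin 3)).setIntegral_preimage_emb
    (MeasurableEquiv.toLp 2 (Fin 3 → ℝ)).symm.measurableEmbedding
    (fun s => g (t.latticePoint κ s)) _

/-- The average over the periodicity cell in relative coordinates. -/
theorem average_Omega {F : Type*} [NormedAddCommGroup F] [NormedSpace ℝ F] [CompleteSpace F]
    (hκ : ∀ j, 0 < κ j) (g : E3 → F) : ⨍ x in t.Omega κ, g x
      = ∫ s in Set.Icc (0 : Fin 3 → ℝ) 1, g (t.latticePoint κ s) := by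
  have h1 := t.integral_Omega hκ fun _ => (1 : ℝ)
  simp only [integral_const, measureReal_restrict_apply_univ, volume_cube, smul_eq_mul,
    mul_one] at h1
  rw [setAverage_eq, h1, t.integral_Omega hκ, smul_smul,
    inv_mul_cancel₀ (abs_ne_zero.2 (t.latticeMap_det_ne hκ)), one_smul]

/-- In relative coordinates the k-th wave is exp(2πi k·s), whatever κ is; over the unit cube only k
= 0 has a nonzero mean. -/
theorem average_waveSum (hκ : ∀ j, 0 < κ j) {a : Idx → ℂ} (ha : Summable fun k => ‖a k‖) :
    ∫ s in Set.Icc (0 : Fin 3 → ℝ) 1, waveSum (t.freq κ) a (t.latticePoint κ s) = a 0 := by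
  have e : ∀ k s, planeWave (t.freq κ k) (t.latticePoint κ s)
      = Complex.exp (Complex.I * ((2 * Real.pi * (k.toReal ⬝ᵥ s) : ℝ) : ℂ)) := fun k s => by
    rw [planeWave, t.inner_freq_latticePoint hκ]
  have hc : ∀ k : Idx, Continuous fun s : Fin 3 → ℝ =>
      a k * Complex.exp (Complex.I * ((2 * Real.pi * (k.toReal ⬝ᵥ s) : ℝ) : ℂ)) := fun k => by
    unfold dotProduct
    fun_prop
  have h := hasSum_integral_of_summable_integral_norm
    (μ := volume.restrict (Set.Icc (0 : Fin 3 → ℝ) 1))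
    (F := fun (k : Idx) (s : Fin 3 → ℝ) =>
      a k * Complex.exp (Complex.I * ((2 * Real.pi * (k.toReal ⬝ᵥ s) : ℝ) : ℂ)))
    (fun k => ((hc k).continuousOn.integrableOn_compact isCompact_Icc)) (by
      refine ha.congr fun k => ?_
      simp only [norm_mul, mul_comm Complex.I, Complex.norm_exp_ofReal_mul_I, mul_one,
        integral_const, measureReal_restrict_apply_univ, volume_cube, smul_eq_mul, one_mul])
  simp only [waveSum, e]
  rw [← h.tsum_eq]
  simp only [integral_const_mul, integral_cube_exp]
  rw [tsum_eq_single 0 fun k hk => by simp [hk]]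
  simp

theorem average_of_waveSum (hκ : ∀ j, 0 < κ j) {a : Idx → ℂ} (ha : Summable fun k => ‖a k‖)
    {w : E3 → ℝ} (hw : ∀ x, (w x : ℂ) = waveSum (t.freq κ) a x) :
    ((⨍ x in t.Omega κ, w x : ℝ) : ℂ) = a 0 := by
  rw [t.average_Omega hκ, ← t.average_waveSum hκ ha]
  simp only [← hw]
  exact integral_ofReal.symm

theorem integral_of_waveSum (hκ : ∀ j, 0 < κ j) {a : Idx → ℂ} (ha : Summable fun k => ‖a k‖)
    (h0 : a 0 = 0) {w : E3 → ℝ} (hw : ∀ x, (w x : ℂ) = waveSum (t.freq κ) a x) :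
    ∫ x in t.Omega κ, w x = 0 := by
  have h := t.average_of_waveSum hκ ha hw
  rw [t.average_Omega hκ, h0, Complex.ofReal_eq_zero] at h
  rw [t.integral_Omega hκ, h, smul_zero]

theorem periodic_of_waveSum (hκ : ∀ j, 0 < κ j) {a : Idx → ℂ} {w : E3 → ℝ}
    (hw : ∀ x, (w x : ℂ) = waveSum (t.freq κ) a x) : t.Periodic κ w := by
  intro n x
  apply Complex.ofReal_injective
  rw [hw, hw]
  refine tsum_congr fun k => ?_
  congr 1
  rw [planeWave, planeWave, inner_add_right, t.inner_freq_latticePoint hκ, Idx.toReal_dot]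
  have : Complex.I * ((inner ℝ (t.freq κ k) x + 2 * Real.pi * ((k ⬝ᵥ n : ℤ) : ℝ) : ℝ) : ℂ)
      = Complex.I * (inner ℝ (t.freq κ k) x : ℝ)
        + ((k ⬝ᵥ n : ℤ) : ℂ) * (2 * Real.pi * Complex.I) := by
    push_cast
    ring
  rw [this, Complex.exp_add, Complex.exp_int_mul_two_pi_mul_I, mul_one]

end Cell

/-- Reindex by g: orthogonality removes C_g from the inner product with g.k, and the translation
part contributes exactly the phase α_g(k). -/
theorem SpaceGroup.invariant_of_waveSum {t : Cell} {G : Type*} [Group G] (S : SpaceGroup t G)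
    {κ : Fin t.J → ℝ} (hκ : ∀ j, 0 < κ j) {a : Idx → ℂ} (ha : S.IsEquivariant a) {w : E3 → ℝ}
    (hw : ∀ x, (w x : ℂ) = waveSum (t.freq κ) a x) : S.Invariant κ w := by
  intro g x
  apply Complex.ofReal_injective
  rw [hw, hw, waveSum, waveSum, ← (S.actEquiv g).tsum_eq]
  refine tsum_congr fun k => ?_
  change a (S.act g k) * planeWave (t.freq κ (S.act g k)) _ = _
  rw [← ha g k, mul_assoc]
  congr 1
  rw [planeWave, planeWave, inner_add_right, t.inner_freq_latticePoint hκ, t.inner_freq,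
    t.inner_freq, S.L_act hκ, S.orthogonal_dot, α, ← Complex.exp_add]
  congr 1
  push_cast
  ring

end OhtaKawasaki

namespace OhtaKawasaki

/-! ### The solution and its energy -/

theorem conj_planeWave (ξ x : E3) : starRingEnd ℂ (planeWave ξ x) = planeWave (-ξ) x := by
  rw [planeWave, planeWave, ← Complex.exp_conj, map_mul, Complex.conj_I, Complex.conj_ofReal,
    inner_neg_left]
  push_cast
  ring_nf

theorem ofReal_re_waveSum {ξ : Idx → E3} (hξ : ∀ k, ξ (-k) = -ξ k) {a : Idx → ℂ} (ha : ref a = a)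
    (x : E3) : (((waveSum ξ a x).re : ℝ) : ℂ) = waveSum ξ a x := by
  rw [← Complex.conj_eq_iff_re, waveSum, Complex.conj_tsum, ← (Equiv.neg Idx).tsum_eq]
  refine tsum_congr fun k => ?_
  rw [map_mul, conj_planeWave, Equiv.neg_apply, hξ, neg_neg]
  congr 1
  exact congrFun ha k

theorem waveSum_single {ξ : Idx → E3} (hξ : ξ 0 = 0) (m : ℂ) (x : E3) :
    waveSum ξ (fun k => if k = 0 then m else 0) x = m := by
  rw [waveSum, tsum_eq_single 0 fun k hk => by simp [hk]]
  simp [hξ, planeWave_zero]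

theorem summable_single (m : ℂ) : Summable fun k : Idx => ‖(if k = 0 then m else 0)‖ :=
  summable_of_ne_finset_zero (s := {0}) fun k hk => by
    rw [if_neg (by simpa using hk), norm_zero]

/-- The zeroth coefficient of the sum of squared partial derivatives: I² = -1 cancels against the
sign in ξ_{-k} = -ξ_k. -/
theorem sum_conv_deriv {ξ : Idx → E3} (hξ : ∀ k, ξ (-k) = -ξ k) {a : Idx → ℂ} (ha : Rapid ξ a) :
    ∑ i, conv (fun k => Complex.I * (ξ k i : ℝ) * a k) (fun k => Complex.I * (ξ k i : ℝ) * a k) 0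
      = ∑' k, ((‖ξ k‖ ^ 2 : ℝ) : ℂ) * (a k * a (-k)) := by
  have hs : ∀ i : Fin 3, Summable fun k => ‖Complex.I * (ξ k i : ℝ) * a k‖ := fun i => by
    simpa only [inner_basisFun] using ha.summable_deriv (EuclideanSpace.basisFun (Fin 3) ℝ i)
  have hs' : ∀ i : Fin 3, Summable fun k =>
      (Complex.I * (ξ k i : ℝ) * a k) * (Complex.I * (ξ (0 - k) i : ℝ) * a (0 - k)) := fun i => by
    have := conv_summable_term (w := fun _ => ⟨1, Set.mem_Ioi.2 one_pos⟩) (fun _ _ => by simp)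
      (a := fun k => Complex.I * (ξ k i : ℝ) * a k) (a' := fun k => Complex.I * (ξ k i : ℝ) * a k)
      (by simpa using hs i) (by simpa using hs i) 0
    exact this.of_norm
  simp only [conv]
  rw [← Summable.tsum_finsetSum fun i _ => hs' i]
  refine tsum_congr fun k => ?_
  have e : ∀ i : Fin 3, (Complex.I * (ξ k i : ℝ) * a k)
      * (Complex.I * (ξ (0 - k) i : ℝ) * a (0 - k)) = ((ξ k i ^ 2 : ℝ) : ℂ) * (a k * a (-k)) :=
    fun i => by
      have hI := Complex.I_mul_I
      rw [zero_sub, hξ]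
      simp only [PiLp.neg_apply, Complex.ofReal_neg, Complex.ofReal_pow]
      linear_combination (-(ξ k i : ℂ) ^ 2 * a k * a (-k)) * hI
  simp only [e]
  rw [← Finset.sum_mul, EuclideanSpace.norm_sq_eq]
  simp only [Real.norm_eq_abs, sq_abs, Complex.ofReal_sum]

namespace Setup

section NoFintype

variable {t : Cell} {G : Type*} [Group G] (S : Setup t G)

/-- The weight is built from κ̄, the frequencies from κ. The two quadratic forms are comparable,
‖L_κ k‖² ≤ b⁻¹ ‖k‖², and the exponential weight beats every power; so one coefficient sequence
serves all positive κ. -/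
theorem rapid_of_summable {a : Idx → ℂ} (ha : Summable fun k => (S.wν k : ℝ) * ‖a k‖)
    {κ : Fin t.J → ℝ} (hκ : ∀ j, 0 < κ j) : Rapid (t.freq κ) a := by
  intro n
  obtain ⟨b, hb, h⟩ := t.exists_pos_le (κ := fun j => S.κbar j / κ j)
    fun j => div_pos (S.κbar_pos j) (hκ j)
  obtain ⟨C, hC, hC'⟩ := S.exists_knorm_pow_le n
  have h1 : ∀ k, ‖t.freq κ k‖ ≤ Real.sqrt b⁻¹ * S.knorm k := fun k => by
    rw [← sq_le_sq₀ (norm_nonneg _) (mul_nonneg (Real.sqrt_nonneg _) (S.knorm_nonneg k))]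
    rw [t.norm_freq_sq (fun j => (hκ j).le), mul_pow, Real.sq_sqrt (by positivity), S.knorm_sq,
      inv_mul_eq_div, le_div_iff₀ hb, mul_comm, ← t.DelR_smul]
    exact t.DelR_mono _ fun j => (le_div_iff₀ (hκ j)).1 (h j)
  refine Summable.of_nonneg_of_le (fun k => by positivity) (fun k => ?_)
    (ha.mul_left (Real.sqrt b⁻¹ ^ n * C))
  calc ‖t.freq κ k‖ ^ n * ‖a k‖ ≤ (Real.sqrt b⁻¹ * S.knorm k) ^ n * ‖a k‖ := by
        gcongr; exact h1 k
    _ = Real.sqrt b⁻¹ ^ n * (S.knorm k ^ n) * ‖a k‖ := by rw [mul_pow]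
    _ ≤ Real.sqrt b⁻¹ ^ n * (C * S.wν k) * ‖a k‖ := by gcongr; exact hC' k
    _ = _ := by ring

end NoFintype

end Setup

section Solution

variable {t : Cell} {κ : Fin t.J → ℝ} {c : Idx → ℂ}

/-- The coefficients of the potential. -/
def potCoeff (t : Cell) (κ : Fin t.J → ℝ) (c : Idx → ℂ) (k : Idx) : ℂ := c k / (t.DelR k κ : ℂ)

theorem ref_potCoeff (hc : ref c = c) : ref (potCoeff t κ c) = potCoeff t κ c := by
  ext k
  have := congrFun hc k
  simp only [ref, potCoeff, map_div₀, Complex.conj_ofReal, t.DelR_neg] at this ⊢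
  rw [this]

theorem rapid_potCoeff (hκ : ∀ j, 0 < κ j) (hc : Rapid (t.freq κ) c) :
    Rapid (t.freq κ) (potCoeff t κ c) := by
  obtain ⟨a, ha, h⟩ := t.exists_pos_le_DelR hκ
  refine hc.of_le (C := a⁻¹) fun k => ?_
  rw [potCoeff]
  by_cases hk : k = 0
  · rw [hk, t.DelR_zero]
    simp only [Complex.ofReal_zero, div_zero, norm_zero]
    positivity
  · rw [norm_div, Complex.norm_real, Real.norm_of_nonneg (t.DelR_pos hκ hk).le, div_eq_inv_mul]
    gcongr
    exact h k hk

/-- A function with given conjugate symmetric Fourier coefficients. -/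
def reSum (t : Cell) (κ : Fin t.J → ℝ) (c : Idx → ℂ) (x : E3) : ℝ := (waveSum (t.freq κ) c x).re

theorem ofReal_reSum (hc : ref c = c) (x : E3) :
    (reSum t κ c x : ℂ) = waveSum (t.freq κ) c x :=
  ofReal_re_waveSum (t.freq_neg κ) hc x

/-- Division by Δ_k inverts -Δ. At k = 0 the convention x / 0 = 0 supplies exactly the normalization
to mean zero, while c₀ = m makes the right-hand side mean free. -/
theorem isPotential_reSum (hκ : ∀ j, 0 < κ j) (hc : ref c = c) (hr : Rapid (t.freq κ) c) {m : ℝ}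
    (hm : c 0 = m) :
    IsPotential t m κ (reSum t κ c) (reSum t κ (potCoeff t κ c)) := by
  have hd := rapid_potCoeff hκ hr
  have hw := ofReal_reSum (t := t) (κ := κ) (ref_potCoeff (t := t) (κ := κ) hc)
  refine ⟨contDiff_of_waveSum hw hd 2, t.periodic_of_waveSum hκ hw,
    t.integral_of_waveSum hκ hd.summable (by simp [potCoeff, t.DelR_zero]) hw, fun x => ?_⟩
  apply Complex.ofReal_injective
  rw [Complex.ofReal_neg, lap_of_waveSum hw hd, Complex.ofReal_sub, ofReal_reSum hc,
    ← waveSum_single (t.freq_zero κ) (m : ℂ) x,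
    ← waveSum_sub hr.summable (summable_single _), neg_eq_neg_one_mul, ← waveSum_const_mul]
  refine tsum_congr fun k => ?_
  congr 1
  beta_reduce
  rw [t.norm_freq_sq fun j => (hκ j).le, potCoeff]
  by_cases hk : k = 0
  · simp [hk, hm, t.DelR_zero]
  · have : (t.DelR k κ : ℂ) ≠ 0 := Complex.ofReal_ne_zero.2 (t.DelR_pos hκ hk).ne'
    rw [if_neg hk]
    field_simp
    ring

theorem isPeriodicSolution_reSum (hκ : ∀ j, 0 < κ j) (hc : ref c = c) (hr : Rapid (t.freq κ) c)
    (hr3 : Rapid (t.freq κ) (conv c (conv c c))) {m γ : ℝ} (hm : c 0 = m)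
    (hf : ∀ k, k ≠ 0 → f t γ (fun j => (κ j : ℂ)) c k = 0) :
    IsPeriodicSolution t γ m κ (reSum t κ c) := by
  have hw := ofReal_reSum (t := t) (κ := κ) hc
  refine ⟨contDiff_of_waveSum hw hr 4, t.periodic_of_waveSum hκ hw, ?_, fun x => ?_⟩
  · apply Complex.ofReal_injective
    rw [t.average_of_waveSum hκ hr.summable hw, hm]
  · have hs := hr.summable
    have hs2 := summable_conv hs hs
    set e : Idx → ℂ := fun k => ((1 / (γ : ℂ) ^ 2) * -1 * ((‖t.freq κ k‖ ^ 2 : ℝ) : ℂ) * c k + c k)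
      + -1 * conv c (conv c c) k with he
    have hre : Rapid (t.freq κ) e := ((hr.norm_sq_mul _).add hr).add (hr3.const_mul (-1))
    have hg : ∀ y, ((1 / γ ^ 2 * lap (reSum t κ c) y + reSum t κ c y - reSum t κ c y ^ 3 : ℝ) : ℂ)
        = waveSum (t.freq κ) e y := fun y => by
      rw [he, waveSum_add ((hr.norm_sq_mul _).add hr).summable (hr3.const_mul (-1)).summable,
        waveSum_add (hr.norm_sq_mul _).summable hs, waveSum_const_mul (-1),
        waveSum_conv (t.freq_add κ) hs hs2, waveSum_conv (t.freq_add κ) hs hs]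
      rw [Complex.ofReal_sub, Complex.ofReal_add, Complex.ofReal_mul, Complex.ofReal_pow,
        lap_of_waveSum hw hr, hw, Complex.ofReal_div, Complex.ofReal_pow, Complex.ofReal_one,
        ← waveSum_const_mul]
      have : (fun k => 1 / (γ : ℂ) ^ 2 * (-((‖t.freq κ k‖ ^ 2 : ℝ) : ℂ) * c k))
          = fun k => (1 / (γ : ℂ) ^ 2) * -1 * ((‖t.freq κ k‖ ^ 2 : ℝ) : ℂ) * c k := by
        ext k; ring
      rw [this]
      generalize waveSum (t.freq κ) (fun k => _ * c k) y = X
      ring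
    apply Complex.ofReal_injective
    rw [Complex.ofReal_sub, Complex.ofReal_neg, lap_of_waveSum hg hre, Complex.ofReal_sub, hw,
      ← waveSum_single (t.freq_zero κ) (m : ℂ) x, ← waveSum_sub hs (summable_single _),
      neg_eq_neg_one_mul, ← waveSum_const_mul]
    have hr4 : Rapid (t.freq κ) fun k => -1 * (-((‖t.freq κ k‖ ^ 2 : ℝ) : ℂ) * e k) := by
      have := (hre.norm_sq_mul (-1)).const_mul (-1)
      convert this using 2
      ring
    have hs5 : Summable fun k => ‖c k - if k = 0 then (m : ℂ) else 0‖ :=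
      Summable.of_nonneg_of_le (fun _ => norm_nonneg _) (fun k => norm_sub_le _ _)
        (hs.add (summable_single (m : ℂ)))
    rw [← waveSum_sub hr4.summable hs5, waveSum, Complex.ofReal_zero]
    refine (tsum_congr fun k => ?_).trans tsum_zero
    apply mul_eq_zero_of_left
    by_cases hk : k = 0
    · simp [hk, hm, t.freq_zero]
    · have hne : (t.DelR k κ : ℂ) ≠ 0 := Complex.ofReal_ne_zero.2 (t.DelR_pos hκ hk).ne'
      have h := hf k hk
      rw [f, t.DelC_ofReal, P] at h
      -- The k-th coefficient of the residual is -Δ_k f_k; the factor Δ_k clears the reciprocal in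
      -- P.
      have h' : (t.DelR k κ : ℂ) * ((1 / (γ : ℂ) ^ 2 * (t.DelR k κ : ℂ) - 1 + 1 / (t.DelR k κ : ℂ))
          * c k + conv c (conv c c) k) = 0 := by rw [h, mul_zero]
      have h2 : (t.DelR k κ : ℂ) * (1 / (t.DelR k κ : ℂ)) = 1 := by field_simp
      rw [if_neg hk, he]
      beta_reduce
      rw [t.norm_freq_sq fun j => (hκ j).le]
      linear_combination -h' + c k * h2

/-- Parseval's identity for the energy. -/
theorem energy_reSum (hκ : ∀ j, 0 < κ j) (hc : ref c = c) (hr : Rapid (t.freq κ) c) (γ : ℝ) :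
    energy t γ κ (reSum t κ c) (reSum t κ (potCoeff t κ c))
      = (1 / 4 * conv (fun k => (if k = 0 then 1 else 0) - conv c c k)
          (fun k => (if k = 0 then 1 else 0) - conv c c k) 0).re
        + ∑' k, 1 / 2 * (1 / γ ^ 2 * t.DelR k κ + 1 / t.DelR k κ) * ‖c k‖ ^ 2 := by
  have hd := rapid_potCoeff hκ hr
  have hw := ofReal_reSum (t := t) (κ := κ) hc
  have hv := ofReal_reSum (t := t) (κ := κ) (ref_potCoeff (t := t) (κ := κ) hc)
  have hs := hr.summable
  set d := potCoeff t κ c with hd'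
  -- These are the coefficients of 1 - u²; below, `g a` holds those of the squared gradient of the
  -- wave sum of a.
  set q : Idx → ℂ := fun k => (if k = 0 then 1 else 0) - conv c c k with hq
  have hqs : Summable fun k => ‖q k‖ :=
    Summable.of_nonneg_of_le (fun _ => norm_nonneg _) (fun k => norm_sub_le _ _)
      ((summable_single 1).add (summable_conv hs hs))
  have hD : ∀ {a : Idx → ℂ}, Rapid (t.freq κ) a → ∀ i : Fin 3,
      Summable fun k => ‖Complex.I * (t.freq κ k i : ℝ) * a k‖ := fun ha i => by
    simpa only [inner_basisFun] using ha.summable_deriv (EuclideanSpace.basisFun (Fin 3) ℝ i)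
  set g : (Idx → ℂ) → Idx → ℂ := fun a k => ∑ i : Fin 3,
    conv (fun k => Complex.I * (t.freq κ k i : ℝ) * a k)
      (fun k => Complex.I * (t.freq κ k i : ℝ) * a k) k with hgdef
  have hgs : ∀ {a : Idx → ℂ}, Rapid (t.freq κ) a → Summable fun k => ‖g a k‖ := fun ha =>
    Summable.of_nonneg_of_le (fun _ => norm_nonneg _) (fun k => norm_sum_le _ _)
      (summable_sum fun i _ => summable_conv (hD ha i) (hD ha i))
  have hg : ∀ {a : Idx → ℂ}, Rapid (t.freq κ) a → ∀ x, waveSum (t.freq κ) (g a) x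
      = ∑ i, waveSum (t.freq κ) (fun k => Complex.I * (t.freq κ k i : ℝ) * a k) x ^ 2 :=
    fun {a} ha x => by
      simp only [sq, ← waveSum_conv (t.freq_add κ) (hD ha _) (hD ha _) x]
      simp only [waveSum, hgdef, Finset.sum_mul]
      exact Summable.tsum_finsetSum fun i _ =>
        summable_mul_planeWave (summable_conv (hD ha i) (hD ha i)) x
  have hs1 : Summable fun k => ‖(1 / (2 * (γ : ℂ) ^ 2)) * g c k‖ :=
    ((hgs hr).mul_left ‖(1 / (2 * (γ : ℂ) ^ 2))‖).congr fun k => (norm_mul _ _).symm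
  have hs2 : Summable fun k => ‖(1 / 4 : ℂ) * conv q q k‖ :=
    ((summable_conv hqs hqs).mul_left ‖(1 / 4 : ℂ)‖).congr fun k => (norm_mul _ _).symm
  have hs3 : Summable fun k => ‖(1 / 2 : ℂ) * g d k‖ :=
    ((hgs hd).mul_left ‖(1 / 2 : ℂ)‖).congr fun k => (norm_mul _ _).symm
  have hs12 : Summable fun k => ‖(1 / (2 * (γ : ℂ) ^ 2)) * g c k + (1 / 4 : ℂ) * conv q q k‖ :=
    Summable.of_nonneg_of_le (fun _ => norm_nonneg _) (fun k => norm_add_le _ _) (hs1.add hs2)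
  have hs123 : Summable fun k => ‖(1 / (2 * (γ : ℂ) ^ 2)) * g c k + (1 / 4 : ℂ) * conv q q k
      + (1 / 2 : ℂ) * g d k‖ :=
    Summable.of_nonneg_of_le (fun _ => norm_nonneg _) (fun k => norm_add_le _ _) (hs12.add hs3)
  -- The energy density is itself a wave sum, so its average is its zeroth coefficient.
  have key := t.average_of_waveSum hκ hs123
    (w := fun x => 1 / (2 * γ ^ 2) * ‖gradient (reSum t κ c) x‖ ^ 2
      + 1 / 4 * (1 - reSum t κ c x ^ 2) ^ 2 + 1 / 2 * ‖gradient (reSum t κ d) x‖ ^ 2)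
    fun x => by
      have h1 := norm_gradient_sq_of_waveSum hw hr x
      have h2 := norm_gradient_sq_of_waveSum hv hd x
      rw [waveSum_add hs12 hs3, waveSum_add hs1 hs2, waveSum_const_mul, waveSum_const_mul,
        waveSum_const_mul, hg hr, hg hd, ← h1, ← h2, waveSum_conv (t.freq_add κ) hqs hqs,
        hq, waveSum_sub (summable_single 1) (summable_conv hs hs),
        waveSum_single (t.freq_zero κ), waveSum_conv (t.freq_add κ) hs hs, ← hw]
      push_cast
      ring
  have hge : energy t γ κ (reSum t κ c) (reSum t κ d)
      = ((1 / (2 * (γ : ℂ) ^ 2)) * g c 0 + (1 / 4 : ℂ) * conv q q 0 + (1 / 2 : ℂ) * g d 0).re := by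
    rw [← key]
    rfl
  have hcc : ∀ k, c k * c (-k) = ((‖c k‖ ^ 2 : ℝ) : ℂ) := fun k => by
    have := congrFun hc (-k)
    rw [ref, neg_neg] at this
    rw [← this, Complex.mul_conj, Complex.normSq_eq_norm_sq]
  have hgc : g c 0 = ((∑' k, t.DelR k κ * ‖c k‖ ^ 2 : ℝ) : ℂ) := by
    rw [hgdef]
    simp only []
    rw [sum_conv_deriv (t.freq_neg κ) hr, Complex.ofReal_tsum]
    refine tsum_congr fun k => ?_
    rw [hcc, t.norm_freq_sq fun j => (hκ j).le]
    push_cast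
    rfl
  have hgd : g d 0 = ((∑' k, 1 / t.DelR k κ * ‖c k‖ ^ 2 : ℝ) : ℂ) := by
    rw [hgdef]
    simp only []
    rw [sum_conv_deriv (t.freq_neg κ) hd, Complex.ofReal_tsum]
    refine tsum_congr fun k => ?_
    rw [hd', potCoeff, potCoeff, t.DelR_neg, div_mul_div_comm, hcc,
      t.norm_freq_sq fun j => (hκ j).le]
    by_cases hk : k = 0
    · simp [hk, t.DelR_zero]
    · have : (t.DelR k κ : ℂ) ≠ 0 := Complex.ofReal_ne_zero.2 (t.DelR_pos hκ hk).ne'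
      push_cast
      field_simp
  obtain ⟨M, hM⟩ : ∃ M, ∀ k, ‖c k‖ ≤ M := ⟨∑' k, ‖c k‖, fun k => hs.le_tsum k fun _ _ => norm_nonneg _⟩
  have hsum1 : Summable fun k => t.DelR k κ * ‖c k‖ ^ 2 := by
    refine Summable.of_nonneg_of_le (fun k => mul_nonneg (t.DelR_nonneg k fun j => (hκ j).le)
      (sq_nonneg _)) (fun k => ?_) ((hr 2).mul_left M)
    rw [t.norm_freq_sq fun j => (hκ j).le]
    have := mul_le_mul_of_nonneg_left (hM k)
      (mul_nonneg (t.DelR_nonneg k fun j => (hκ j).le) (norm_nonneg (c k)))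
    linarith
  have hsum2 : Summable fun k => 1 / t.DelR k κ * ‖c k‖ ^ 2 := by
    refine Summable.of_nonneg_of_le (fun k => mul_nonneg
      (one_div_nonneg.2 (t.DelR_nonneg k fun j => (hκ j).le)) (sq_nonneg _)) (fun k => ?_)
      (hd.summable.mul_left M)
    rw [hd', potCoeff, norm_div, Complex.norm_real,
      Real.norm_of_nonneg (t.DelR_nonneg k fun j => (hκ j).le)]
    have := mul_le_mul_of_nonneg_right (hM k) (mul_nonneg
      (one_div_nonneg.2 (t.DelR_nonneg k fun j => (hκ j).le)) (norm_nonneg (c k)))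
    calc _ = ‖c k‖ * (1 / t.DelR k κ * ‖c k‖) := by ring
      _ ≤ M * (1 / t.DelR k κ * ‖c k‖) := this
      _ = _ := by ring
  rw [hge, hgc, hgd]
  have e1 : ∀ X Y : ℝ, ∀ z : ℂ, ((1 / (2 * (γ : ℂ) ^ 2)) * (X : ℂ) + z + (1 / 2 : ℂ) * (Y : ℂ)).re
      = z.re + (1 / (2 * γ ^ 2) * X + 1 / 2 * Y) := fun X Y z => by
    have : (1 / (2 * (γ : ℂ) ^ 2)) * (X : ℂ) + z + (1 / 2 : ℂ) * (Y : ℂ)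
        = z + ((1 / (2 * γ ^ 2) * X + 1 / 2 * Y : ℝ) : ℂ) := by push_cast; ring
    rw [this, Complex.add_re, Complex.ofReal_re]
  rw [e1, ← tsum_mul_left, ← tsum_mul_left, ← (hsum1.mul_left _).tsum_add (hsum2.mul_left _)]
  congr 1
  refine tsum_congr fun k => ?_
  have : 1 / (2 * γ ^ 2) = 1 / 2 * (1 / γ ^ 2) := by rw [one_div_mul_one_div]
  rw [this]
  ring

end Solution

end OhtaKawasaki

namespace OhtaKawasaki

/-! ### Stationarity of the energy -/

namespace Cell

variable (t : Cell)

/-- The linear form `κ ↦ Δ_k κ` for real length scales. -/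
def DelRL (k : Idx) : (Fin t.J → ℝ) →L[ℝ] ℝ := ∑ j, t.Del k j • ContinuousLinearMap.proj j

theorem DelRL_apply (k : Idx) (κ : Fin t.J → ℝ) : t.DelRL k κ = t.DelR k κ := by
  simp [DelRL, DelR]

theorem norm_DelRL_le (k : Idx) : ‖t.DelRL k‖ ≤ ∑ j, t.Del k j := by
  refine ContinuousLinearMap.opNorm_le_bound _ (Finset.sum_nonneg fun j _ => t.Del_nonneg k j)
    fun κ => ?_
  rw [DelRL_apply, DelR, Finset.sum_mul]
  refine norm_sum_le_of_le _ fun j _ => ?_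
  rw [norm_mul, Real.norm_of_nonneg (t.Del_nonneg k j)]
  exact mul_le_mul_of_nonneg_left (norm_le_pi_norm κ j) (t.Del_nonneg k j)

theorem hasFDerivAt_DelR (k : Idx) (κ : Fin t.J → ℝ) :
    HasFDerivAt (t.DelR k) (t.DelRL k) κ := by
  have : t.DelR k = t.DelRL k := funext fun κ => (t.DelRL_apply k κ).symm
  rw [this]
  exact (t.DelRL k).hasFDerivAt

theorem DelRL_zero : t.DelRL 0 = 0 := by
  simp [DelRL, Del_zero]

variable {t}

/-- At k = 0 the form vanishes identically and 1 / 0 = 0, so the term is constant; otherwise apply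
the chain rule through the linear form. -/
theorem hasFDerivAt_energy_term {κ : Fin t.J → ℝ} (hκ : ∀ j, 0 < κ j) (γ s : ℝ) (k : Idx) :
    HasFDerivAt (fun κ => 1 / 2 * (1 / γ ^ 2 * t.DelR k κ + 1 / t.DelR k κ) * s)
      ((1 / 2 * (1 / γ ^ 2 - 1 / t.DelR k κ ^ 2) * s) • t.DelRL k) κ := by
  by_cases hk : k = 0
  · subst hk
    simp only [t.DelR_zero, DelRL_zero, smul_zero]
    exact hasFDerivAt_const _ _
  · have hD := t.DelR_pos hκ hk
    have h1 : HasDerivAt (fun y : ℝ => 1 / 2 * (1 / γ ^ 2 * y + 1 / y) * s)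
        (1 / 2 * (1 / γ ^ 2 - 1 / t.DelR k κ ^ 2) * s) (t.DelR k κ) := by
      have h2 := (((hasDerivAt_id (t.DelR k κ)).const_mul (1 / γ ^ 2)).add
        (hasDerivAt_inv hD.ne')).const_mul (1 / 2 : ℝ) |>.mul_const s
      refine (h2.congr_deriv (by ring)).congr_of_eventuallyEq (Filter.Eventually.of_forall fun y => ?_)
      simp
    exact h1.comp_hasFDerivAt κ (t.hasFDerivAt_DelR k κ)

theorem summable_energy_term {κ : Fin t.J → ℝ} (hκ : ∀ j, 0 < κ j) (γ : ℝ) {s : Idx → ℝ}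
    (hs0 : ∀ k, 0 ≤ s k) (hs : ∀ j, Summable fun k => t.Del k j * s k) :
    Summable fun k => 1 / 2 * (1 / γ ^ 2 * t.DelR k κ + 1 / t.DelR k κ) * s k := by
  obtain ⟨a, ha, h⟩ := t.exists_pos_le_DelR hκ
  have h0 : ∀ k, 0 ≤ t.DelR k κ := fun k => t.DelR_nonneg k fun j => (hκ j).le
  have h1 : Summable fun k => t.DelR k κ * s k := by
    simp only [DelR, Finset.sum_mul]
    refine summable_sum fun j _ => ((hs j).mul_left (κ j)).congr fun k => by ring
  refine Summable.of_nonneg_of_le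
    (fun k => mul_nonneg (mul_nonneg (by norm_num) (add_nonneg
      (mul_nonneg (by positivity) (h0 k)) (one_div_nonneg.2 (h0 k)))) (hs0 k))
    (fun k => ?_) (h1.mul_left (1 / 2 * (1 / γ ^ 2 + 1 / a ^ 2)))
  -- The forms are bounded below by a away from k = 0, so the reciprocal is dominated by a multiple
  -- of the form itself.
  have h2 : 1 / t.DelR k κ ≤ 1 / a ^ 2 * t.DelR k κ := by
    by_cases hk : k = 0
    · simp [hk, t.DelR_zero]
    · have hD := t.DelR_pos hκ hk
      rw [div_le_iff₀ hD, one_div_mul_eq_div, div_mul_eq_mul_div, one_le_div (by positivity), ← sq]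
      have := h k hk
      gcongr
  have h3 : 1 / 2 * (1 / γ ^ 2 * t.DelR k κ + 1 / t.DelR k κ)
      ≤ 1 / 2 * (1 / γ ^ 2 + 1 / a ^ 2) * t.DelR k κ := by
    linarith
  exact (mul_le_mul_of_nonneg_right h3 (hs0 k)).trans (mul_assoc _ _ _).le

theorem isOpen_forall_lt (κ : Fin t.J → ℝ) : IsOpen {κ' : Fin t.J → ℝ | ∀ j, κ j < κ' j} := by
  simp only [Set.ofPred_forall]
  exact isOpen_iInter_of_finite fun j => isOpen_lt continuous_const (continuous_apply j)

theorem convex_forall_lt (κ : Fin t.J → ℝ) : Convex ℝ {κ' : Fin t.J → ℝ | ∀ j, κ j < κ' j} := by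
  simp only [Set.ofPred_forall]
  exact convex_iInter fun j => convex_halfSpace_gt (LinearMap.proj j).isLinear _

/-- The derivative with respect to the length scales of the quadratic part of the energy. -/
theorem hasFDerivAt_tsum_energy {κ : Fin t.J → ℝ} (hκ : ∀ j, 0 < κ j) (γ : ℝ) {s : Idx → ℝ}
    (hs0 : ∀ k, 0 ≤ s k) (hs : ∀ j, Summable fun k => t.Del k j * s k)
    (hcrit : ∀ j, ∑' k, 1 / 2 * (1 / γ ^ 2 - 1 / t.DelR k κ ^ 2) * s k * t.Del k j = 0) :
    HasFDerivAt (fun κ => ∑' k, 1 / 2 * (1 / γ ^ 2 * t.DelR k κ + 1 / t.DelR k κ) * s k)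
      (0 : (Fin t.J → ℝ) →L[ℝ] ℝ) κ := by
  -- On the open convex set of length scales above κ/2 all Δ_k with k ≠ 0 have a common positive
  -- lower bound, which gives a summable majorant for the derivatives.
  have hκ2 : ∀ j, 0 < κ j / 2 := fun j => half_pos (hκ j)
  obtain ⟨a, ha, h⟩ := t.exists_pos_le_DelR hκ2
  have hu : Summable fun k => 1 / 2 * (1 / γ ^ 2 + 1 / a ^ 2) * ∑ j, t.Del k j * s k :=
    (summable_sum fun j _ => hs j).mul_left _
  have hmem : κ ∈ {κ' : Fin t.J → ℝ | ∀ j, κ j / 2 < κ' j} := fun j => half_lt_self (hκ j)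
  have hb : ∀ k (x : Fin t.J → ℝ), x ∈ {κ' : Fin t.J → ℝ | ∀ j, κ j / 2 < κ' j} →
      ‖(1 / 2 * (1 / γ ^ 2 - 1 / t.DelR k x ^ 2) * s k) • t.DelRL k‖
        ≤ 1 / 2 * (1 / γ ^ 2 + 1 / a ^ 2) * ∑ j, t.Del k j * s k := fun k x hx => by
    have h1 : 1 / t.DelR k x ^ 2 ≤ 1 / a ^ 2 := by
      by_cases hk : k = 0
      · rw [hk, t.DelR_zero]
        simp only [ne_eq, OfNat.ofNat_ne_zero, not_false_eq_true, zero_pow, div_zero]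
        positivity
      · have := (h k hk).trans (t.DelR_mono k fun j => (hx j).le)
        gcongr
    have h2 : |1 / γ ^ 2 - 1 / t.DelR k x ^ 2| ≤ 1 / γ ^ 2 + 1 / a ^ 2 := by
      have h3 : 0 ≤ 1 / γ ^ 2 := by positivity
      have h4 : 0 ≤ 1 / t.DelR k x ^ 2 := by positivity
      rw [abs_le]
      constructor <;> linarith
    rw [norm_smul, norm_mul, norm_mul, Real.norm_of_nonneg (hs0 k), Real.norm_eq_abs (_ - _),
      Real.norm_of_nonneg (by norm_num : (0 : ℝ) ≤ 1 / 2), ← Finset.sum_mul]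
    calc 1 / 2 * |1 / γ ^ 2 - 1 / t.DelR k x ^ 2| * s k * ‖t.DelRL k‖
        ≤ 1 / 2 * (1 / γ ^ 2 + 1 / a ^ 2) * s k * ∑ j, t.Del k j := by
          have := hs0 k
          gcongr
          exact t.norm_DelRL_le k
      _ = _ := by ring
  have key := hasFDerivAt_tsum_of_isPreconnected hu (isOpen_forall_lt fun j => κ j / 2)
    (convex_forall_lt fun j => κ j / 2).isPreconnected
    (fun k x hx => hasFDerivAt_energy_term (fun j => (hκ2 j).trans (hx j)) γ (s k) k) hb hmem
    (summable_energy_term hκ γ hs0 hs) hmem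
  have hsum : Summable fun k => (1 / 2 * (1 / γ ^ 2 - 1 / t.DelR k κ ^ 2) * s k) • t.DelRL k :=
    Summable.of_norm_bounded hu fun k => hb k κ hmem
  have hz : ∑' k, (1 / 2 * (1 / γ ^ 2 - 1 / t.DelR k κ ^ 2) * s k) • t.DelRL k = 0 := by
    refine ContinuousLinearMap.coe_injective (LinearMap.pi_ext' fun j => LinearMap.ext_ring ?_)
    change (∑' k, (1 / 2 * (1 / γ ^ 2 - 1 / t.DelR k κ ^ 2) * s k) • t.DelRL k)
      (Pi.single j 1) = 0
    rw [← hcrit j]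
    refine ((ContinuousLinearMap.apply ℝ ℝ (Pi.single j (1 : ℝ))).map_tsum hsum).trans
      (tsum_congr fun k => ?_)
    rw [ContinuousLinearMap.apply_apply, smul_apply, DelRL_apply, smul_eq_mul]
    congr 1
    rw [DelR, Finset.sum_eq_single j (fun i _ hi => by rw [Pi.single_eq_of_ne hi, mul_zero]) (by simp),
      Pi.single_eq_same, mul_one]
  rwa [hz] at key

end Cell

variable {t : Cell} {κ : Fin t.J → ℝ} {c : Idx → ℂ}

theorem mul_neg_of_ref (hc : ref c = c) (k : Idx) : c k * c (-k) = ((‖c k‖ ^ 2 : ℝ) : ℂ) := by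
  have := congrFun hc (-k)
  rw [ref, neg_neg] at this
  rw [← this, Complex.mul_conj, Complex.normSq_eq_norm_sq]

/-- Conjugate symmetry makes c_k c_{-k} = |c_k|², and the index 0 may be added because Δ_0^j = 0; so
h_j is the real critical point sum of the energy. -/
theorem h_eq_tsum (hc : ref c = c) (γ : ℝ) (j : Fin t.J) :
    h t γ (fun j => (κ j : ℂ)) c j
      = ((∑' k, 1 / 2 * (1 / γ ^ 2 - 1 / t.DelR k κ ^ 2) * ‖c k‖ ^ 2 * t.Del k j : ℝ) : ℂ) := by
  rw [h, ← tsum_mul_left, Complex.ofReal_tsum]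
  rw [← tsum_subtype_eq_of_support_subset (s := {k : Idx | k ≠ 0}) fun k hk h0 => hk ?_]
  · refine tsum_congr fun k => ?_
    rw [mul_assoc (_ * _) (c _), mul_neg_of_ref hc, t.DelC_ofReal, P']
    push_cast
    ring
  · simp [h0, t.Del_zero]

/-- In Parseval's form the convolution term depends on c alone, so only the quadratic part varies
with κ, and its partial derivatives are the h_j. That form holds on the open positive orthant, which
suffices for a derivative at κ. -/
theorem energy_stationary (hκ : ∀ j, 0 < κ j) (hc : ref c = c)
    (hr : ∀ κ : Fin t.J → ℝ, (∀ j, 0 < κ j) → Rapid (t.freq κ) c) {γ : ℝ}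
    (hs : ∀ j, Summable fun k => t.Del k j * ‖c k‖ ^ 2)
    (hh : ∀ j, h t γ (fun j => (κ j : ℂ)) c j = 0) :
    HasFDerivAt (fun κ => energy t γ κ (reSum t κ c) (reSum t κ (potCoeff t κ c)))
      (0 : (Fin t.J → ℝ) →L[ℝ] ℝ) κ := by
  have key := (Cell.hasFDerivAt_tsum_energy hκ γ (s := fun k => ‖c k‖ ^ 2)
    (fun k => sq_nonneg _) hs fun j => by
      have := hh j
      rwa [h_eq_tsum hc, Complex.ofReal_eq_zero] at this).const_add
    (1 / 4 * conv (fun k => (if k = 0 then 1 else 0) - conv c c k)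
      (fun k => (if k = 0 then 1 else 0) - conv c c k) 0).re
  refine key.congr_of_eventuallyEq ?_
  filter_upwards [(Cell.isOpen_forall_lt (0 : Fin t.J → ℝ)).mem_nhds hκ] with κ' hκ'
  exact energy_reSum hκ' hc (hr κ' hκ') γ

namespace Setup

variable {G : Type*} [Group G] (S : Setup t G)

/-- One factor |c_k| takes the weight that dominates Δ_k^j; the other stays bounded. -/
theorem summable_Del_mul_sq {c : Idx → ℂ} (hc : Summable fun k => (S.wν k : ℝ) * ‖c k‖)
    (j : Fin t.J) : Summable fun k => t.Del k j * ‖c k‖ ^ 2 := by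
  obtain ⟨C, hC, h⟩ := S.exists_Del_le j
  set M := ∑' k, (S.wν k : ℝ) * ‖c k‖
  have hM : ∀ k, ‖c k‖ ≤ M := fun k =>
    (le_mul_of_one_le_left (norm_nonneg _) (S.one_le_wν k)).trans
      (hc.le_tsum k fun i _ => mul_nonneg (zero_le_one.trans (S.one_le_wν i)) (norm_nonneg _))
  refine Summable.of_nonneg_of_le (fun k => mul_nonneg (t.Del_nonneg k j) (sq_nonneg _))
    (fun k => ?_) (hc.mul_left (C * M))
  have h0 := t.Del_nonneg k j
  calc t.Del k j * ‖c k‖ ^ 2 = t.Del k j * (‖c k‖ * ‖c k‖) := by rw [sq]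
    _ ≤ C * S.wν k * (M * ‖c k‖) := by
        gcongr
        · exact h0.trans (h k)
        · exact h k
        · exact hM k
    _ = _ := by ring

end Setup

end OhtaKawasaki

end

/-! ### The main theorem -/

open OhtaKawasaki OhtaKawasaki.Setup in
theorem mainTheorem1 {t : Cell} {G : Type*} [Group G] [Fintype G] (S : Setup t G)
    (bbar : S.X0) (hsymm : S.xbar bbar ∈ S.symm)
    (A : Module.End ℂ S.Fin0) (hA : IsUnit A) (hAconj : ∀ y, A (S.conjFin y) = S.conjFin (A y))
    (rs : Fin 2 → ℝ) (hrs : ∀ i, 0 < rs i) (hrs1 : rs 0 < 1)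
    (Y : Fin 2 → ℝ) (Z : Fin 2 → Fin 2 → ℝ) (W : Fin 2 → Fin 2 → Fin 2 → ℝ)
    (hY : ∀ i, 0 ≤ Y i) (hZ : ∀ i i', 0 ≤ Z i i') (hW : ∀ i i' i'', 0 ≤ W i i' i'')
    (hbounds : S.Bounds A bbar rs Y Z W)
    (rh : Fin 2 → ℝ) (hrh : ∀ i, 0 < rh i) (hrhs : ∀ i, rh i ≤ rs i)
    (hp₁ : p₁ Y Z W rh < 0) (hp₂ : p₂ Y Z W rh < 0)
    (hp₃ : p₃ Z W rh < 0) (hp₄ : p₄ Z W rh < 0) :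
    ∃ (κh : Fin t.J → ℝ) (xh : S.CJ × S.X0),
      -- the unique zero of `𝓕` in the conjugate symmetric ball
      (xh ∈ S.ball rh (S.xbar bbar) ∧ S.F xh = 0 ∧
        ∀ x ∈ S.ball rh (S.xbar bbar), S.F x = 0 → x = xh) ∧
      (∀ j, coords xh.1 j = (κh j : ℂ) ∧ 0 < κh j) ∧
      -- the functions `u κ` with the Fourier coefficients found and the cell `Ω_κ`
      ∃ u : (Fin t.J → ℝ) → E3 → ℝ,
        (∀ κ, (∀ j, 0 < κ j) → ∀ x,
          HasSum (fun k => S.coeff (seq xh.2) k * t.wave κ k x) (u κ x : ℂ)) ∧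
        IsPeriodicSolution t S.γ S.m κh (u κh) ∧
        S.Invariant κh (u κh) ∧
        -- the energy is stationary with respect to the proportions of the cell
        ∃ v : (Fin t.J → ℝ) → E3 → ℝ,
          (∀ κ, (∀ j, 0 < κ j) → IsPotential t S.m κ (u κ) (v κ)) ∧
          HasFDerivAt (fun κ => energy t S.γ κ (u κ) (v κ)) (0 : (Fin t.J → ℝ) →L[ℝ] ℝ) κh := by
  obtain ⟨xh, hmem, hpos, hF, huniq⟩ := S.exists_unique_zero bbar hsymm A hA hAconj rs hrs1 Y Z W
    hZ hW hbounds rh hrh hrhs hp₁ hp₂ hp₃ hp₄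
  have hco := coords_eq_reκ hmem.2
  have hκ : ∀ j, 0 < reκ xh j := hpos
  have hws := S.summable_coeff xh.2
  have hf : ∀ k, k ≠ 0 → f t S.γ (fun j => (reκ xh j : ℂ)) (S.coeff (seq xh.2)) k = 0 :=
    fun k hk => hco ▸ S.f_eq_zero_of_F_eq_zero hF hk
  have hh : ∀ j, h t S.γ (fun j => (reκ xh j : ℂ)) (S.coeff (seq xh.2)) j = 0 :=
    fun j => hco ▸ congrFun (congrArg Prod.fst hF) j
  have hc := S.ref_coeff hmem.2.2
  have hm := S.coeff_zero (seq xh.2)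
  have heq := S.coeff_equivariant (seq xh.2)
  -- From here on the coefficients matter only as a fixed sequence, independent of κ, that is
  -- weighted summable, conjugate symmetric and equivariant and satisfies the equations f_k = 0 and
  -- h_j = 0.
  generalize hcoeff : S.coeff (seq xh.2) = c at hws hf hh hc hm heq
  have hr : ∀ κ : Fin t.J → ℝ, (∀ j, 0 < κ j) → Rapid (t.freq κ) c :=
    fun κ hκ => S.rapid_of_summable hws hκ
  have hr3 : Rapid (t.freq (reκ xh)) (conv c (conv c c)) :=
    S.rapid_of_summable (conv_summable S.wν_add hws (conv_summable S.wν_add hws hws)) hκ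
  refine ⟨reκ xh, xh, ⟨hmem, hF, huniq⟩, fun j => ⟨congrFun hco j, hκ j⟩, fun κ => reSum t κ c,
    fun κ hκ' x => ?_, isPeriodicSolution_reSum hκ hc (hr _ hκ) hr3 hm hf,
    S.invariant_of_waveSum hκ heq (ofReal_reSum hc), fun κ => reSum t κ (potCoeff t κ c),
    fun κ hκ' => isPotential_reSum hκ' hc (hr κ hκ') hm,
    energy_stationary hκ hc hr (S.summable_Del_mul_sq hws) hh⟩
  simp only [hcoeff, t.wave_eq, ofReal_reSum hc x]
  exact hasSum_waveSum (hr κ hκ').summable x
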